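/- Let $D$ be a positive square-free integer and $C$ a positive divisor of $D$. For $g:\mathfrak H\to\mathbb C$ on the upper half plane and $\gamma=\begin{pmatrix}a&b\\c&d\end{pmatrix}\in GL_2^+(\mathbb R)$ put $(g|\gamma)(z)=\det(\gamma)(cz+d)^{-2}g(\gamma z)$. For $x=(x_1,x_2)\in(\mathbb Q/\mathbb Z)^2$ let $\phi_x$ be Hecke's weight-two Eisenstein series $$\phi_x(z)=\tfrac12\left(\langle x_1\rangle^2-\langle x_1\rangle+\tfrac16\right)-P_x(z)-P_{-x}(z)-\delta(x)\frac{i}{2\pi(z-\bar z)},\qquad P_x(z)=\sum_{k\in\mathbb Q_{>0},\,k\equiv x_1(1)}k\sum_{m\ge1}e^{2\pi i m(kz+x_2)},$$ where $\langle x_1\rangle\in[0,1)$ is the fractional part and $\delta(x)=1$ if $x=0$, $\delta(x)=0$ otherwise. Let $\mathcal E_2(\Gamma_0(DC),\mathbb C)$ be the space of Eisenstein series of weight two and level $\Gamma_0(DC)$, that is, the space of weight-two modular forms for $\Gamma_0(DC)$ which are finite $\mathbb C$-linear combinations of the $\phi_x$ with $x\ne0$. Let $\mathcal H(DC)$ be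 the set of triples $(M,L,\psi)$ where $M,L$ are positive divisors of $D$ with $M\ne1$ and $D\mid ML\mid DC$, and $\psi$ is a Dirichlet character modulo the greatest common divisor $(M,L)$. Let $f$ be the conductor of $\psi$; below, $\psi$ and $\psi^{-1}$ are evaluated through the primitive characters modulo $f$ (value $0$ at integers not prime to $f$). Let $g(\psi)=\sum_{a\in(\mathbb Z/f)^\times}\psi(a)e^{2\pi i a/f}$ and $$E_\psi=-\frac1{2g(\psi)}\sum_{a\in(\mathbb Z/f)^\times}\ \sum_{b\in(\mathbb Z/f^2)^\times}\psi(a)\psi(b)\,\phi_{(a/f,\,b/f^2)}.$$ For a prime $p\nmid f$ put $([p]^+_\psi g)(z)=g(z)-p\,\psi(p)g(pz)$ and $([p]^-_\psi g)(z)=g(z)-\psi^{-1}(p)g(pz)$; these operators commute, and for square-free $K$ prime to $f$ let $[K]^\pm_\psi$ be the composition of the $[p]^\pm_\psi$ over the primes $p\mid K$. Put $E_{M,L,\psi}=[L/f]^-_\psi\,[M/f]^+_\psi\,(E_\psi)$. For a prime $\ell$ the Hecke operator of level $\Gamma_0(DC)$ is $\mathcal T_\ell(g)=\sum_{k=0}^{\ell-1}g|\begin{pmatrix}1&k\\0&\ell\end{pmatrix}$,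 plus $g|\begin{pmatrix}\ell&0\\0&1\end{pmatrix}$ if $\ell\nmid DC$. Then: 1. For every $(M,L,\psi)\in\mathcal H(DC)$ the series $E_{M,L,\psi}$ is normalized: the coefficient $a_1$ of its Fourier expansion at $\infty$ in $q=e^{2\pi i z}$ is $1$. In particular $E_{M,L,\psi}\neq0$. 2. For every $(M,L,\psi)\in\mathcal H(DC)$ and every prime $\ell$, $$\mathcal T_\ell(E_{M,L,\psi})=\begin{cases}(\psi^{-1}(\ell)+\ell\psi(\ell))\,E_{M,L,\psi}&\text{if }\ell\nmid D,\\ \psi^{-1}(\ell)\,E_{M,L,\psi}&\text{if }\ell\mid \frac{M}{(M,L)},\\ \ell\psi(\ell)\,E_{M,L,\psi}&\text{if }\ell\mid\frac{L}{(M,L)},\\ 0&\text{if }\ell\mid(M,L).\end{cases}$$ 3. $\mathcal E_2(\Gamma_0(DC),\mathbb C)=\bigoplus_{(M,L,\psi)\in\mathcal H(DC)}\mathbb C\cdot E_{M,L,\psi}$; that is, the $E_{M,L,\psi}$ are linearly independent and span $\mathcal E_2(\Gamma_0(DC),\mathbb C)$. -/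

import Mathlib

open UpperHalfPlane ModularForm CongruenceSubgroup
open scoped MatrixGroups

noncomputable section

/-- The matrix with rows `(a, b)` and `(0, d)`, as an element of `GL₂(ℝ)`. -/
def upperGL (a b d : ℕ) (ha : a ≠ 0) (hd : d ≠ 0) : GL (Fin 2) ℝ :=
  Matrix.GeneralLinearGroup.mkOfDetNeZero !![(a : ℝ), (b : ℝ); 0, (d : ℝ)]
    (by simp [Matrix.det_fin_two_of, ha, hd])

/-- The operator `γ_p`, `g ↦ g | (p 0; 0 1)` in weight two, i.e. `z ↦ p * g (p z)`. -/
def gammaOp (p : ℕ) (hp : p.Prime) (g : ℍ → ℂ) : ℍ → ℂ :=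
  g ∣[(2 : ℤ)] upperGL p 0 1 hp.ne_zero one_ne_zero

/-- The `ℓ`-th Hecke operator of level `Γ₀(N)` in weight two, for a prime `ℓ`: the sum of the
`g | (1 k; 0 ℓ)` for `0 ≤ k < ℓ`, and of `g | (ℓ 0; 0 1)` when `ℓ ∤ N`. -/
def heckeOp (N ℓ : ℕ) (hℓ : ℓ.Prime) (g : ℍ → ℂ) : ℍ → ℂ :=
  (∑ k ∈ Finset.range ℓ, g ∣[(2 : ℤ)] upperGL 1 k ℓ one_ne_zero hℓ.ne_zero) +
    if ℓ ∣ N then 0 else gammaOp ℓ hℓ g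

/-- `x ∈ ℚ²` represents the zero element of `(ℚ/ℤ)²`. -/
def IsIntegralPair (x : ℚ × ℚ) : Prop :=
  (∃ m : ℤ, x.1 = m) ∧ ∃ n : ℤ, x.2 = n

/-- `P_x(z) = ∑ k ∑_{m ≥ 1} exp (2πi m (k z + x₂))`, over the rationals `k > 0` with
`k ≡ x₁ (mod 1)`. -/
def heckeP (x : ℚ × ℚ) (z : ℍ) : ℂ :=
  ∑' k : {k : ℚ // 0 < k ∧ ∃ n : ℤ, k = x.1 + n},
    ((k : ℚ) : ℂ) * ∑' m : ℕ+,
      Complex.exp (2 * Real.pi * Complex.I * (m : ℂ) * (((k : ℚ) : ℂ) * (z : ℂ) + (x.2 : ℂ)))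

open Classical in
/-- Hecke's weight two Eisenstein series `φ_x`. It depends only on the class of `x` in `(ℚ/ℤ)²`,
and is holomorphic when this class is not zero. -/
def heckePhi (x : ℚ × ℚ) (z : ℍ) : ℂ :=
  (1 / 2) * (((Int.fract x.1) ^ 2 - Int.fract x.1 + 1 / 6 : ℚ) : ℂ)
    - heckeP x z - heckeP (-x) z
    - (if IsIntegralPair x then 1 else 0) *
        (Complex.I / (2 * Real.pi * ((z : ℂ) - (starRingEnd ℂ) (z : ℂ))))

/-- The space of functions on the upper half plane that are weight two modular forms of level
`Γ₀(N)`. -/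
def modularFormSpace (N : ℕ) : Submodule ℂ (ℍ → ℂ) where
  carrier := {f | ∃ F : ModularForm (Gamma0 N) 2, (F : ℍ → ℂ) = f}
  add_mem' := by
    rintro _ _ ⟨F, rfl⟩ ⟨G, rfl⟩
    exact ⟨F + G, rfl⟩
  zero_mem' := ⟨0, rfl⟩
  smul_mem' := by
    rintro c _ ⟨F, rfl⟩
    exact ⟨c • F, rfl⟩

/-- The space `ℰ₂(Γ₀(N), ℂ)` of weight two Eisenstein series of level `Γ₀(N)`: the weight two
modular forms of level `Γ₀(N)` which are linear combinations of the holomorphic Eisenstein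
series `φ_x`, for `x` a non-zero element of `(ℚ/ℤ)²`. -/
def eisensteinSpace (N : ℕ) : Submodule ℂ (ℍ → ℂ) :=
  modularFormSpace N ⊓ Submodule.span ℂ {f | ∃ x : ℚ × ℚ, ¬ IsIntegralPair x ∧ f = heckePhi x}

section Character

variable {n : ℕ} (ψ : DirichletCharacter ℂ n)

/-- The value `ψ(m)` of the primitive character attached to `ψ`; it vanishes exactly when `m` is
not prime to the conductor of `ψ`. -/
def psiVal (m : ℕ) : ℂ := ψ.primitiveCharacter (m : ZMod ψ.conductor)

/-- The value `ψ⁻¹(m)` of the inverse of the primitive character attached to `ψ`. -/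
def psiInvVal (m : ℕ) : ℂ := ψ.primitiveCharacter⁻¹ (m : ZMod ψ.conductor)

/-- The operator `[p]⁺_ψ = 1 - ψ(p) γ_p`. -/
def plusOpPrime (p : ℕ) (hp : p.Prime) (g : ℍ → ℂ) : ℍ → ℂ :=
  g - psiVal ψ p • gammaOp p hp g

/-- The operator `[p]⁻_ψ = 1 - p⁻¹ ψ⁻¹(p) γ_p`. -/
def minusOpPrime (p : ℕ) (hp : p.Prime) (g : ℍ → ℂ) : ℍ → ℂ :=
  g - ((p : ℂ)⁻¹ * psiInvVal ψ p) • gammaOp p hp g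

/-- The operator `[M]⁺_ψ`, for `M` square-free and prime to the conductor of `ψ`: the composition
of the `[p]⁺_ψ` over the primes `p` dividing `M`. -/
def plusOp (M : ℕ) (g : ℍ → ℂ) : ℍ → ℂ :=
  M.primeFactorsList.attach.foldr
    (fun p h => plusOpPrime ψ p.1 (Nat.prime_of_mem_primeFactorsList p.2) h) g

/-- The operator `[M]⁻_ψ`, for `M` square-free and prime to the conductor of `ψ`: the composition
of the `[p]⁻_ψ` over the primes `p` dividing `M`. -/
def minusOp (M : ℕ) (g : ℍ → ℂ) : ℍ → ℂ :=
  M.primeFactorsList.attach.foldr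
    (fun p h => minusOpPrime ψ p.1 (Nat.prime_of_mem_primeFactorsList p.2) h) g

instance neZero_conductor [NeZero n] : NeZero ψ.conductor :=
  ⟨fun h => NeZero.ne n (Nat.eq_zero_of_zero_dvd (h ▸ ψ.conductor_dvd_level))⟩

/-- `E_ψ = -1/(2 g(ψ)) ∑_{a mod f} ∑_{b mod f²} ψ(a) ψ(b) φ_(a/f, b/f²)`, where `f` is the
conductor of `ψ`, the sums are over units, and `g(ψ)` is the Gauss sum. -/
def eisPsi [NeZero n] : ℍ → ℂ :=
  (-1 / (2 * gaussSum ψ.primitiveCharacter (ZMod.stdAddChar (N := ψ.conductor)))) •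
    ∑ a : (ZMod ψ.conductor)ˣ, ∑ b : (ZMod (ψ.conductor ^ 2))ˣ,
      (psiVal ψ (a : ZMod ψ.conductor).val * psiVal ψ (b : ZMod (ψ.conductor ^ 2)).val) •
        heckePhi (((a : ZMod ψ.conductor).val : ℚ) / (ψ.conductor : ℚ),
          ((b : ZMod (ψ.conductor ^ 2)).val : ℚ) / (ψ.conductor : ℚ) ^ 2)

end Character

/-- The set `ℋ(DC)` of triples `(M, L, ψ)`, where `M` and `L` are positive divisors of `D` with
`M ≠ 1` and `D ∣ M L ∣ D C`, and `ψ` is a Dirichlet character modulo `(M, L)`. -/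
structure EisIndex (D C : ℕ) where
  M : ℕ
  L : ℕ
  M_pos : 1 ≤ M
  L_pos : 1 ≤ L
  M_dvd : M ∣ D
  L_dvd : L ∣ D
  M_ne_one : M ≠ 1
  dvd_mul : D ∣ M * L
  mul_dvd : M * L ∣ D * C
  ψ : DirichletCharacter ℂ (Nat.gcd M L)

instance EisIndex.neZero_gcd {D C : ℕ} (t : EisIndex D C) : NeZero (Nat.gcd t.M t.L) :=
  ⟨(Nat.gcd_pos_of_pos_left _ t.M_pos).ne'⟩

/-- The Eisenstein series `E_{M,L,ψ} = [L/f]⁻_ψ ([M/f]⁺_ψ (E_ψ))`, with `f` the conductor of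
`ψ`. -/
def eisSeries {D C : ℕ} (t : EisIndex D C) : ℍ → ℂ :=
  minusOp t.ψ (t.L / t.ψ.conductor) (plusOp t.ψ (t.M / t.ψ.conductor) (eisPsi t.ψ))

end

/-! ### Double series `∑ n A(n) B(m) q^(nm)`. -/

noncomputable section

open Filter Topology

/-! Every series in play is a constant plus a multiple of `nonHol` plus a double series `dsum A B
z`, the sum of `n A(n) B(m) q^(nm)`. For `E_ψ` one has `A = ψ` and `B = ψ⁻¹` (`eisPsi_apply`). The
operator `[p]⁺` deletes the terms with `p ∣ n` and `[p]⁻` those with `p ∣ m`, so `E_{M,L,ψ}` has the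
sequences `ψ` and `ψ⁻¹` cut down to integers prime to `M/f` and `L/f`. As `M ≠ 1`, the
non-holomorphic part cancels (`EisIndex.hasDsum_eisSeries`). Normalization is then visible, and
complete multiplicativity of both sequences makes the series Hecke eigenfunctions (`dsum_eigen`,
`EisIndex.heckeOp_eisSeries`).

Modularity rests on `φ_x|γ = φ_{xγ}` for `x ≠ 0`: `φ_x` is a finite Fourier transform of division
values of the Weierstrass function (`heckeHol_eq_sum_wp`), whose behaviour under `SL(2, ℤ)` is a
reindexing of the lattice. Hence `E_ψ` has level `f²` if `f ≠ 1`, each operator at `p` multiplies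
the level by `p`, and the total is `ML` (`eisSeries_mem_heckeInvariants`).

Independence holds because the systems of eigenvalues differ: at `ℓ ∣ D` the absolute value is `0`,
`1` or `ℓ` and reveals `M` and `L`; at `ℓ ∤ D` the value `ψ(ℓ)` can be solved for
(`EisIndex.ext_of_eigenvalue`).

Spanning is a dimension count by constant terms at the cusps. A combination of the `φ_x` vanishing
at all cusps is zero (`eq_zero_of_tendsto_zero`). This is a maximum argument: for `ℓ ≡ 1` modulo the
level it has `T_ℓ`-eigenvalue `1 + ℓ`, the largest that boundedness of `|f| y` allows, which pushes
near-maxima up towards the cusp, where `|f| y` tends to `0`. The constant term at `∞` is redundant,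
since the trace to level one is zero (`eq_zero_of_tendsto_slash`). Finally the cusps other than `∞`
inject into the index set (`CuspRel.exists_mem_Gamma0`), so the dimension is at most the number of
the independent `E_{M,L,ψ}` (`span_eisSeries`). -/

/-- A bounded sequence of complex numbers. -/
def BddSeq (A : ℕ → ℂ) : Prop := ∃ K : ℝ, ∀ n, ‖A n‖ ≤ K

/-- The general term of `dsum`. -/
def dsumTerm (A B : ℕ → ℂ) (w : ℂ) (p : ℕ+ × ℕ+) : ℂ :=
  ((p.1 : ℕ) : ℂ) * A p.1 * B p.2 *
    Complex.exp (2 * Real.pi * Complex.I * (((p.1 : ℕ) : ℂ) * ((p.2 : ℕ) : ℂ)) * w)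

/-- The double series `∑ n A(n) B(m) exp (2πi n m w)` over positive integers `n`, `m`. -/
def dsum (A B : ℕ → ℂ) (w : ℂ) : ℂ := ∑' p : ℕ+ × ℕ+, dsumTerm A B w p

lemma norm_exp_two_pi_mul (t : ℕ) (w : ℂ) :
    ‖Complex.exp (2 * Real.pi * Complex.I * (t : ℂ) * w)‖ =
      Real.exp (-2 * Real.pi * w.im) ^ t := by
  rw [Complex.norm_exp, ← Real.exp_nat_mul]
  congr 1
  simp [Complex.mul_re, Complex.mul_im]
  ring

lemma norm_dsumTerm (A B : ℕ → ℂ) (w : ℂ) (p : ℕ+ × ℕ+) :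
    ‖dsumTerm A B w p‖ = (p.1 : ℕ) * ‖A p.1‖ * ‖B p.2‖ *
      Real.exp (-2 * Real.pi * w.im) ^ ((p.1 : ℕ) * (p.2 : ℕ)) := by
  rw [dsumTerm, ← Nat.cast_mul, norm_mul, norm_exp_two_pi_mul]
  simp

lemma summable_pnat_mul_pow {r : ℝ} (h0 : 0 ≤ r) (h1 : r < 1) :
    Summable fun p : ℕ+ × ℕ+ => ((p.1 : ℕ) : ℝ) * r ^ ((p.1 : ℕ) * (p.2 : ℕ)) := by
  have h := summable_prod_mul_pow (𝕜 := ℝ) 1 (r := r) (by rwa [Real.norm_of_nonneg h0])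
  refine (h.prod_symm).congr fun p => ?_
  simp [mul_comm]

lemma exp_neg_im_lt_one {w : ℂ} (hw : 0 < w.im) : Real.exp (-2 * Real.pi * w.im) < 1 := by
  rw [Real.exp_lt_one_iff]
  have := mul_pos Real.pi_pos hw
  nlinarith

lemma norm_dsumTerm_le {A B : ℕ → ℂ} {K K' : ℝ} (hA : ∀ n, ‖A n‖ ≤ K) (hB : ∀ n, ‖B n‖ ≤ K')
    (w : ℂ) (p : ℕ+ × ℕ+) :
    ‖dsumTerm A B w p‖ ≤ K * K' *
      (((p.1 : ℕ) : ℝ) * Real.exp (-2 * Real.pi * w.im) ^ ((p.1 : ℕ) * (p.2 : ℕ))) := by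
  rw [norm_dsumTerm]
  have h1 := mul_le_mul (hA p.1) (hB p.2) (norm_nonneg _) ((norm_nonneg _).trans (hA 0))
  have h2 : 0 ≤ ((p.1 : ℕ) : ℝ) * Real.exp (-2 * Real.pi * w.im) ^ ((p.1 : ℕ) * (p.2 : ℕ)) := by
    positivity
  calc _ = ‖A p.1‖ * ‖B p.2‖ *
      (((p.1 : ℕ) : ℝ) * Real.exp (-2 * Real.pi * w.im) ^ ((p.1 : ℕ) * (p.2 : ℕ))) := by ring
    _ ≤ _ := mul_le_mul_of_nonneg_right h1 h2

lemma summable_dsumTerm {A B : ℕ → ℂ} (hA : BddSeq A) (hB : BddSeq B) {w : ℂ} (hw : 0 < w.im) :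
    Summable (dsumTerm A B w) := by
  obtain ⟨K, hK⟩ := hA
  obtain ⟨K', hK'⟩ := hB
  exact Summable.of_norm_bounded
    ((summable_pnat_mul_pow (Real.exp_pos _).le (exp_neg_im_lt_one hw)).mul_left (K * K'))
    (norm_dsumTerm_le hK hK' w)

lemma BddSeq.ite {A : ℕ → ℂ} (hA : BddSeq A) (P : ℕ → Prop) [DecidablePred P] :
    BddSeq fun n => if P n then A n else 0 := by
  obtain ⟨K, hK⟩ := hA
  refine ⟨K, fun n => ?_⟩
  beta_reduce
  split_ifs
  · exact hK n
  · simpa using (norm_nonneg _).trans (hK 0)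

lemma BddSeq.const_mul {A : ℕ → ℂ} (hA : BddSeq A) (c : ℂ) : BddSeq fun n => c * A n := by
  obtain ⟨K, hK⟩ := hA
  refine ⟨‖c‖ * K, fun n => ?_⟩
  rw [norm_mul]
  exact mul_le_mul_of_nonneg_left (hK n) (norm_nonneg _)

lemma BddSeq.sub {A B : ℕ → ℂ} (hA : BddSeq A) (hB : BddSeq B) : BddSeq fun n => A n - B n := by
  obtain ⟨K, hK⟩ := hA
  obtain ⟨K', hK'⟩ := hB
  exact ⟨K + K', fun n => (norm_sub_le _ _).trans (add_le_add (hK n) (hK' n))⟩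

lemma BddSeq.comp {A : ℕ → ℂ} (hA : BddSeq A) (f : ℕ → ℕ) : BddSeq fun n => A (f n) :=
  hA.imp fun _ hK n => hK (f n)

lemma dsum_const_mul_left (A B : ℕ → ℂ) (c w : ℂ) :
    dsum (fun n => c * A n) B w = c * dsum A B w := by
  rw [dsum, dsum, ← tsum_mul_left]
  exact tsum_congr fun p => by simp only [dsumTerm]; ring

lemma dsum_const_mul_right (A B : ℕ → ℂ) (c w : ℂ) :
    dsum A (fun n => c * B n) w = c * dsum A B w := by
  rw [dsum, dsum, ← tsum_mul_left]
  exact tsum_congr fun p => by simp only [dsumTerm]; ring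

lemma dsum_sub_left {A A' B : ℕ → ℂ} (hA : BddSeq A) (hA' : BddSeq A') (hB : BddSeq B)
    {w : ℂ} (hw : 0 < w.im) :
    dsum (fun n => A n - A' n) B w = dsum A B w - dsum A' B w := by
  rw [dsum, dsum, dsum, ← (summable_dsumTerm hA hB hw).tsum_sub (summable_dsumTerm hA' hB hw)]
  exact tsum_congr fun p => by simp only [dsumTerm]; ring

lemma dsum_sub_right {A B B' : ℕ → ℂ} (hA : BddSeq A) (hB : BddSeq B) (hB' : BddSeq B')
    {w : ℂ} (hw : 0 < w.im) :
    dsum A (fun n => B n - B' n) w = dsum A B w - dsum A B' w := by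
  rw [dsum, dsum, dsum, ← (summable_dsumTerm hA hB hw).tsum_sub (summable_dsumTerm hA hB' hw)]
  exact tsum_congr fun p => by simp only [dsumTerm]; ring

lemma dsum_sum_sum {ι κ : Type*} (s : Finset ι) (t : Finset κ) (A : ι → ℕ → ℂ) (B : κ → ℕ → ℂ)
    (hA : ∀ i, BddSeq (A i)) (hB : ∀ j, BddSeq (B j)) {w : ℂ} (hw : 0 < w.im) :
    ∑ i ∈ s, ∑ j ∈ t, dsum (A i) (B j) w =
      dsum (fun n => ∑ i ∈ s, A i n) (fun m => ∑ j ∈ t, B j m) w := by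
  have h1 (i : ι) : ∑ j ∈ t, dsum (A i) (B j) w = dsum (A i) (fun m => ∑ j ∈ t, B j m) w := by
    simp only [dsum]
    rw [← Summable.tsum_finsetSum fun j _ => summable_dsumTerm (hA i) (hB j) hw]
    refine tsum_congr fun p => ?_
    simp only [dsumTerm, Finset.mul_sum, Finset.sum_mul]
  have hB' : BddSeq (fun m => ∑ j ∈ t, B j m) := by
    choose K hK using hB
    exact ⟨∑ j ∈ t, K j, fun n => (norm_sum_le _ _).trans (Finset.sum_le_sum fun j _ => hK j n)⟩
  simp only [h1]
  simp only [dsum]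
  rw [← Summable.tsum_finsetSum fun i _ => summable_dsumTerm (hA i) hB' hw]
  refine tsum_congr fun p => ?_
  simp only [dsumTerm, Finset.mul_sum, Finset.sum_mul]
  rw [Finset.sum_comm]

lemma dsum_sum_right {κ : Type*} (t : Finset κ) (A : ℕ → ℂ) (B : κ → ℕ → ℂ)
    (hA : BddSeq A) (hB : ∀ j, BddSeq (B j)) {w : ℂ} (hw : 0 < w.im) :
    ∑ j ∈ t, dsum A (B j) w = dsum A (fun m => ∑ j ∈ t, B j m) w := by
  simpa using dsum_sum_sum (Finset.univ : Finset Unit) t (fun _ => A) B (fun _ => hA) hB hw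

lemma dsum_congr {A A' B B' : ℕ → ℂ} (hA : ∀ n : ℕ, 0 < n → A n = A' n)
    (hB : ∀ n : ℕ, 0 < n → B n = B' n) (w : ℂ) : dsum A B w = dsum A' B' w :=
  tsum_congr fun p => by simp only [dsumTerm, hA p.1 p.1.pos, hB p.2 p.2.pos]

lemma tsum_pnat_prod_ite_dvd_left (ℓ : ℕ+) (F : ℕ+ × ℕ+ → ℂ)
    (hF : ∀ p, ¬ (ℓ : ℕ) ∣ (p.1 : ℕ) → F p = 0) : ∑' p, F p = ∑' p : ℕ+ × ℕ+, F (ℓ * p.1, p.2) := by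
  have hinj : Function.Injective fun p : ℕ+ × ℕ+ => (ℓ * p.1, p.2) := fun p q h => by
    simp only [Prod.mk.injEq, mul_right_inj] at h
    exact Prod.ext h.1 h.2
  refine (hinj.tsum_eq fun p hp => ?_).symm
  by_contra hcon
  refine hp (hF p fun hd => hcon ?_)
  obtain ⟨k, hk⟩ := PNat.dvd_iff.mpr hd
  exact ⟨(k, p.2), by simp [← hk]⟩

lemma tsum_pnat_prod_ite_dvd_right (ℓ : ℕ+) (F : ℕ+ × ℕ+ → ℂ)
    (hF : ∀ p, ¬ (ℓ : ℕ) ∣ (p.2 : ℕ) → F p = 0) : ∑' p, F p = ∑' p : ℕ+ × ℕ+, F (p.1, ℓ * p.2) := by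
  have h := tsum_pnat_prod_ite_dvd_left ℓ (fun p => F p.swap) fun p hp => hF _ hp
  rw [← (Equiv.prodComm ℕ+ ℕ+).tsum_eq F,
    ← (Equiv.prodComm ℕ+ ℕ+).tsum_eq fun p : ℕ+ × ℕ+ => F (p.1, ℓ * p.2)]
  simpa using h

lemma dsum_ite_dvd_left {ℓ : ℕ} (hℓ : 0 < ℓ) (A B : ℕ → ℂ) (w : ℂ) :
    dsum (fun n => if ℓ ∣ n then A n else 0) B w = ℓ * dsum (fun n => A (ℓ * n)) B (ℓ * w) := by
  rw [dsum, tsum_pnat_prod_ite_dvd_left ⟨ℓ, hℓ⟩ _ fun p hp => by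
    simp only [PNat.mk_coe] at hp; simp [dsumTerm, hp], dsum, ← tsum_mul_left]
  refine tsum_congr fun p => ?_
  have hmul : (((show ℕ+ from ⟨ℓ, hℓ⟩) * p.1 : ℕ+) : ℕ) = ℓ * p.1 := PNat.mul_coe _ _
  simp only [dsumTerm, hmul, dvd_mul_right, if_true, Nat.cast_mul]
  rw [show 2 * Real.pi * Complex.I * (((p.1 : ℕ) : ℂ) * ((p.2 : ℕ) : ℂ)) * (ℓ * w) =
    2 * Real.pi * Complex.I * (ℓ * ((p.1 : ℕ) : ℂ) * ((p.2 : ℕ) : ℂ)) * w by ring]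
  ring

lemma dsum_ite_dvd_right {ℓ : ℕ} (hℓ : 0 < ℓ) (A B : ℕ → ℂ) (w : ℂ) :
    dsum A (fun n => if ℓ ∣ n then B n else 0) w = dsum A (fun n => B (ℓ * n)) (ℓ * w) := by
  rw [dsum, tsum_pnat_prod_ite_dvd_right ⟨ℓ, hℓ⟩ _ fun p hp => by
    simp only [PNat.mk_coe] at hp; simp [dsumTerm, hp], dsum]
  refine tsum_congr fun p => ?_
  have hmul : (((show ℕ+ from ⟨ℓ, hℓ⟩) * p.2 : ℕ+) : ℕ) = ℓ * p.2 := PNat.mul_coe _ _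
  simp only [dsumTerm, hmul, dvd_mul_right, if_true, Nat.cast_mul]
  rw [show 2 * Real.pi * Complex.I * (((p.1 : ℕ) : ℂ) * ((p.2 : ℕ) : ℂ)) * (ℓ * w) =
    2 * Real.pi * Complex.I * (((p.1 : ℕ) : ℂ) * (ℓ * ((p.2 : ℕ) : ℂ))) * w by ring]

lemma sum_range_exp_div {ℓ : ℕ} (hℓ : 0 < ℓ) (t : ℕ) :
    ∑ k ∈ Finset.range ℓ, Complex.exp (2 * Real.pi * Complex.I * t * (k / ℓ : ℂ)) =
      if ℓ ∣ t then (ℓ : ℂ) else 0 := by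
  have hℓ' : (ℓ : ℂ) ≠ 0 := by exact_mod_cast hℓ.ne'
  have hζ := Complex.isPrimitiveRoot_exp ℓ hℓ.ne'
  have hpow (k : ℕ) : Complex.exp (2 * Real.pi * Complex.I * t * (k / ℓ : ℂ)) =
      (Complex.exp (2 * Real.pi * Complex.I / ℓ) ^ t) ^ k := by
    rw [← pow_mul, ← Complex.exp_nat_mul]
    congr 1
    push_cast
    field_simp
  simp only [hpow]
  split_ifs with h
  · rw [(hζ.pow_eq_one_iff_dvd t).mpr h]
    simp
  · have h1 : Complex.exp (2 * Real.pi * Complex.I / ℓ) ^ t ≠ 1 :=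
      fun h' => h ((hζ.pow_eq_one_iff_dvd t).mp h')
    rw [geom_sum_eq h1, ← pow_mul, mul_comm t, pow_mul, hζ.pow_eq_one]
    simp

/-- Averaging over the translates by `k / ℓ` keeps the terms with `ℓ ∣ n m`. As `ℓ` is prime this
means `ℓ ∣ n` or `ℓ ∣ m`, whence the inclusion-exclusion. -/
lemma sum_range_dsum_add_div {ℓ : ℕ} (hℓ : ℓ.Prime) {A B : ℕ → ℂ} (hA : BddSeq A)
    (hB : BddSeq B) {w : ℂ} (hw : 0 < w.im) :
    ∑ k ∈ Finset.range ℓ, dsum A B (w + k / ℓ) =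
      ℓ * (dsum (fun n => if ℓ ∣ n then A n else 0) B w +
        dsum A (fun m => if ℓ ∣ m then B m else 0) w -
        dsum (fun n => if ℓ ∣ n then A n else 0) (fun m => if ℓ ∣ m then B m else 0) w) := by
  have hA' : BddSeq fun n => if ℓ ∣ n then A n else 0 := hA.ite _
  have hB' : BddSeq fun n => if ℓ ∣ n then B n else 0 := hB.ite _
  have hwk (k : ℕ) : 0 < (w + k / ℓ).im := by
    have : ((k : ℂ) / ℓ).im = 0 := by simp [Complex.div_natCast_im]
    simpa [this] using hw
  simp only [dsum]
  rw [← Summable.tsum_finsetSum fun k _ => summable_dsumTerm hA hB (hwk k),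
    ← (summable_dsumTerm hA' hB hw).tsum_add (summable_dsumTerm hA hB' hw),
    ← ((summable_dsumTerm hA' hB hw).add (summable_dsumTerm hA hB' hw)).tsum_sub
      (summable_dsumTerm hA' hB' hw), ← tsum_mul_left]
  refine tsum_congr fun p => ?_
  have h1 (k : ℕ) : dsumTerm A B (w + k / ℓ) p = dsumTerm A B w p *
      Complex.exp (2 * Real.pi * Complex.I * ((p.1 * p.2 : ℕ) : ℂ) * (k / ℓ : ℂ)) := by
    simp only [dsumTerm, mul_add, Complex.exp_add]
    push_cast
    ring
  simp only [h1, ← Finset.mul_sum, sum_range_exp_div hℓ.pos, hℓ.dvd_mul]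
  by_cases ha : ℓ ∣ (p.1 : ℕ) <;> by_cases hb : ℓ ∣ (p.2 : ℕ) <;> simp [dsumTerm, ha, hb] <;> ring

/-- Each divisibility condition by `ℓ` rescales the argument by `ℓ`: one condition brings `w / ℓ`
back to `w`, both together lead to `ℓ * w`. The last term is what the `γ_ℓ` part of a Hecke operator
has to cancel. -/
lemma dsum_eigen {ℓ : ℕ} (hℓ : ℓ.Prime) {A B : ℕ → ℂ} (hA : BddSeq A) (hB : BddSeq B) {s t : ℂ}
    (hs : ∀ n, A (ℓ * n) = s * A n) (ht : ∀ n, B (ℓ * n) = t * B n) {w : ℂ} (hw : 0 < w.im) :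
    (ℓ : ℂ)⁻¹ * ∑ k ∈ Finset.range ℓ, dsum A B (w / ℓ + k / ℓ) =
      (ℓ * s + t) * dsum A B w - ℓ * s * t * dsum A B (ℓ * w) := by
  have hℓ' : (ℓ : ℂ) ≠ 0 := by exact_mod_cast hℓ.ne_zero
  have hw' : 0 < (w / ℓ).im := by
    rw [Complex.div_natCast_im]
    exact div_pos hw (by exact_mod_cast hℓ.pos)
  rw [sum_range_dsum_add_div hℓ hA hB hw', dsum_ite_dvd_left hℓ.pos, dsum_ite_dvd_right hℓ.pos,
    dsum_ite_dvd_left hℓ.pos, dsum_ite_dvd_right hℓ.pos]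
  simp only [hs, ht, dsum_const_mul_left, dsum_const_mul_right, mul_div_cancel₀ w hℓ']
  field_simp

lemma norm_dsumTerm_le_of_le {A B : ℕ → ℂ} {K K' : ℝ} (hA : ∀ n, ‖A n‖ ≤ K)
    (hB : ∀ n, ‖B n‖ ≤ K') {ε : ℝ} {w : ℂ} (hw : ε ≤ w.im) (p : ℕ+ × ℕ+) :
    ‖dsumTerm A B w p‖ ≤ K * K' *
      (((p.1 : ℕ) : ℝ) * Real.exp (-2 * Real.pi * ε) ^ ((p.1 : ℕ) * (p.2 : ℕ))) := by
  have hK : 0 ≤ K := (norm_nonneg _).trans (hA 0)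
  have hK' : 0 ≤ K' := (norm_nonneg _).trans (hB 0)
  refine (norm_dsumTerm_le hA hB w p).trans ?_
  have hexp : Real.exp (-2 * Real.pi * w.im) ≤ Real.exp (-2 * Real.pi * ε) := by
    rw [Real.exp_le_exp]
    nlinarith [Real.pi_pos]
  gcongr

lemma differentiableOn_dsum {A B : ℕ → ℂ} (hA : BddSeq A) (hB : BddSeq B) :
    DifferentiableOn ℂ (dsum A B) {w | 0 < w.im} := by
  obtain ⟨K, hK⟩ := hA
  obtain ⟨K', hK'⟩ := hB
  intro w₀ hw₀
  have hε : 0 < w₀.im / 2 := half_pos hw₀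
  have hopen : IsOpen {w : ℂ | w₀.im / 2 < w.im} := isOpen_lt continuous_const Complex.continuous_im
  have hsum : Summable fun p : ℕ+ × ℕ+ => K * K' *
      (((p.1 : ℕ) : ℝ) * Real.exp (-2 * Real.pi * (w₀.im / 2)) ^ ((p.1 : ℕ) * (p.2 : ℕ))) := by
    refine (summable_pnat_mul_pow (Real.exp_pos _).le ?_).mul_left _
    have := mul_pos Real.pi_pos hε
    rw [Real.exp_lt_one_iff]
    nlinarith
  have h := Complex.differentiableOn_tsum_of_summable_norm hsum
    (F := fun p w => dsumTerm A B w p) (U := {w : ℂ | w₀.im / 2 < w.im})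
    (fun p => by unfold dsumTerm; fun_prop) hopen
    (fun p w hw => norm_dsumTerm_le_of_le hK hK' (le_of_lt hw) p)
  have hmem : w₀ ∈ {w : ℂ | w₀.im / 2 < w.im} :=
    half_lt_self (show 0 < w₀.im from hw₀)
  exact (h.differentiableAt (hopen.mem_nhds hmem)).differentiableWithinAt

lemma tendsto_dsum {A B : ℕ → ℂ} (hA : BddSeq A) (hB : BddSeq B) :
    Tendsto (dsum A B) (comap Complex.im atTop) (𝓝 0) := by
  obtain ⟨K, hK⟩ := hA
  obtain ⟨K', hK'⟩ := hB
  have hev : ∀ᶠ w in comap Complex.im atTop, 1 ≤ w.im :=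
    tendsto_comap.eventually (eventually_ge_atTop 1)
  have hsum : Summable fun p : ℕ+ × ℕ+ => K * K' *
      (((p.1 : ℕ) : ℝ) * Real.exp (-2 * Real.pi * 1) ^ ((p.1 : ℕ) * (p.2 : ℕ))) := by
    refine (summable_pnat_mul_pow (Real.exp_pos _).le ?_).mul_left _
    rw [Real.exp_lt_one_iff]
    have := Real.pi_pos
    linarith
  have h := tendsto_tsum_of_dominated_convergence (𝓕 := comap Complex.im atTop)
    (f := fun w p => dsumTerm A B w p) (g := fun _ => 0) hsum (fun p => ?_)
    (hev.mono fun w hw p => norm_dsumTerm_le_of_le hK hK' hw p)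
  · rw [tsum_zero] at h
    exact h
  · rw [tendsto_zero_iff_norm_tendsto_zero]
    simp only [norm_dsumTerm]
    rw [← mul_zero (((p.1 : ℕ) : ℝ) * ‖A p.1‖ * ‖B p.2‖)]
    refine Tendsto.const_mul _ ?_
    have hlim : Tendsto (fun w : ℂ => Real.exp (-2 * Real.pi * w.im)) (comap Complex.im atTop)
        (𝓝 0) := Real.tendsto_exp_atBot.comp ?_
    · simpa [(mul_pos p.1.pos p.2.pos).ne'] using hlim.pow ((p.1 : ℕ) * (p.2 : ℕ))
    exact (tendsto_id.const_mul_atTop_of_neg (by linarith [Real.pi_pos])).comp tendsto_comap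

/-- The coefficient of `q ^ m` in `dsum A B`. -/
def dsumCoeff (A B : ℕ → ℂ) (m : ℕ) : ℂ :=
  ∑ d ∈ m.divisorsAntidiagonal, (d.1 : ℂ) * A d.1 * B d.2

/-- Absolute convergence permits collecting the pairs by their product. -/
lemma hasSum_dsumCoeff {A B : ℕ → ℂ} (hA : BddSeq A) (hB : BddSeq B) {w : ℂ} (hw : 0 < w.im) :
    HasSum (fun m => dsumCoeff A B m * Complex.exp (2 * Real.pi * Complex.I * w) ^ m)
      (dsum A B w) := by
  have h1 := sigmaAntidiagonalEquivProd.hasSum_iff.mpr (summable_dsumTerm hA hB hw).hasSum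
  have h2 := h1.sigma fun n => hasSum_fintype _
  have h3 : HasSum (fun n : ℕ+ => dsumCoeff A B n *
      Complex.exp (2 * Real.pi * Complex.I * w) ^ (n : ℕ)) (dsum A B w) := by
    refine h2.congr_fun fun n => ?_
    rw [dsumCoeff, Finset.sum_mul, ← Finset.sum_coe_sort]
    refine Finset.sum_congr rfl fun d _ => ?_
    have hd := (Nat.mem_divisorsAntidiagonal.mp d.2).1
    simp only [Function.comp_apply, dsumTerm, sigmaAntidiagonalEquivProd,
      divisorsAntidiagonalFactors, Equiv.coe_fn_mk, PNat.mk_coe]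
    have hd' : ((n : ℕ) : ℂ) = (d.1.1 : ℂ) * (d.1.2 : ℂ) := by exact_mod_cast hd.symm
    rw [← Complex.exp_nat_mul, hd']
    congr 2
    ring
  refine (Function.Injective.hasSum_iff PNat.coe_injective fun m hm => ?_).mp h3
  have : m = 0 := by
    by_contra h0
    exact hm ⟨⟨m, Nat.pos_of_ne_zero h0⟩, rfl⟩
  simp [this, dsumCoeff]

end


/-! ### Fourier expansions, distribution relations and Hecke eigenvalues of the `φ_x`. -/

noncomputable section

open Filter Topology

/-- The indicator function of a residue class modulo `N`. -/
def resInd {N : ℕ} (a : ZMod N) (n : ℕ) : ℂ := if (n : ZMod N) = a then 1 else 0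

/-- The sequence `m ↦ exp (2πi m y)`. -/
def expSeq (y : ℚ) (m : ℕ) : ℂ := Complex.exp (2 * Real.pi * Complex.I * m * y)

lemma bddSeq_resInd {N : ℕ} (a : ZMod N) : BddSeq (resInd a) :=
  ⟨1, fun n => by unfold resInd; split_ifs <;> simp⟩

lemma norm_expSeq (y : ℚ) (m : ℕ) : ‖expSeq y m‖ = 1 := by
  rw [expSeq, show 2 * (Real.pi : ℂ) * Complex.I * m * y =
    ((2 * Real.pi * m * y : ℝ) : ℂ) * Complex.I by push_cast; ring, Complex.norm_exp_ofReal_mul_I]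

lemma bddSeq_expSeq (y : ℚ) : BddSeq (expSeq y) := ⟨1, fun m => (norm_expSeq y m).le⟩

lemma expSeq_add (y y' : ℚ) (m : ℕ) : expSeq (y + y') m = expSeq y m * expSeq y' m := by
  simp only [expSeq, ← Complex.exp_add]
  push_cast
  ring_nf

lemma expSeq_int (n : ℤ) (m : ℕ) : expSeq n m = 1 := by
  rw [expSeq, Complex.exp_eq_one_iff]
  exact ⟨m * n, by push_cast; ring⟩

lemma expSeq_add_int (y : ℚ) (n : ℤ) : expSeq (y + n) = expSeq y := by
  ext m
  rw [expSeq_add, expSeq_int, mul_one]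

lemma expSeq_mul (y : ℚ) (ℓ m : ℕ) : expSeq y (ℓ * m) = expSeq (ℓ * y) m := by
  simp only [expSeq]
  push_cast
  ring_nf

/-- The holomorphic part of Hecke's Eisenstein series `φ_x`. -/
def heckeHol (x : ℚ × ℚ) (z : ℍ) : ℂ :=
  (1 / 2) * (((Int.fract x.1) ^ 2 - Int.fract x.1 + 1 / 6 : ℚ) : ℂ) - heckeP x z - heckeP (-x) z

/-- The non-holomorphic function occurring in `φ_0`. -/
def nonHol (z : ℍ) : ℂ := Complex.I / (2 * Real.pi * ((z : ℂ) - (starRingEnd ℂ) (z : ℂ)))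

lemma heckePhi_of_not_integral {x : ℚ × ℚ} (hx : ¬ IsIntegralPair x) :
    heckePhi x = heckeHol x := by
  ext z
  simp [heckePhi, heckeHol, hx]

lemma heckePhi_of_integral {x : ℚ × ℚ} (hx : IsIntegralPair x) :
    heckePhi x = heckeHol x - nonHol := by
  ext z
  simp [heckePhi, heckeHol, hx, nonHol]

lemma im_div_nat_pos (z : ℍ) {N : ℕ} (hN : 0 < N) : 0 < ((z : ℂ) / N).im := by
  rw [Complex.div_natCast_im]
  exact div_pos z.im_pos (by exact_mod_cast hN)

/-- The rationals `k > 0` with `k ≡ a / N` are the `n / N` with `n > 0` and `n ≡ a` modulo `N`; this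
turns the inner sum over `k` into one over all `n` weighted by a residue indicator. -/
lemma heckeP_eq_dsum {N : ℕ} (hN : 0 < N) (a : ℤ) (y : ℚ) (z : ℍ) :
    heckeP ((a : ℚ) / N, y) z =
      (N : ℂ)⁻¹ * dsum (resInd (a : ZMod N)) (expSeq y) ((z : ℂ) / N) := by
  have hN' : (N : ℂ) ≠ 0 := by exact_mod_cast hN.ne'
  have hNq : (N : ℚ) ≠ 0 := by exact_mod_cast hN.ne'
  set S : Set ℕ+ := {n | ((n : ℕ) : ZMod N) = (a : ZMod N)} with hS
  let f : S → {k : ℚ // 0 < k ∧ ∃ n : ℤ, k = ((a : ℚ) / N, y).1 + n} := fun n =>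
    ⟨((n.1 : ℕ) : ℚ) / N, by have := n.1.pos; positivity, by
      have h := n.2
      simp only [hS, Set.mem_ofPred_eq] at h
      have h' : (((n.1 : ℕ) : ℤ) : ZMod N) = (a : ZMod N) := by exact_mod_cast h
      obtain ⟨c, hc⟩ := (ZMod.intCast_eq_intCast_iff_dvd_sub _ _ _).mp h'.symm
      refine ⟨c, ?_⟩
      have hc' : (((n.1 : ℕ) : ℚ)) - a = N * c := by exact_mod_cast hc
      simp only
      field_simp
      linarith⟩
  have hf : Function.Bijective f := by
    constructor
    · intro m n h
      have h1 : ((m.1 : ℕ) : ℚ) / N = ((n.1 : ℕ) : ℚ) / N := congrArg Subtype.val h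
      rw [div_left_inj' hNq] at h1
      exact Subtype.ext (PNat.coe_injective (by exact_mod_cast h1))
    · rintro ⟨k, hk, c, hc⟩
      have hkN : k * N = ((a + N * c : ℤ) : ℚ) := by
        rw [hc]; push_cast; field_simp
      have hpos : (0 : ℚ) < ((a + N * c : ℤ) : ℚ) := hkN ▸ mul_pos hk (by positivity)
      have hpos' : 0 < a + N * c := by exact_mod_cast hpos
      obtain ⟨n, hn⟩ := Int.eq_ofNat_of_zero_le hpos'.le
      have hn0 : 0 < n := by omega
      refine ⟨⟨⟨n, hn0⟩, ?_⟩, ?_⟩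
      · have : ((n : ℤ) : ZMod N) = ((a + N * c : ℤ) : ZMod N) := by rw [hn]
        push_cast at this
        show ((n : ℕ) : ZMod N) = (a : ZMod N)
        simpa using this
      · apply Subtype.ext
        simp only [f, PNat.mk_coe]
        rw [div_eq_iff hNq, hkN, hn]
        rfl
  rw [heckeP, ← (Equiv.ofBijective f hf).tsum_eq, dsum,
    (summable_dsumTerm (bddSeq_resInd _) (bddSeq_expSeq y) (im_div_nat_pos z hN)).tsum_prod,
    ← tsum_mul_left]
  rw [show (∑' n : ℕ+, (N : ℂ)⁻¹ * ∑' m : ℕ+, dsumTerm (resInd (a : ZMod N)) (expSeq y)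
      ((z : ℂ) / N) (n, m)) = ∑' n : ℕ+, S.indicator (fun n : ℕ+ => (((n : ℕ) : ℂ) / N) *
        ∑' m : ℕ+, Complex.exp (2 * Real.pi * Complex.I * ((m : ℕ) : ℂ) *
          ((((n : ℕ) : ℂ) / N) * (z : ℂ) + (y : ℂ)))) n from ?_, ← tsum_subtype]
  · refine tsum_congr fun n => ?_
    simp [f]
  · refine tsum_congr fun n => ?_
    by_cases hn : ((n : ℕ) : ZMod N) = (a : ZMod N)
    · rw [Set.indicator_of_mem (by exact hn), ← tsum_mul_left, ← tsum_mul_left]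
      refine tsum_congr fun m => ?_
      simp only [dsumTerm, resInd, hn, if_true, expSeq, mul_one]
      rw [mul_add, Complex.exp_add]
      have : 2 * (Real.pi : ℂ) * Complex.I * (((n : ℕ) : ℂ) * ((m : ℕ) : ℂ)) * ((z : ℂ) / N) =
        2 * Real.pi * Complex.I * ((m : ℕ) : ℂ) * (((n : ℕ) : ℂ) / N * (z : ℂ)) := by ring
      rw [this]
      ring
    · rw [Set.indicator_of_notMem (by exact hn)]
      simp [dsumTerm, resInd, hn]

lemma heckeHol_eq_dsum {N : ℕ} (hN : 0 < N) (a : ℤ) (y : ℚ) (z : ℍ) :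
    heckeHol ((a : ℚ) / N, y) z =
      (1 / 2) * (((Int.fract ((a : ℚ) / N)) ^ 2 - Int.fract ((a : ℚ) / N) + 1 / 6 : ℚ) : ℂ) -
      (N : ℂ)⁻¹ * (dsum (resInd (a : ZMod N)) (expSeq y) ((z : ℂ) / N) +
        dsum (resInd (-a : ZMod N)) (expSeq (-y)) ((z : ℂ) / N)) := by
  have h : -((a : ℚ) / N, y) = (((-a : ℤ) : ℚ) / N, -y) := by
    ext <;> simp [neg_div]
  rw [heckeHol, h, heckeP_eq_dsum hN, heckeP_eq_dsum hN]
  push_cast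
  ring

lemma exists_common_denom (x : ℚ × ℚ) :
    ∃ N : ℕ, 0 < N ∧ ∃ a b : ℤ, x = ((a : ℚ) / N, (b : ℚ) / N) := by
  refine ⟨x.1.den * x.2.den, Nat.mul_pos x.1.den_pos x.2.den_pos, x.1.num * x.2.den,
    x.2.num * x.1.den, ?_⟩
  have h1 : (x.1.den : ℚ) ≠ 0 := by exact_mod_cast x.1.den_pos.ne'
  have h2 : (x.2.den : ℚ) ≠ 0 := by exact_mod_cast x.2.den_pos.ne'
  ext
  · push_cast
    rw [mul_div_mul_right _ _ h2, Rat.num_div_den]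
  · push_cast
    rw [mul_comm (x.1.den : ℚ), mul_div_mul_right _ _ h1, Rat.num_div_den]

lemma heckeHol_add_int (x : ℚ × ℚ) (m n : ℤ) : heckeHol (x.1 + m, x.2 + n) = heckeHol x := by
  obtain ⟨N, hN, a, b, rfl⟩ := exists_common_denom x
  have hNq : (N : ℚ) ≠ 0 := by exact_mod_cast hN.ne'
  ext z
  have h1 : (a : ℚ) / N + m = ((a + N * m : ℤ) : ℚ) / N := by push_cast; field_simp
  have h2 : Int.fract (((a + N * m : ℤ) : ℚ) / N) = Int.fract ((a : ℚ) / N) := by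
    rw [← h1, Int.fract_add_intCast]
  have h3 : -((b : ℚ) / N + n) = -((b : ℚ) / N) + (-n : ℤ) := by push_cast; ring
  rw [h1, heckeHol_eq_dsum hN, heckeHol_eq_dsum hN, h2, h3, expSeq_add_int, expSeq_add_int]
  simp

lemma isIntegralPair_div_iff {N : ℕ} (hN : 0 < N) (a b : ℤ) :
    IsIntegralPair ((a : ℚ) / N, (b : ℚ) / N) ↔ ((a : ZMod N) = 0 ∧ (b : ZMod N) = 0) := by
  have hNq : (N : ℚ) ≠ 0 := by exact_mod_cast hN.ne'
  have key (a : ℤ) : (∃ m : ℤ, (a : ℚ) / N = m) ↔ (a : ZMod N) = 0 := by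
    rw [ZMod.intCast_zmod_eq_zero_iff_dvd]
    constructor
    · rintro ⟨m, hm⟩
      rw [div_eq_iff hNq] at hm
      exact ⟨m, by rw [mul_comm]; exact_mod_cast hm⟩
    · rintro ⟨m, rfl⟩
      exact ⟨m, by push_cast; field_simp⟩
  simp [IsIntegralPair, key]

lemma slash_upperGL (g : ℍ → ℂ) (a b d : ℕ) (ha : a ≠ 0) (hd : d ≠ 0) (z w : ℍ)
    (hw : (w : ℂ) = (a * z + b) / d) :
    (g ∣[(2 : ℤ)] upperGL a b d ha hd) z = (a / d : ℂ) * g w := by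
  have hdet : (upperGL a b d ha hd).det.val = (a : ℝ) * d := by
    simp [upperGL, Matrix.GeneralLinearGroup.mkOfDetNeZero, Matrix.det_fin_two_of]
  have hpos : 0 < (upperGL a b d ha hd).det.val := by
    rw [hdet]
    have := Nat.pos_of_ne_zero ha
    have := Nat.pos_of_ne_zero hd
    positivity
  have hw' : upperGL a b d ha hd • z = w := by
    apply UpperHalfPlane.ext
    rw [UpperHalfPlane.coe_smul_of_det_pos hpos, hw]
    simp [upperGL, Matrix.GeneralLinearGroup.mkOfDetNeZero, UpperHalfPlane.num,
      UpperHalfPlane.denom]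
  have hσ : UpperHalfPlane.σ (upperGL a b d ha hd) = ContinuousAlgEquiv.refl ℝ ℂ := by
    rw [UpperHalfPlane.σ, if_pos hpos]
  have hden : UpperHalfPlane.denom (upperGL a b d ha hd) z = d := by
    simp [upperGL, Matrix.GeneralLinearGroup.mkOfDetNeZero, UpperHalfPlane.denom]
  rw [ModularForm.slash_apply, hw', hσ, hden, abs_of_pos hpos, hdet]
  have hd' : (d : ℂ) ≠ 0 := by exact_mod_cast hd
  simp only [ContinuousAlgEquiv.refl_apply]
  norm_num
  field_simp

/-- The point `p z` of the upper half plane. -/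
def natMul (p : ℕ) (hp : 0 < p) (z : ℍ) : ℍ :=
  ⟨p * z, by simpa using mul_pos (by exact_mod_cast hp : (0 : ℝ) < p) z.im_pos⟩

/-- The point `(z + t) / ℓ` of the upper half plane. -/
def addDiv (ℓ : ℕ) (hℓ : 0 < ℓ) (t : ℕ) (z : ℍ) : ℍ :=
  ⟨(z + t) / ℓ, by
    rw [Complex.div_natCast_im]
    exact div_pos (by simpa using z.im_pos) (by exact_mod_cast hℓ)⟩

@[simp] lemma coe_natMul (p : ℕ) (hp : 0 < p) (z : ℍ) : (natMul p hp z : ℂ) = p * z := rfl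

@[simp] lemma coe_addDiv (ℓ : ℕ) (hℓ : 0 < ℓ) (t : ℕ) (z : ℍ) :
    (addDiv ℓ hℓ t z : ℂ) = (z + t) / ℓ := rfl

lemma gammaOp_apply (p : ℕ) (hp : p.Prime) (g : ℍ → ℂ) (z : ℍ) :
    gammaOp p hp g z = p * g (natMul p hp.pos z) := by
  rw [gammaOp, slash_upperGL g p 0 1 _ _ z (natMul p hp.pos z) (by simp)]
  simp

/-- Homogeneity of degree `-1` compensates the factor `p`. This is why a factor `1 - γ_p` removes
the non-holomorphic part. -/
lemma gammaOp_nonHol (p : ℕ) (hp : p.Prime) : gammaOp p hp nonHol = nonHol := by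
  ext z
  have hp' : (p : ℂ) ≠ 0 := by exact_mod_cast hp.ne_zero
  rw [gammaOp_apply]
  simp only [nonHol, coe_natMul, map_mul, map_natCast]
  rw [show 2 * (Real.pi : ℂ) * (p * (z : ℂ) - p * (starRingEnd ℂ) (z : ℂ)) =
    p * (2 * Real.pi * ((z : ℂ) - (starRingEnd ℂ) (z : ℂ))) by ring, mul_div_assoc',
    mul_div_mul_left _ _ hp']

lemma gammaOp_add (p : ℕ) (hp : p.Prime) (g h : ℍ → ℂ) :
    gammaOp p hp (g + h) = gammaOp p hp g + gammaOp p hp h := by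
  ext z
  simp [gammaOp_apply, mul_add]

lemma gammaOp_smul (p : ℕ) (hp : p.Prime) (c : ℂ) (g : ℍ → ℂ) :
    gammaOp p hp (c • g) = c • gammaOp p hp g := by
  ext z
  simp [gammaOp_apply]
  ring

lemma sum_range_expSeq {p : ℕ} (hp : 0 < p) (y : ℚ) (m : ℕ) :
    ∑ j ∈ Finset.range p, expSeq ((y + j) / p) m =
      p * (if p ∣ m then expSeq (y / p) m else 0) := by
  have h (j : ℕ) : expSeq ((y + j) / p) m = expSeq (y / p) m *
      Complex.exp (2 * Real.pi * Complex.I * m * (j / p : ℂ)) := by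
    rw [add_div, expSeq_add]
    simp [expSeq]
  simp only [h, ← Finset.mul_sum, sum_range_exp_div hp]
  split_ifs <;> ring

lemma sum_range_expSeq_neg {p : ℕ} (hp : 0 < p) (y : ℚ) (m : ℕ) :
    ∑ j ∈ Finset.range p, expSeq (-((y + j) / p)) m =
      p * (if p ∣ m then expSeq (-y / p) m else 0) := by
  have h1 := sum_range_expSeq hp y m
  have hconj (y : ℚ) (m : ℕ) : expSeq (-y) m = (starRingEnd ℂ) (expSeq y m) := by
    simp only [expSeq, ← Complex.exp_conj, map_mul, Complex.conj_ofReal, Complex.conj_I,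
      map_natCast, map_ratCast, Complex.conj_ofNat]
    push_cast
    ring_nf
  simp only [hconj, neg_div, ← map_sum, h1]
  split_ifs <;> simp

/-- The distribution relation: summing the characters `exp (2πi m (x₂ + j) / p)` over `j` leaves `p`
times the terms with `p ∣ m`, that is, the same series at `p z`. -/
lemma gammaOp_heckeHol (p : ℕ) (hp : p.Prime) (x : ℚ × ℚ) :
    gammaOp p hp (heckeHol x) = ∑ j ∈ Finset.range p, heckeHol (x.1, (x.2 + j) / p) := by
  obtain ⟨N, hN, a, b, rfl⟩ := exists_common_denom x
  ext z
  have hz := im_div_nat_pos z hN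
  have hp' : (p : ℚ) ≠ 0 := by exact_mod_cast hp.ne_zero
  rw [gammaOp_apply, heckeHol_eq_dsum hN, Finset.sum_apply]
  simp only [heckeHol_eq_dsum hN, Finset.sum_sub_distrib, ← Finset.mul_sum,
    Finset.sum_add_distrib]
  rw [dsum_sum_right _ _ _ (bddSeq_resInd _) (fun j => bddSeq_expSeq _) hz,
    dsum_sum_right _ _ _ (bddSeq_resInd _) (fun j => bddSeq_expSeq _) hz]
  simp only [sum_range_expSeq hp.pos, sum_range_expSeq_neg hp.pos, dsum_const_mul_right,
    dsum_ite_dvd_right hp.pos, expSeq_mul, mul_div_cancel₀ _ hp', coe_natMul, mul_div_assoc]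
  simp only [Finset.sum_const, Finset.card_range, nsmul_eq_mul]
  ring

lemma resInd_mul {N ℓ : ℕ} (h : (ℓ : ZMod N) = 1) (a : ZMod N) (n : ℕ) :
    resInd a (ℓ * n) = resInd a n := by
  simp [resInd, h]

lemma expSeq_div_mul {N ℓ : ℕ} (hN : 0 < N) (h : (ℓ : ZMod N) = 1) (b : ℤ) (m : ℕ) :
    expSeq ((b : ℚ) / N) (ℓ * m) = expSeq ((b : ℚ) / N) m := by
  have hNq : (N : ℚ) ≠ 0 := by exact_mod_cast hN.ne'
  have h' : ((ℓ : ℤ) : ZMod N) = ((1 : ℤ) : ZMod N) := by simpa using h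
  obtain ⟨c, hc⟩ := (ZMod.intCast_eq_intCast_iff_dvd_sub _ _ _).mp h'.symm
  have hc' : (ℓ : ℚ) - 1 = N * c := by exact_mod_cast hc
  rw [expSeq_mul, show (ℓ : ℚ) * ((b : ℚ) / N) = (b : ℚ) / N + ((c * b : ℤ) : ℚ) by
    rw [show (ℓ : ℚ) = 1 + N * c by linarith]; push_cast; field_simp, expSeq_add_int]

/-- Hecke eigenvalue property of `φ_x`, `N x = 0`, for primes congruent to `1` modulo `N`. -/
lemma heckeHol_hecke_eigen {N ℓ : ℕ} (hN : 0 < N) (hℓ : ℓ.Prime) (h : (ℓ : ZMod N) = 1) (a b : ℤ)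
    (z : ℍ) :
    (ℓ : ℂ)⁻¹ * ∑ k ∈ Finset.range ℓ, heckeHol ((a : ℚ) / N, (b : ℚ) / N)
        (addDiv ℓ hℓ.pos (N * k) z) +
      ℓ * heckeHol ((a : ℚ) / N, (b : ℚ) / N) (natMul ℓ hℓ.pos z) =
      (1 + ℓ) * heckeHol ((a : ℚ) / N, (b : ℚ) / N) z := by
  have hN' : (N : ℂ) ≠ 0 := by exact_mod_cast hN.ne'
  have hℓ' : (ℓ : ℂ) ≠ 0 := by exact_mod_cast hℓ.ne_zero
  have hz := im_div_nat_pos z hN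
  -- The series lives in the variable `z / N`, so the translations must be by multiples of `N` to
  -- become `k / ℓ` there.
  have hpt (k : ℕ) : (addDiv ℓ hℓ.pos (N * k) z : ℂ) / N = (z / N) / ℓ + k / ℓ := by
    rw [coe_addDiv]; push_cast; field_simp
  have e1 := dsum_eigen hℓ (s := 1) (t := 1) (bddSeq_resInd (a : ZMod N))
    (bddSeq_expSeq ((b : ℚ) / N)) (fun n => by rw [resInd_mul h, one_mul])
    (fun n => by rw [expSeq_div_mul hN h, one_mul]) hz
  have e2 := dsum_eigen hℓ (s := 1) (t := 1) (bddSeq_resInd (-a : ZMod N))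
    (bddSeq_expSeq (-((b : ℚ) / N))) (fun n => by rw [resInd_mul h, one_mul])
    (fun n => by
      have := expSeq_div_mul hN h (-b) n
      push_cast [neg_div] at this
      rw [this, one_mul]) hz
  simp only [heckeHol_eq_dsum hN, hpt, coe_natMul, Finset.sum_sub_distrib, ← Finset.mul_sum,
    Finset.sum_add_distrib, Finset.sum_const, Finset.card_range, nsmul_eq_mul, mul_div_assoc]
  generalize (((Int.fract ((a : ℚ) / N)) ^ 2 - Int.fract ((a : ℚ) / N) + 1 / 6 : ℚ) : ℂ) = K
  linear_combination (-(N : ℂ)⁻¹) * e1 + (-(N : ℂ)⁻¹) * e2 + (1 / 2 * K) * inv_mul_cancel₀ hℓ'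

lemma tendsto_heckeHol (x : ℚ × ℚ) : Tendsto (heckeHol x) atImInfty
    (𝓝 ((1 / 2) * (((Int.fract x.1) ^ 2 - Int.fract x.1 + 1 / 6 : ℚ) : ℂ))) := by
  obtain ⟨N, hN, a, b, rfl⟩ := exists_common_denom x
  have hlim : Tendsto (fun z : ℍ => (z : ℂ) / N) atImInfty (comap Complex.im atTop) := by
    rw [tendsto_comap_iff]
    have : Complex.im ∘ (fun z : ℍ => (z : ℂ) / N) = fun z : ℍ => z.im / N := by
      ext z; simp [Complex.div_natCast_im]
    rw [this]
    exact Tendsto.atTop_div_const (by exact_mod_cast hN) tendsto_comap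
  have e : heckeHol ((a : ℚ) / N, (b : ℚ) / N) = _ := funext (heckeHol_eq_dsum hN a ((b : ℚ) / N))
  have h1 := (tendsto_dsum (bddSeq_resInd (a : ZMod N)) (bddSeq_expSeq ((b : ℚ) / N))).comp hlim
  have h2 := (tendsto_dsum (bddSeq_resInd (-a : ZMod N)) (bddSeq_expSeq (-((b : ℚ) / N)))).comp hlim
  rw [e]
  generalize (1 / 2) * (((Int.fract ((a : ℚ) / N)) ^ 2 - Int.fract ((a : ℚ) / N) + 1 / 6 : ℚ) : ℂ)
    = K
  have h3 := ((h1.add h2).const_mul (N : ℂ)⁻¹).const_sub K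
  rw [add_zero, mul_zero, sub_zero] at h3
  exact h3

open scoped Manifold ContDiff in
lemma mdifferentiable_heckeHol (x : ℚ × ℚ) : MDiff (heckeHol x) := by
  obtain ⟨N, hN, a, b, rfl⟩ := exists_common_denom x
  rw [UpperHalfPlane.mdifferentiable_iff]
  have hmaps : Set.MapsTo (fun w : ℂ => w / N) {w : ℂ | 0 < w.im} {w : ℂ | 0 < w.im} := by
    intro w hw
    simp only [Set.mem_ofPred_eq, Complex.div_natCast_im] at hw ⊢
    exact div_pos hw (by exact_mod_cast hN)
  have hd : DifferentiableOn ℂ (fun w : ℂ => w / N) {w : ℂ | 0 < w.im} := by fun_prop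
  have h1 := (differentiableOn_dsum (bddSeq_resInd (a : ZMod N))
    (bddSeq_expSeq ((b : ℚ) / N))).comp hd hmaps
  have h2 := (differentiableOn_dsum (bddSeq_resInd (-a : ZMod N))
    (bddSeq_expSeq (-((b : ℚ) / N)))).comp hd hmaps
  refine (((h1.add h2).const_mul (N : ℂ)⁻¹).const_sub
    ((1 / 2) * (((Int.fract ((a : ℚ) / N)) ^ 2 - Int.fract ((a : ℚ) / N) + 1 / 6 : ℚ) :
      ℂ))).congr fun w hw => ?_
  rw [Function.comp_apply, heckeHol_eq_dsum hN, ofComplex_apply_of_im_pos hw]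
  rfl

end


/-! ### The Weierstrass function and the transformation law `φ_x|γ = φ_{xγ}`. -/

noncomputable section

open Filter Topology

/-- The period pair `(z, 1)` attached to a point of the upper half plane. -/
def tauPair (z : ℍ) : PeriodPair where
  ω₁ := z
  ω₂ := 1
  indep := by
    rw [LinearIndependent.pair_iff]
    intro s t h
    have him := congrArg Complex.im h
    simp only [Complex.real_smul, Complex.add_im, Complex.mul_im, Complex.ofReal_re,
      Complex.ofReal_im, zero_mul, add_zero, mul_one,
      Complex.zero_im] at him
    have hs : s = 0 := by
      rcases mul_eq_zero.mp him with h | h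
      · exact h
      · exact absurd h z.im_pos.ne'
    subst hs
    simpa using h

/-- The Weierstrass function of the lattice `ℤ z + ℤ`. -/
def wp (z : ℍ) (u : ℂ) : ℂ := PeriodPair.weierstrassP (tauPair z) u

lemma hasSum_wp (z : ℍ) (u : ℂ) :
    HasSum (fun q : ℤ × ℤ => 1 / (u - (q.1 * z + q.2)) ^ 2 - 1 / ((q.1 : ℂ) * z + q.2) ^ 2)
      (wp z u) := by
  have h := (tauPair z).hasSum_weierstrassP u
  rw [← (tauPair z).latticeEquivProd.symm.toEquiv.hasSum_iff] at h
  refine h.congr_fun fun q => ?_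
  have e := (tauPair z).latticeEquiv_symm_apply q
  simp only [tauPair, mul_one] at e
  simp only [Function.comp_apply, LinearEquiv.coe_toEquiv]
  erw [e]

lemma wp_add_lattice (z : ℍ) (u : ℂ) (m n : ℤ) : wp z (u + (m * z + n)) = wp z u := by
  have hmem : (m * z + n : ℂ) ∈ (tauPair z).lattice :=
    PeriodPair.mem_lattice.mpr ⟨m, n, by simp [tauPair]⟩
  exact (tauPair z).weierstrassP_add_coe u ⟨_, hmem⟩

lemma SL_det_cast (R : Type*) [CommRing R] (γ : SL(2, ℤ)) :
    (γ 0 0 : R) * γ 1 1 - γ 0 1 * γ 1 0 = 1 := by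
  have hdet := γ.det_coe
  rw [Matrix.det_fin_two] at hdet
  have := congrArg (Int.cast : ℤ → R) hdet
  push_cast at this
  exact this

/-- The action of a matrix on row vectors. -/
def rowEquiv (γ : SL(2, ℤ)) : ℤ × ℤ ≃ ℤ × ℤ where
  toFun q := (q.1 * γ 0 0 + q.2 * γ 1 0, q.1 * γ 0 1 + q.2 * γ 1 1)
  invFun q := (q.1 * γ 1 1 - q.2 * γ 1 0, -q.1 * γ 0 1 + q.2 * γ 0 0)
  left_inv q := by
    have hdet := γ.det_coe
    rw [Matrix.det_fin_two] at hdet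
    ext
    · simp only; linear_combination q.1 * hdet
    · simp only; linear_combination q.2 * hdet
  right_inv q := by
    have hdet := γ.det_coe
    rw [Matrix.det_fin_two] at hdet
    ext
    · simp only; linear_combination q.1 * hdet
    · simp only; linear_combination q.2 * hdet

lemma coe_SL_smul (γ : SL(2, ℤ)) (z : ℍ) :
    ((γ • z : ℍ) : ℂ) = ((γ 0 0 : ℂ) * z + γ 0 1) / ((γ 1 0 : ℂ) * z + γ 1 1) := by
  rw [UpperHalfPlane.coe_specialLinearGroup_apply]
  simp

lemma SL_denom_ne_zero (γ : SL(2, ℤ)) (z : ℍ) : (γ 1 0 : ℂ) * z + γ 1 1 ≠ 0 := by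
  rw [← ModularGroup.denom_apply]
  exact UpperHalfPlane.denom_ne_zero _ _

/-- The lattice of `γ z` is that of `z` divided by the automorphy factor, and the terms of the
series are homogeneous of degree `-2`; absolute convergence allows the change of basis. -/
lemma wp_smul (γ : SL(2, ℤ)) (z : ℍ) (u : ℂ) :
    wp (γ • z) (u / ((γ 1 0 : ℂ) * z + γ 1 1)) = ((γ 1 0 : ℂ) * z + γ 1 1) ^ 2 * wp z u := by
  have hne := SL_denom_ne_zero γ z
  set j := (γ 1 0 : ℂ) * z + γ 1 1 with hj
  have h1 := ((rowEquiv γ).hasSum_iff.mpr (hasSum_wp z u)).mul_left (j ^ 2)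
  refine (hasSum_wp (γ • z) (u / j)).unique (h1.congr_fun fun q => ?_)
  simp only [Function.comp_apply, rowEquiv, Equiv.coe_fn_mk]
  have e : (q.1 : ℂ) * ((γ • z : ℍ) : ℂ) + q.2 =
      (((q.1 * γ 0 0 + q.2 * γ 1 0 : ℤ) : ℂ) * z + ((q.1 * γ 0 1 + q.2 * γ 1 1 : ℤ) : ℂ)) / j := by
    rw [coe_SL_smul, ← hj]
    field_simp
    rw [hj]
    push_cast
    ring
  rw [e, ← sub_div, div_pow, div_pow]
  simp only [one_div, inv_div]
  ring

/-- The series `∑ (w + n)⁻²` over the integers. -/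
def sqSum (w : ℂ) : ℂ := ∑' n : ℤ, 1 / (w + n) ^ 2

lemma summable_sqSum (w : ℂ) : Summable fun n : ℤ => 1 / (w + n) ^ 2 := by
  have h := EisensteinSeries.linear_right_summable w 1 (k := 2) le_rfl
  refine h.congr fun n => ?_
  simp only [Int.cast_one, one_mul, one_div]
  norm_cast

lemma sqSum_neg (w : ℂ) : sqSum (-w) = sqSum w := by
  rw [sqSum, sqSum, ← (Equiv.neg ℤ).tsum_eq]
  refine tsum_congr fun n => ?_
  rw [Equiv.neg_apply]
  push_cast
  rw [← neg_add, neg_sq]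

lemma sqSum_of_im_pos {w : ℂ} (hw : 0 < w.im) :
    sqSum w = -4 * Real.pi ^ 2 *
      ∑' n : ℕ+, ((n : ℕ) : ℂ) * Complex.exp (2 * Real.pi * Complex.I * w) ^ (n : ℕ) := by
  have h := EisensteinSeries.qExpansion_identity_pnat (k := 1) le_rfl ⟨w, hw⟩
  simp only [Nat.reduceAdd, pow_one, Nat.factorial_one, Nat.cast_one, div_one] at h
  rw [sqSum]
  refine h.trans ?_
  congr 1
  linear_combination 4 * (Real.pi : ℂ) ^ 2 * Complex.I_sq

/-- Summation along rows separates the two halves of each term, so that the part independent of `u`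
can later be discarded. The convention `1 / 0 = 0` accounts for the missing correction at the
origin. -/
lemma hasSum_wp_sqSum (z : ℍ) (u : ℂ) :
    HasSum (fun m : ℤ => sqSum (u + m * z) - sqSum (m * z)) (wp z u) := by
  have h := (hasSum_wp z u).prod_fiberwise (g := fun m : ℤ => sqSum (u - m * z) - sqSum (m * z))
    fun m => by
      have h1 : HasSum (fun n : ℤ => 1 / (u - m * z - n) ^ 2) (sqSum (u - m * z)) := by
        have := (Equiv.neg ℤ).hasSum_iff.mpr (summable_sqSum (u - m * z)).hasSum
        refine this.congr_fun fun n => ?_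
        simp [sub_eq_add_neg]
      refine (h1.sub (summable_sqSum (m * z)).hasSum).congr_fun fun n => ?_
      simp only [sub_sub]
  have h2 := (Equiv.neg ℤ).hasSum_iff.mpr h
  refine h2.congr_fun fun m => ?_
  simp only [Function.comp_apply, Equiv.neg_apply, Int.cast_neg, neg_mul, sub_neg_eq_add,
    sqSum_neg]

/-- Lipschitz's formula in each row `c ≥ 1`, then exchange of the two summations. -/
lemma hasSum_sqSum_pos {N : ℕ} (hN : 0 < N) (t : ℤ) {β : ℕ → ℂ} (hβ : BddSeq β) (z : ℍ) :
    HasSum (fun c : ℕ => β (c + 1) * sqSum ((((c + 1 : ℕ) : ℂ) * z + t) / N))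
      (-4 * Real.pi ^ 2 * dsum (expSeq ((t : ℚ) / N)) β ((z : ℂ) / N)) := by
  have hz := im_div_nat_pos z hN
  have hsum := summable_dsumTerm (bddSeq_expSeq ((t : ℚ) / N)) hβ hz
  have h1 := ((Equiv.prodComm ℕ+ ℕ+).hasSum_iff.mpr hsum.hasSum).mul_left (-4 * (Real.pi : ℂ) ^ 2)
  have h2 := h1.prod_fiberwise
    (g := fun c : ℕ+ => β c * sqSum ((((c : ℕ) : ℂ) * z + t) / N)) fun c => by
      have him : 0 < ((((c : ℕ) : ℂ) * z + t) / N).im := by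
        rw [Complex.div_natCast_im]
        have := c.pos
        have := z.im_pos
        simp only [Complex.add_im, Complex.mul_im, Complex.natCast_re, Complex.natCast_im, zero_mul,
          add_zero, Complex.intCast_im]
        positivity
      rw [sqSum_of_im_pos him, mul_left_comm, ← tsum_mul_left]
      refine Summable.hasSum_iff (((hsum.prod_symm.prod_factor c)).mul_left _) |>.mpr ?_
      rw [← tsum_mul_left]
      refine tsum_congr fun n => ?_
      simp only [Prod.swap_prod_mk, dsumTerm, expSeq]
      rw [← Complex.exp_nat_mul, show ((n : ℕ) : ℂ) * (2 * Real.pi * Complex.I *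
        ((((c : ℕ) : ℂ) * z + t) / N)) = 2 * Real.pi * Complex.I * ((n : ℕ) : ℂ) * (((t : ℚ) / N :
        ℚ) : ℂ) + 2 * Real.pi * Complex.I * (((n : ℕ) : ℂ) * ((c : ℕ) : ℂ)) * ((z : ℂ) / N) by
          push_cast; ring, Complex.exp_add]
      ring
  have h3 := Equiv.pnatEquivNat.symm.hasSum_iff.mpr h2
  refine h3.congr_fun fun c => ?_
  simp [Equiv.pnatEquivNat]

lemma hasSum_int_of_pos_zero_neg {f : ℤ → ℂ} {s t : ℂ}
    (hpos : HasSum (fun n : ℕ => f ((n + 1 : ℕ) : ℤ)) s)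
    (hneg : HasSum (fun n : ℕ => f (-((n + 1 : ℕ) : ℤ))) t) : HasSum f (s + f 0 + t) := by
  refine HasSum.of_nat_of_neg_add_one ?_ (by simpa using hneg)
  have := (hasSum_nat_add_iff (f := fun n : ℕ => f n) 1).mp hpos
  simpa using this

lemma expSeq_div_eq {N : ℕ} [NeZero N] (t : ℤ) (n : ℕ) :
    expSeq ((t : ℚ) / N) n = ZMod.stdAddChar ((t : ZMod N) * (n : ZMod N)) := by
  have : (t : ZMod N) * (n : ZMod N) = ((t * n : ℤ) : ZMod N) := by push_cast; ring
  rw [this, ZMod.stdAddChar_coe, expSeq]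
  push_cast
  ring_nf

lemma sum_stdAddChar_mul {N : ℕ} [NeZero N] (b : ZMod N) :
    ∑ j : ZMod N, ZMod.stdAddChar (j * b) = if b = 0 then (N : ℂ) else 0 := by
  classical
  rw [AddChar.sum_mulShift b (ZMod.isPrimitive_stdAddChar N), ZMod.card]
  split_ifs <;> simp

lemma hasSum_int_iff_residues {N : ℕ} [NeZero N] {f : ℤ → ℂ} (hf : Summable f) :
    ∑ j : ZMod N, ∑' n : ℤ, f (j.val + N * n) = ∑' d, f d := by
  obtain ⟨k, rfl⟩ := Nat.exists_eq_succ_of_ne_zero (NeZero.ne N)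
  have h1 := (Equiv.prodComm _ _).summable_iff.mpr
    ((Int.divModEquiv (k + 1)).symm.summable_iff.mpr hf)
  rw [← (Int.divModEquiv (k + 1)).symm.tsum_eq f, ← (Equiv.prodComm _ _).tsum_eq]
  refine Eq.trans ?_ h1.tsum_prod.symm
  rw [tsum_fintype]
  refine Finset.sum_congr rfl fun j _ => tsum_congr fun n => ?_
  simp only [Function.comp_apply, Equiv.prodComm_apply, Int.divModEquiv,
    Equiv.coe_fn_symm_mk]
  rw [add_comm, mul_comm]
  rfl

lemma summable_sqSum_shift {N : ℕ} (hN : 0 < N) (t : ℤ) (z : ℍ) :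
    Summable fun c : ℤ => sqSum (((c : ℂ) * z + t) / N) := by
  have hone : BddSeq fun _ => (1 : ℂ) := ⟨1, fun _ => by simp⟩
  refine (hasSum_int_of_pos_zero_neg (f := fun c : ℤ => sqSum (((c : ℂ) * z + t) / N))
    ((hasSum_sqSum_pos hN t hone z).congr_fun fun c => ?_)
    ((hasSum_sqSum_pos hN (-t) hone z).congr_fun fun c => ?_)).summable
  · simp
  · rw [← sqSum_neg]
    push_cast
    rw [one_mul]
    ring_nf

lemma hasSum_sqSum_twist {N : ℕ} [NeZero N] (b t : ℤ) (z : ℍ) :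
    HasSum (fun c : ℤ => ZMod.stdAddChar (-(b : ZMod N) * (c : ZMod N)) * sqSum (((c : ℂ) * z + t) / N))
      (-4 * Real.pi ^ 2 * dsum (expSeq ((t : ℚ) / N)) (expSeq (((-b : ℤ) : ℚ) / N)) ((z : ℂ) / N) +
        sqSum ((t : ℂ) / N) + -4 * Real.pi ^ 2 *
          dsum (expSeq (((-t : ℤ) : ℚ) / N)) (expSeq ((b : ℚ) / N)) ((z : ℂ) / N)) := by
  have hN : 0 < N := Nat.pos_of_ne_zero (NeZero.ne N)
  have h := hasSum_int_of_pos_zero_neg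
    (f := fun c : ℤ => ZMod.stdAddChar (-(b : ZMod N) * (c : ZMod N)) * sqSum (((c : ℂ) * z + t) / N))
    ((hasSum_sqSum_pos hN t (bddSeq_expSeq (((-b : ℤ) : ℚ) / N)) z).congr_fun fun c => ?_)
    ((hasSum_sqSum_pos hN (-t) (bddSeq_expSeq ((b : ℚ) / N)) z).congr_fun fun c => ?_)
  · simpa using h
  · rw [expSeq_div_eq]
    push_cast
    rfl
  · rw [expSeq_div_eq, ← sqSum_neg]
    push_cast
    congr 2
    · ring
    · ring

/-- The row `c = 0`: splitting `d` by residues modulo `N`, this is the Fourier series `∑ exp (2πi a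
d / N) / d²` of the second Bernoulli polynomial, its term `d = 0` vanishing by the convention `1 / 0
= 0`. -/
lemma sum_sqSum_eq_bernoulli {N : ℕ} [NeZero N] (a : ℤ) :
    ∑ j : ZMod N, ZMod.stdAddChar ((a : ZMod N) * j) * sqSum ((j.val : ℂ) / N) =
      4 * Real.pi ^ 2 * N ^ 2 * ((1 / 2) *
        (((Int.fract ((a : ℚ) / N)) ^ 2 - Int.fract ((a : ℚ) / N) + 1 / 6 : ℚ) : ℂ)) := by
  have hN : (N : ℂ) ≠ 0 := by exact_mod_cast NeZero.ne N
  set y : ℚ := Int.fract ((a : ℚ) / N) with hy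
  have hmem : (y : ℝ) ∈ Set.Icc (0 : ℝ) 1 :=
    ⟨by exact_mod_cast Int.fract_nonneg _, by exact_mod_cast (Int.fract_lt_one _).le⟩
  have hB := hasSum_one_div_pow_mul_fourier_mul_bernoulliFun le_rfl hmem
  have hterm (d : ℤ) : (1 / (d : ℂ) ^ 2 * fourier d ((y : ℝ) : UnitAddCircle)) * N ^ 2 =
      ZMod.stdAddChar ((a : ZMod N) * (d : ZMod N)) * (1 / ((d : ℂ) / N) ^ 2) := by
    rw [show (a : ZMod N) * (d : ZMod N) = ((a * d : ℤ) : ZMod N) by push_cast; ring, ZMod.stdAddChar_coe,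
      fourier_coe_apply]
    have hya : (y : ℂ) = a / N - ⌊(a : ℚ) / N⌋ := by
      rw [hy, Int.fract]; push_cast; ring
    have : Complex.exp (2 * Real.pi * Complex.I * d * ((y : ℝ) : ℂ) / ((1 : ℝ) : ℂ)) =
        Complex.exp (2 * Real.pi * Complex.I * ((a * d : ℤ) : ℂ) / N) := by
      rw [Complex.exp_eq_exp_iff_exists_int]
      refine ⟨-(d * ⌊(a : ℚ) / N⌋), ?_⟩
      rw [Complex.ofReal_ratCast, hya]
      push_cast
      ring
    rw [this, div_pow, one_div_div]
    ring
  have hS := hB.mul_right ((N : ℂ) ^ 2)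
  simp only [hterm] at hS
  have hR := hasSum_int_iff_residues (N := N) hS.summable
  rw [hS.tsum_eq] at hR
  rw [bernoulliFun_two] at hR
  have hfac : ((Nat.factorial 2 : ℕ) : ℂ) = 2 := by norm_num [Nat.factorial]
  rw [hfac] at hR
  have hC : 4 * (Real.pi : ℂ) ^ 2 * N ^ 2 * ((1 / 2) * ((y ^ 2 - y + 1 / 6 : ℚ) : ℂ)) =
      -(2 * Real.pi * Complex.I) ^ 2 / 2 * (((y : ℝ) ^ 2 - (y : ℝ) + 6⁻¹ : ℝ) : ℂ) * N ^ 2 := by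
    push_cast
    linear_combination ((2 : ℂ) * Real.pi ^ 2 * (y ^ 2 - y + 6⁻¹) * N ^ 2) * Complex.I_sq
  rw [hC, ← hR]
  refine Finset.sum_congr rfl fun j _ => ?_
  rw [sqSum, ← tsum_mul_left]
  refine tsum_congr fun n => ?_
  have h1 : (a : ZMod N) * ((j.val + N * n : ℤ) : ZMod N) = a * j := by
    push_cast
    simp
  rw [h1]
  congr 3
  push_cast
  field_simp

lemma sum_stdAddChar_dsum {N : ℕ} [NeZero N] (a : ZMod N) {β : ℕ → ℂ} (hβ : BddSeq β) {w : ℂ}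
    (hw : 0 < w.im) :
    ∑ j : ZMod N, ZMod.stdAddChar (a * j) * dsum (expSeq (((j.val : ℤ) : ℚ) / N)) β w =
      N * dsum (resInd (-a)) β w := by
  have h := dsum_sum_sum (Finset.univ : Finset (ZMod N)) (Finset.univ : Finset Unit)
    (fun j n => ZMod.stdAddChar (a * j) * expSeq (((j.val : ℤ) : ℚ) / N) n) (fun _ => β)
    (fun j => (bddSeq_expSeq _).const_mul _) (fun _ => hβ) hw
  simp only [Finset.univ_unique, Finset.sum_const, Finset.card_singleton, one_smul,
    dsum_const_mul_left] at h
  rw [h, ← dsum_const_mul_left]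
  refine dsum_congr (fun n _ => ?_) (fun _ _ => rfl) w
  have (j : ZMod N) : ZMod.stdAddChar (a * j) * expSeq (((j.val : ℤ) : ℚ) / N) n =
      (ZMod.stdAddChar (j * (a + (n : ZMod N))) : ℂ) := by
    rw [expSeq_div_eq, ← AddChar.map_add_eq_mul]
    congr 1
    push_cast
    rw [ZMod.natCast_zmod_val]
    ring
  simp only [this, sum_stdAddChar_mul, resInd, add_comm a, add_eq_zero_iff_eq_neg]
  split_ifs <;> simp

/-- This is `N²` times the sum of `exp (2πi (a d - b c) / N) (c z + d)⁻²`, taken over `d` first,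
with `j` the residue of `d`. Rows `c ≠ 0` give the two halves `P_x` and `P_{-x}`, as the Fourier
transform in `j` produces residue indicators; the row `c = 0` gives the constant term. -/
lemma hasSum_heckeHol {N : ℕ} [NeZero N] (a b : ℤ) (z : ℍ) :
    HasSum (fun c : ℤ => ∑ j : ZMod N, ZMod.stdAddChar ((a : ZMod N) * j) *
        (ZMod.stdAddChar (-(b : ZMod N) * (c : ZMod N)) * sqSum (((c : ℂ) * z + (j.val : ℤ)) / N)))
      (4 * Real.pi ^ 2 * N ^ 2 * heckeHol ((a : ℚ) / N, (b : ℚ) / N) z) := by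
  have hN : 0 < N := Nat.pos_of_ne_zero (NeZero.ne N)
  have hN' : (N : ℂ) ≠ 0 := by exact_mod_cast NeZero.ne N
  have hz := im_div_nat_pos z hN
  have h := hasSum_sum (s := (Finset.univ : Finset (ZMod N))) fun j _ =>
    (hasSum_sqSum_twist (N := N) b j.val z).mul_left (ZMod.stdAddChar ((a : ZMod N) * j) : ℂ)
  convert h using 1
  · rfl
  have e1 := sum_stdAddChar_dsum (a : ZMod N) (bddSeq_expSeq (((-b : ℤ) : ℚ) / N)) hz
  have e2 : ∑ j : ZMod N, ZMod.stdAddChar ((a : ZMod N) * j) *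
      dsum (expSeq (((-(j.val : ℤ) : ℤ) : ℚ) / N)) (expSeq ((b : ℚ) / N)) ((z : ℂ) / N) =
      N * dsum (resInd (a : ZMod N)) (expSeq ((b : ℚ) / N)) ((z : ℂ) / N) := by
    have h := sum_stdAddChar_dsum (-a : ZMod N) (bddSeq_expSeq ((b : ℚ) / N)) hz
    rw [neg_neg] at h
    rw [← h]
    refine (Equiv.sum_comp (Equiv.neg (ZMod N)) _).symm.trans (Finset.sum_congr rfl fun j _ => ?_)
    have e : expSeq (((-((-j).val : ℤ) : ℤ) : ℚ) / N) = expSeq (((j.val : ℤ) : ℚ) / N) := by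
      ext n
      rw [expSeq_div_eq, expSeq_div_eq]
      push_cast
      rw [ZMod.natCast_zmod_val, ZMod.natCast_zmod_val, neg_neg]
    rw [Equiv.neg_apply, e, mul_neg, neg_mul]
  have e3 := sum_sqSum_eq_bernoulli (N := N) a
  simp only [mul_add, Finset.sum_add_distrib, mul_left_comm _ (-4 * (Real.pi : ℂ) ^ 2),
    ← Finset.mul_sum, e1, e2]
  simp only [Int.cast_natCast, e3]
  rw [heckeHol_eq_dsum hN, show -((b : ℚ) / N) = ((-b : ℤ) : ℚ) / N by push_cast; ring]
  field_simp
  ring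

/-- `φ_x` as a finite Fourier transform of division values of the Weierstrass function. -/
theorem heckeHol_eq_sum_wp {N : ℕ} [NeZero N] (a b : ℤ)
    (hab : ¬ ((a : ZMod N) = 0 ∧ (b : ZMod N) = 0)) (z : ℍ) :
    4 * Real.pi ^ 2 * N ^ 2 * heckeHol ((a : ℚ) / N, (b : ℚ) / N) z =
      ∑ i : ZMod N, ∑ j : ZMod N, ZMod.stdAddChar ((a : ZMod N) * j - (b : ZMod N) * i) *
        wp z (((i.val : ℂ) * z + j.val) / N) := by
  have hN : 0 < N := Nat.pos_of_ne_zero (NeZero.ne N)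
  have hN' : (N : ℂ) ≠ 0 := by exact_mod_cast NeZero.ne N
  have hS := hasSum_heckeHol (N := N) a b z
  rw [← hS.tsum_eq, ← hasSum_int_iff_residues (N := N) hS.summable]
  have hS0 : Summable fun m : ℤ => sqSum ((m : ℂ) * z) := by
    simpa using summable_sqSum_shift (N := 1) one_pos 0 z
  have hSij (i j : ZMod N) : Summable fun m : ℤ =>
      sqSum ((((i.val + N * m : ℤ) : ℂ) * z + (j.val : ℤ)) / N) := by
    have hinj : Function.Injective fun m : ℤ => (i.val + N * m : ℤ) := fun m n h => by
      have : (N : ℤ) ≠ 0 := by exact_mod_cast NeZero.ne N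
      simpa [NeZero.ne N] using h
    exact (summable_sqSum_shift hN j.val z).comp_injective hinj
  have hwp (i j : ZMod N) : wp z (((i.val : ℂ) * z + j.val) / N) =
      ∑' m : ℤ, sqSum ((((i.val + N * m : ℤ) : ℂ) * z + (j.val : ℤ)) / N) -
        ∑' m : ℤ, sqSum ((m : ℂ) * z) := by
    rw [← (hSij i j).tsum_sub hS0, ← (hasSum_wp_sqSum z _).tsum_eq]
    refine tsum_congr fun m => ?_
    congr 2
    push_cast
    field_simp
    ring
  -- Since the character of `(ℤ/N)²` is nontrivial, its values sum to zero and the row sums not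
  -- involving the division point drop out. Only here is `x ≠ 0` needed.
  have hzero : ∑ i : ZMod N, ∑ j : ZMod N,
      (ZMod.stdAddChar ((a : ZMod N) * j - (b : ZMod N) * i) : ℂ) = 0 := by
    have h1 (i j : ZMod N) : (ZMod.stdAddChar ((a : ZMod N) * j - (b : ZMod N) * i) : ℂ) =
        ZMod.stdAddChar (i * -(b : ZMod N)) * ZMod.stdAddChar (j * (a : ZMod N)) := by
      rw [← AddChar.map_add_eq_mul]
      ring_nf
    simp only [h1, ← Finset.mul_sum, ← Finset.sum_mul, sum_stdAddChar_mul, neg_eq_zero]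
    rcases not_and_or.mp hab with h | h <;> simp [h]
  simp only [hwp, mul_sub, Finset.sum_sub_distrib, ← Finset.sum_mul, hzero, zero_mul, sub_zero]
  refine Finset.sum_congr rfl fun i _ => ?_
  have hterm (j : ZMod N) (m : ℤ) : (ZMod.stdAddChar ((a : ZMod N) * j) : ℂ) *
      (ZMod.stdAddChar (-(b : ZMod N) * ((i.val + N * m : ℤ) : ZMod N)) *
        sqSum ((((i.val + N * m : ℤ) : ℂ) * z + (j.val : ℤ)) / N)) =
      ZMod.stdAddChar ((a : ZMod N) * j - (b : ZMod N) * i) *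
        sqSum ((((i.val + N * m : ℤ) : ℂ) * z + (j.val : ℤ)) / N) := by
    rw [← mul_assoc, ← AddChar.map_add_eq_mul]
    congr 2
    push_cast
    simp
    ring
  simp only [hterm]
  rw [Summable.tsum_finsetSum fun j _ => (hSij i j).mul_left _]
  exact Finset.sum_congr rfl fun j _ => tsum_mul_left

lemma wp_div_congr {N : ℕ} [NeZero N] (z : ℍ) {c c' d d' : ℤ} (hc : (c : ZMod N) = c')
    (hd : (d : ZMod N) = d') : wp z (((c : ℂ) * z + d) / N) = wp z (((c' : ℂ) * z + d') / N) := by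
  have hN' : (N : ℂ) ≠ 0 := by exact_mod_cast NeZero.ne N
  obtain ⟨m, hm⟩ := (ZMod.intCast_eq_intCast_iff_dvd_sub _ _ _).mp hc
  obtain ⟨n, hn⟩ := (ZMod.intCast_eq_intCast_iff_dvd_sub _ _ _).mp hd
  rw [← wp_add_lattice z _ m n]
  congr 1
  rw [show c' = c + N * m by linarith, show d' = d + N * n by linarith]
  push_cast
  field_simp
  ring

/-- The action of a matrix on row vectors modulo `N`. -/
def rowEquivZMod (N : ℕ) (γ : SL(2, ℤ)) : ZMod N × ZMod N ≃ ZMod N × ZMod N where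
  toFun q := (q.1 * γ 0 0 + q.2 * γ 1 0, q.1 * γ 0 1 + q.2 * γ 1 1)
  invFun q := (q.1 * γ 1 1 - q.2 * γ 1 0, -q.1 * γ 0 1 + q.2 * γ 0 0)
  left_inv q := by
    have hdet' := SL_det_cast (ZMod N) γ
    ext
    · simp only; linear_combination q.1 * hdet'
    · simp only; linear_combination q.2 * hdet'
  right_inv q := by
    have hdet' := SL_det_cast (ZMod N) γ
    ext
    · simp only; linear_combination q.1 * hdet'
    · simp only; linear_combination q.2 * hdet'

/-- `γ` permutes the `N`-division points by row multiplication, and `a j - b i` is a determinant,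
hence unchanged when `γ` acts on both rows. -/
lemma heckeHol_slash_div {N : ℕ} [NeZero N] (a b : ℤ)
    (hab : ¬ ((a : ZMod N) = 0 ∧ (b : ZMod N) = 0)) (γ : SL(2, ℤ)) :
    heckeHol ((a : ℚ) / N, (b : ℚ) / N) ∣[(2 : ℤ)] γ =
      heckeHol (((a * γ 0 0 + b * γ 1 0 : ℤ) : ℚ) / N, ((a * γ 0 1 + b * γ 1 1 : ℤ) : ℚ) / N) := by
  have hN' : (N : ℂ) ≠ 0 := by exact_mod_cast NeZero.ne N
  have hdet' := SL_det_cast (ZMod N) γ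
  have hab' : ¬ (((a * γ 0 0 + b * γ 1 0 : ℤ) : ZMod N) = 0 ∧
      ((a * γ 0 1 + b * γ 1 1 : ℤ) : ZMod N) = 0) := by
    rintro ⟨h1, h2⟩
    push_cast at h1 h2
    refine hab ⟨?_, ?_⟩
    · linear_combination (γ 1 1 : ZMod N) * h1 - (γ 1 0 : ZMod N) * h2 - (a : ZMod N) * hdet'
    · linear_combination (γ 0 0 : ZMod N) * h2 - (γ 0 1 : ZMod N) * h1 - (b : ZMod N) * hdet'
  ext z
  have hne := SL_denom_ne_zero γ z
  have hC : (4 * Real.pi ^ 2 * N ^ 2 : ℂ) ≠ 0 := by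
    have := Real.pi_ne_zero
    simp [hN', this]
  apply mul_left_cancel₀ hC
  rw [heckeHol_eq_sum_wp _ _ hab', ModularForm.SL_slash_apply, ← mul_assoc,
    heckeHol_eq_sum_wp _ _ hab, ModularGroup.denom_apply]
  set J := (γ 1 0 : ℂ) * z + γ 1 1 with hJ
  have hJ2 : J ^ (-2 : ℤ) = (J ^ 2)⁻¹ := by
    rw [zpow_neg]; rfl
  rw [hJ2, ← div_eq_mul_inv, div_eq_iff (pow_ne_zero 2 hne), mul_comm _ (J ^ 2)]
  simp only [← Fintype.sum_prod_type']
  rw [Finset.mul_sum]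
  refine Eq.trans (Finset.sum_congr rfl fun q _ => ?_) (Equiv.sum_comp (rowEquivZMod N γ) _)
  have e1 : wp (γ • z) (((q.1.val : ℂ) * ((γ • z : ℍ) : ℂ) + q.2.val) / N) = J ^ 2 *
      wp z (((((rowEquivZMod N γ) q).1.val : ℂ) * z + ((rowEquivZMod N γ) q).2.val) / N) := by
    have e2 : ((q.1.val : ℂ) * ((γ • z : ℍ) : ℂ) + q.2.val) / N =
        ((((q.1.val * γ 0 0 + q.2.val * γ 1 0 : ℤ) : ℂ) * z +
          ((q.1.val * γ 0 1 + q.2.val * γ 1 1 : ℤ) : ℂ)) / N) / J := by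
      rw [coe_SL_smul, ← hJ]
      field_simp
      rw [hJ]
      push_cast
      ring
    rw [e2, wp_smul]
    congr 1
    have := wp_div_congr (N := N) z (c := q.1.val * γ 0 0 + q.2.val * γ 1 0)
      (c' := ((rowEquivZMod N γ) q).1.val) (d := q.1.val * γ 0 1 + q.2.val * γ 1 1)
      (d' := ((rowEquivZMod N γ) q).2.val) (by simp [rowEquivZMod]) (by simp [rowEquivZMod])
    simpa using this
  rw [e1, ← mul_assoc, ← mul_assoc, mul_comm (J ^ 2)]
  congr 3
  simp only [rowEquivZMod, Equiv.coe_fn_mk]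
  push_cast
  linear_combination hdet' * ((b : ZMod N) * q.1 - (a : ZMod N) * q.2)

/-- `φ_x | γ = φ_{x γ}`. -/
theorem heckeHol_slash {x : ℚ × ℚ} (hx : ¬ IsIntegralPair x) (γ : SL(2, ℤ)) :
    heckeHol x ∣[(2 : ℤ)] γ =
      heckeHol (x.1 * γ 0 0 + x.2 * γ 1 0, x.1 * γ 0 1 + x.2 * γ 1 1) := by
  obtain ⟨N, hN, a, b, rfl⟩ := exists_common_denom x
  have : NeZero N := ⟨hN.ne'⟩
  rw [isIntegralPair_div_iff hN] at hx
  rw [heckeHol_slash_div a b hx]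
  congr 1
  ext <;> push_cast <;> ring

lemma isIntegralPair_mul_SL (x : ℚ × ℚ) (γ : SL(2, ℤ)) :
    IsIntegralPair (x.1 * γ 0 0 + x.2 * γ 1 0, x.1 * γ 0 1 + x.2 * γ 1 1) ↔ IsIntegralPair x := by
  have hdet' := SL_det_cast ℚ γ
  constructor
  · rintro ⟨⟨m, hm⟩, n, hn⟩
    simp only at hm hn
    refine ⟨⟨m * γ 1 1 - n * γ 1 0, ?_⟩, n * γ 0 0 - m * γ 0 1, ?_⟩
    · push_cast
      linear_combination (γ 1 1 : ℚ) * hm - (γ 1 0 : ℚ) * hn - x.1 * hdet'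
    · push_cast
      linear_combination (γ 0 0 : ℚ) * hn - (γ 0 1 : ℚ) * hm - x.2 * hdet'
  · rintro ⟨⟨m, hm⟩, n, hn⟩
    exact ⟨⟨m * γ 0 0 + n * γ 1 0, by simp [hm, hn]⟩, m * γ 0 1 + n * γ 1 1, by simp [hm, hn]⟩

end


/-! ### Vanishing at all cusps forces a combination of the `φ_x` to be zero. -/

noncomputable section

open Filter Topology
open scoped Manifold ContDiff

/-- The span of the holomorphic Eisenstein series of weight two. -/
def heckeSpan : Submodule ℂ (ℍ → ℂ) :=
  Submodule.span ℂ {f | ∃ x : ℚ × ℚ, ¬ IsIntegralPair x ∧ f = heckeHol x}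

/-- The span of the holomorphic Eisenstein series of weight two attached to `N`-division points. -/
def heckeSpanLevel (N : ℕ) : Submodule ℂ (ℍ → ℂ) :=
  Submodule.span ℂ {f | ∃ a b : ℤ, ¬ ((a : ZMod N) = 0 ∧ (b : ZMod N) = 0) ∧
    f = heckeHol ((a : ℚ) / N, (b : ℚ) / N)}

lemma heckeSpan_eq : heckeSpan =
    Submodule.span ℂ {f | ∃ x : ℚ × ℚ, ¬ IsIntegralPair x ∧ f = heckePhi x} := by
  refine congrArg _ (Set.ext fun f => exists_congr fun x => and_congr_right fun hx => ?_)
  rw [heckePhi_of_not_integral hx]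

lemma heckeHol_mem_heckeSpan {x : ℚ × ℚ} (hx : ¬ IsIntegralPair x) : heckeHol x ∈ heckeSpan :=
  Submodule.subset_span ⟨x, hx, rfl⟩

lemma slash_mem_heckeSpan {f : ℍ → ℂ} (hf : f ∈ heckeSpan) (γ : SL(2, ℤ)) :
    f ∣[(2 : ℤ)] γ ∈ heckeSpan := by
  induction hf using Submodule.span_induction with
  | mem f hf =>
    obtain ⟨x, hx, rfl⟩ := hf
    rw [heckeHol_slash hx]
    exact heckeHol_mem_heckeSpan (by rwa [isIntegralPair_mul_SL])
  | zero => rw [SlashAction.zero_slash]; exact zero_mem _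
  | add f g _ _ hf hg => rw [SlashAction.add_slash]; exact add_mem hf hg
  | smul c f _ hf => rw [ModularForm.SL_smul_slash]; exact Submodule.smul_mem _ _ hf

lemma slash_mem_heckeSpanLevel {N : ℕ} [NeZero N] {f : ℍ → ℂ} (hf : f ∈ heckeSpanLevel N)
    (γ : SL(2, ℤ)) : f ∣[(2 : ℤ)] γ ∈ heckeSpanLevel N := by
  induction hf using Submodule.span_induction with
  | mem f hf =>
    obtain ⟨a, b, hab, rfl⟩ := hf
    rw [heckeHol_slash_div a b hab]
    refine Submodule.subset_span ⟨_, _, fun h => hab ?_, rfl⟩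
    have hdet := SL_det_cast (ZMod N) γ
    obtain ⟨h1, h2⟩ := h
    push_cast at h1 h2
    constructor
    · linear_combination (γ 1 1 : ZMod N) * h1 - (γ 1 0 : ZMod N) * h2 - (a : ZMod N) * hdet
    · linear_combination (γ 0 0 : ZMod N) * h2 - (γ 0 1 : ZMod N) * h1 - (b : ZMod N) * hdet
  | zero => rw [SlashAction.zero_slash]; exact zero_mem _
  | add f g _ _ hf hg => rw [SlashAction.add_slash]; exact add_mem hf hg
  | smul c f _ hf => rw [ModularForm.SL_smul_slash]; exact Submodule.smul_mem _ _ hf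

lemma heckeSpanLevel_le_mul {N M : ℕ} (hN : 0 < N) (hM : 0 < M) :
    heckeSpanLevel N ≤ heckeSpanLevel (N * M) := by
  refine Submodule.span_mono ?_
  rintro _ ⟨a, b, hab, rfl⟩
  have hM' : (M : ℚ) ≠ 0 := by exact_mod_cast hM.ne'
  have e (c : ℤ) : ((c * M : ℤ) : ℚ) / ((N * M : ℕ) : ℚ) = (c : ℚ) / N := by
    push_cast
    exact mul_div_mul_right _ _ hM'
  refine ⟨a * M, b * M, ?_, by rw [e, e]⟩
  rwa [← isIntegralPair_div_iff (Nat.mul_pos hN hM), e, e, isIntegralPair_div_iff hN]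

lemma exists_mem_heckeSpanLevel {f : ℍ → ℂ} (hf : f ∈ heckeSpan) :
    ∃ N : ℕ, 0 < N ∧ f ∈ heckeSpanLevel N := by
  induction hf using Submodule.span_induction with
  | mem f hf =>
    obtain ⟨x, hx, rfl⟩ := hf
    obtain ⟨N, hN, a, b, rfl⟩ := exists_common_denom x
    refine ⟨N, hN, Submodule.subset_span ⟨a, b, ?_, rfl⟩⟩
    rwa [← isIntegralPair_div_iff hN]
  | zero => exact ⟨1, one_pos, zero_mem _⟩
  | add f g _ _ hf hg =>
    obtain ⟨N, hN, hf⟩ := hf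
    obtain ⟨M, hM, hg⟩ := hg
    refine ⟨N * M, Nat.mul_pos hN hM, add_mem (heckeSpanLevel_le_mul hN hM hf) ?_⟩
    rw [mul_comm]
    exact heckeSpanLevel_le_mul hM hN hg
  | smul c f _ hf =>
    obtain ⟨N, hN, hf⟩ := hf
    exact ⟨N, hN, Submodule.smul_mem _ _ hf⟩

lemma mdifferentiable_of_mem_heckeSpan {f : ℍ → ℂ} (hf : f ∈ heckeSpan) : MDiff f := by
  induction hf using Submodule.span_induction with
  | mem f hf =>
    obtain ⟨x, hx, rfl⟩ := hf
    exact mdifferentiable_heckeHol x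
  | zero => exact mdifferentiable_const
  | add f g _ _ hf hg => exact hf.add hg
  | smul c f _ hf => exact hf.const_smul c

lemma exists_tendsto_of_mem_heckeSpan {f : ℍ → ℂ} (hf : f ∈ heckeSpan) :
    ∃ c, Tendsto f atImInfty (𝓝 c) := by
  induction hf using Submodule.span_induction with
  | mem f hf =>
    obtain ⟨x, hx, rfl⟩ := hf
    exact ⟨_, tendsto_heckeHol x⟩
  | zero => exact ⟨0, tendsto_const_nhds⟩
  | add f g _ _ hf hg =>
    obtain ⟨c, hc⟩ := hf
    obtain ⟨d, hd⟩ := hg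
    exact ⟨_, hc.add hd⟩
  | smul a f _ hf =>
    obtain ⟨c, hc⟩ := hf
    exact ⟨_, hc.const_smul a⟩

lemma heckeSpanLevel_le_heckeSpan {N : ℕ} (hN : 0 < N) : heckeSpanLevel N ≤ heckeSpan := by
  refine Submodule.span_mono ?_
  rintro _ ⟨a, b, hab, rfl⟩
  exact ⟨_, by rwa [isIntegralPair_div_iff hN], rfl⟩

lemma heckeHol_div_congr {N : ℕ} [NeZero N] {a a' b b' : ℤ} (ha : (a : ZMod N) = a')
    (hb : (b : ZMod N) = b') :
    heckeHol ((a : ℚ) / N, (b : ℚ) / N) = heckeHol ((a' : ℚ) / N, (b' : ℚ) / N) := by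
  have hN' : (N : ℚ) ≠ 0 := by exact_mod_cast NeZero.ne N
  obtain ⟨m, hm⟩ := (ZMod.intCast_eq_intCast_iff_dvd_sub _ _ _).mp ha
  obtain ⟨n, hn⟩ := (ZMod.intCast_eq_intCast_iff_dvd_sub _ _ _).mp hb
  rw [← heckeHol_add_int ((a : ℚ) / N, (b : ℚ) / N) m n]
  congr 2
  · rw [show a' = a + N * m by linarith]
    push_cast
    field_simp
  · rw [show b' = b + N * n by linarith]
    push_cast
    field_simp

/-- `x γ` modulo integers depends on `γ` modulo `N` only. This gives both invariance under `Γ(N)`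
and the finiteness of the set of translates. -/
lemma slash_congr_of_mem_heckeSpanLevel {N : ℕ} [NeZero N] {f : ℍ → ℂ}
    (hf : f ∈ heckeSpanLevel N) {γ γ' : SL(2, ℤ)}
    (h : ∀ i j, ((γ i j : ℤ) : ZMod N) = (γ' i j : ℤ)) : f ∣[(2 : ℤ)] γ = f ∣[(2 : ℤ)] γ' := by
  induction hf using Submodule.span_induction with
  | mem f hf =>
    obtain ⟨a, b, hab, rfl⟩ := hf
    rw [heckeHol_slash_div a b hab, heckeHol_slash_div a b hab]
    apply heckeHol_div_congr <;> push_cast <;> simp only [h]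
  | zero => simp only [SlashAction.zero_slash]
  | add f g _ _ hf hg => rw [SlashAction.add_slash, SlashAction.add_slash, hf, hg]
  | smul c f _ hf => rw [ModularForm.SL_smul_slash, ModularForm.SL_smul_slash, hf]

lemma slash_eq_of_mem_heckeSpanLevel {N : ℕ} [NeZero N] {f : ℍ → ℂ} (hf : f ∈ heckeSpanLevel N)
    {γ : SL(2, ℤ)} (hγ : γ ∈ Gamma N) : f ∣[(2 : ℤ)] γ = f := by
  rw [Gamma_mem] at hγ
  rw [slash_congr_of_mem_heckeSpanLevel (γ' := 1) hf, SlashAction.slash_one]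
  intro i j
  fin_cases i <;> fin_cases j <;> simp [hγ]

lemma hecke_eigen_of_mem_heckeSpanLevel {N ℓ : ℕ} (hN : 0 < N) (hℓ : ℓ.Prime)
    (h : (ℓ : ZMod N) = 1) {f : ℍ → ℂ} (hf : f ∈ heckeSpanLevel N) (z : ℍ) :
    (ℓ : ℂ)⁻¹ * ∑ k ∈ Finset.range ℓ, f (addDiv ℓ hℓ.pos (N * k) z) +
      ℓ * f (natMul ℓ hℓ.pos z) = (1 + ℓ) * f z := by
  induction hf using Submodule.span_induction with
  | mem f hf =>
    obtain ⟨a, b, hab, rfl⟩ := hf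
    exact heckeHol_hecke_eigen hN hℓ h a b z
  | zero => simp
  | add f g _ _ hf hg =>
    simp only [Pi.add_apply, Finset.sum_add_distrib]
    linear_combination hf + hg
  | smul c f _ hf =>
    simp only [Pi.smul_apply, smul_eq_mul, ← Finset.mul_sum]
    linear_combination c * hf

lemma norm_slash_mul_im (f : ℍ → ℂ) (γ : SL(2, ℤ)) (z : ℍ) :
    ‖(f ∣[(2 : ℤ)] γ) z‖ * z.im = ‖f (γ • z)‖ * (γ • z).im := by
  rw [ModularForm.SL_slash_apply, ModularGroup.im_smul_eq_div_normSq, norm_mul, norm_zpow,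
    Complex.normSq_eq_norm_sq, zpow_neg, div_eq_mul_inv]
  norm_cast
  ring

/-- The cusp form attached to a linear combination of Eisenstein series that vanishes at all
cusps. -/
def cuspFormOfHeckeSpanLevel {N : ℕ} [NeZero N] {f : ℍ → ℂ} (hf : f ∈ heckeSpanLevel N)
    (h : ∀ γ : SL(2, ℤ), Tendsto (f ∣[(2 : ℤ)] γ) atImInfty (𝓝 0)) :
    CuspForm (Gamma N) 2 where
  toFun := f
  slash_action_eq' γ hγ := by
    obtain ⟨γ, hγ, rfl⟩ := hγ
    exact slash_eq_of_mem_heckeSpanLevel hf hγ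
  holo' := mdifferentiable_of_mem_heckeSpan
    (heckeSpanLevel_le_heckeSpan (Nat.pos_of_ne_zero (NeZero.ne N)) hf)
  zero_at_cusps' {c} hc := by
    rw [Subgroup.IsArithmetic.isCusp_iff_isCusp_SL2Z] at hc
    rw [OnePoint.isZeroAt_iff_forall_SL2Z hc]
    exact fun γ _ => h γ

/-- Exponential decay of a cusp form at `∞` beats the factor `Im z`. -/
lemma tendsto_norm_mul_im {N : ℕ} [NeZero N] {f : ℍ → ℂ} (hf : f ∈ heckeSpanLevel N)
    (h : ∀ γ : SL(2, ℤ), Tendsto (f ∣[(2 : ℤ)] γ) atImInfty (𝓝 0)) :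
    Tendsto (fun z : ℍ => ‖f z‖ * z.im) atImInfty (𝓝 0) := by
  let Γ : Subgroup (GL (Fin 2) ℝ) := Gamma N
  have hpos : 0 < Γ.strictWidthInfty := Γ.strictWidthInfty_pos_iff.mpr <| by
    rw [Subgroup.IsArithmetic.isCusp_iff_isCusp_SL2Z, isCusp_SL2Z_iff']
    exact ⟨1, by simp⟩
  have hO := CuspFormClass.exp_decay_atImInfty (cuspFormOfHeckeSpanLevel hf h) hpos
    Γ.strictWidthInfty_mem_strictPeriods
  obtain ⟨c, hc⟩ := hO.bound
  set w := Γ.strictWidthInfty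
  have hlim : Tendsto (fun y : ℝ => c * (y ^ (1 : ℝ) * Real.exp (-(2 * Real.pi / w) * y))) atTop
      (𝓝 0) := by
    have := (tendsto_rpow_mul_exp_neg_mul_atTop_nhds_zero 1 _
      (show 0 < 2 * Real.pi / w by positivity)).const_mul c
    rwa [mul_zero] at this
  refine squeeze_zero' (Eventually.of_forall fun z => by have := z.im_pos; positivity) ?_
    (hlim.comp (show Tendsto UpperHalfPlane.im atImInfty atTop from tendsto_comap))
  filter_upwards [hc] with z hz
  refine (mul_le_mul_of_nonneg_right hz z.im_pos.le).trans (le_of_eq ?_)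
  rw [Real.norm_of_nonneg (Real.exp_pos _).le, Function.comp_apply, Real.rpow_one, mul_assoc]
  congr 1
  rw [mul_comm]
  congr 2
  ring

lemma exists_norm_mul_im_le {N : ℕ} [NeZero N] {f : ℍ → ℂ} (hf : f ∈ heckeSpanLevel N)
    (h : ∀ γ : SL(2, ℤ), Tendsto (f ∣[(2 : ℤ)] γ) atImInfty (𝓝 0)) :
    ∃ C, ∀ z : ℍ, ‖f z‖ * z.im ≤ C := by
  obtain ⟨C, hC⟩ := CuspFormClass.exists_bound (cuspFormOfHeckeSpanLevel hf h)
  refine ⟨C, fun z => ?_⟩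
  have := hC z
  rw [show ((2 : ℤ) : ℝ) / 2 = 1 by norm_num, Real.rpow_one, le_div_iff₀ z.im_pos] at this
  exact this

lemma im_natMul (p : ℕ) (hp : 0 < p) (z : ℍ) : (natMul p hp z).im = p * z.im := by
  simp [← UpperHalfPlane.coe_im]

lemma im_addDiv (ℓ : ℕ) (hℓ : 0 < ℓ) (t : ℕ) (z : ℍ) : (addDiv ℓ hℓ t z).im = z.im / ℓ := by
  rw [← UpperHalfPlane.coe_im, coe_addDiv, Complex.div_natCast_im]
  simp

/-- In the eigenvalue relation multiplied by `Im z`, the `ℓ` points `(z + N k) / ℓ` contribute at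
most `ℓ M` altogether. So if `|f| y` is close to `M` at `z`, it is close to `M` at the higher point
`ℓ z` too, the defect growing by at most `1 + ℓ`. -/
lemma le_norm_mul_im_natMul {N ℓ : ℕ} (hN : 0 < N) (hℓ : ℓ.Prime)
    (h : (ℓ : ZMod N) = 1) {f : ℍ → ℂ} (hf : f ∈ heckeSpanLevel N) {M : ℝ}
    (hM : ∀ z : ℍ, ‖f z‖ * z.im ≤ M) (z : ℍ) :
    M - ‖f (natMul ℓ hℓ.pos z)‖ * (natMul ℓ hℓ.pos z).im ≤ (1 + ℓ) * (M - ‖f z‖ * z.im) := by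
  have hl : (0 : ℝ) < ℓ := by exact_mod_cast hℓ.pos
  have e := hecke_eigen_of_mem_heckeSpanLevel hN hℓ h hf z
  have him (k : ℕ) : (addDiv ℓ hℓ.pos (N * k) z).im = z.im / ℓ := im_addDiv ..
  have him' : (natMul ℓ hℓ.pos z).im = ℓ * z.im := im_natMul ..
  have hsum : ‖∑ k ∈ Finset.range ℓ, f (addDiv ℓ hℓ.pos (N * k) z)‖ * z.im ≤ ℓ * (ℓ * M) := by
    refine (mul_le_mul_of_nonneg_right (norm_sum_le _ _) z.im_pos.le).trans ?_
    rw [Finset.sum_mul]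
    refine (Finset.sum_le_card_nsmul _ _ (ℓ * M) fun k _ => ?_).trans (by simp)
    have := hM (addDiv ℓ hℓ.pos (N * k) z)
    rw [him, mul_div_assoc', div_le_iff₀ hl] at this
    linarith
  have hn : (1 + (ℓ : ℝ)) * ‖f z‖ ≤ (ℓ : ℝ)⁻¹ *
      ‖∑ k ∈ Finset.range ℓ, f (addDiv ℓ hℓ.pos (N * k) z)‖ + ℓ * ‖f (natMul ℓ hℓ.pos z)‖ := by
    have h1 := congrArg norm e
    have h2 : ‖(1 + (ℓ : ℂ))‖ = 1 + ℓ := by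
      rw [show (1 + (ℓ : ℂ)) = ((1 + ℓ : ℕ) : ℂ) by push_cast; rfl, Complex.norm_natCast]
      push_cast
      rfl
    rw [norm_mul, h2] at h1
    rw [← h1]
    refine (norm_add_le _ _).trans ?_
    rw [norm_mul, norm_mul, norm_inv, Complex.norm_natCast]
  rw [him']
  have h3 := mul_le_mul_of_nonneg_right hn z.im_pos.le
  have h4 : (ℓ : ℝ)⁻¹ * ‖∑ k ∈ Finset.range ℓ, f (addDiv ℓ hℓ.pos (N * k) z)‖ * z.im ≤ ℓ * M := by
    rw [mul_assoc, inv_mul_le_iff₀ hl]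
    exact hsum
  linarith

/-- A linear combination of holomorphic Eisenstein series that vanishes at all cusps is zero. -/
theorem eq_zero_of_tendsto_zero {f : ℍ → ℂ} (hf : f ∈ heckeSpan)
    (h : ∀ γ : SL(2, ℤ), Tendsto (f ∣[(2 : ℤ)] γ) atImInfty (𝓝 0)) : f = 0 := by
  obtain ⟨N, hN, hf⟩ := exists_mem_heckeSpanLevel hf
  have : NeZero N := ⟨hN.ne'⟩
  have hγ (γ δ : SL(2, ℤ)) : Tendsto ((f ∣[(2 : ℤ)] γ) ∣[(2 : ℤ)] δ) atImInfty (𝓝 0) := by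
    rw [← SlashAction.slash_mul]
    exact h _
  obtain ⟨C, hC⟩ := exists_norm_mul_im_le hf h
  have hbdd : BddAbove (Set.range fun z : ℍ => ‖f z‖ * z.im) :=
    ⟨C, by rintro _ ⟨z, rfl⟩; exact hC z⟩
  set M := ⨆ z : ℍ, ‖f z‖ * z.im with hMdef
  have hM (z : ℍ) : ‖f z‖ * z.im ≤ M := le_ciSup hbdd z
  suffices hM0 : M ≤ 0 by
    ext z
    have := (hM z).trans hM0
    have := nonpos_of_mul_nonpos_left this z.im_pos
    simpa using this
  by_contra! hMpos
  have hMγ (γ : SL(2, ℤ)) (z : ℍ) : ‖(f ∣[(2 : ℤ)] γ) z‖ * z.im ≤ M := by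
    rw [norm_slash_mul_im]
    exact hM _
  -- Finiteness yields one height `A` above which all translates satisfy `|g| y < M / 2`.
  have hfin : (Set.range fun γ : SL(2, ℤ) => f ∣[(2 : ℤ)] γ).Finite := by
    have hfac : Function.FactorsThrough (fun γ : SL(2, ℤ) => f ∣[(2 : ℤ)] γ)
        (fun γ (i j : Fin 2) => ((γ i j : ℤ) : ZMod N)) := fun γ γ' hγ =>
      slash_congr_of_mem_heckeSpanLevel hf fun i j => congrFun (congrFun hγ i) j
    obtain ⟨e, he⟩ := (Function.factorsThrough_iff _).mp hfac
    rw [he, Set.range_comp]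
    exact (Set.toFinite _).image _
  have hev : ∀ᶠ z in atImInfty, ∀ g ∈ Set.range fun γ : SL(2, ℤ) => f ∣[(2 : ℤ)] γ,
      ‖g z‖ * z.im < M / 2 := by
    rw [eventually_all_finite hfin]
    rintro _ ⟨γ, rfl⟩
    exact (tendsto_norm_mul_im (slash_mem_heckeSpanLevel hf γ) (hγ γ)).eventually_lt_const
      (half_pos hMpos)
  obtain ⟨A, hA⟩ := (atImInfty_mem _).mp hev
  obtain ⟨ℓ, hℓ1, hℓ, hℓN⟩ := Nat.forall_exists_prime_gt_and_eq_mod (q := N) isUnit_one 1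
  have hℓ0 : (0 : ℝ) < ℓ := by exact_mod_cast hℓ.pos
  -- Points of the fundamental domain have height at least `1 / 2`, so `j` multiplications by `ℓ`
  -- lift any of them above `A`. Thus `j` is fixed before `z₀`, which is then chosen so near the
  -- supremum that the defect stays below `M / 2` after `j` steps.
  obtain ⟨j, hj⟩ := pow_unbounded_of_one_lt (2 * A) (show (1 : ℝ) < ℓ by exact_mod_cast hℓ1)
  have hε : 0 < M / 2 / (1 + ℓ) ^ j := by positivity
  obtain ⟨z₀, hz₀⟩ := exists_lt_of_lt_ciSup (show M - M / 2 / (1 + ℓ) ^ j < ⨆ z : ℍ, ‖f z‖ * z.im by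
    linarith)
  obtain ⟨γ, hγz⟩ := ModularGroup.exists_smul_mem_fd z₀
  have h3 := ModularGroup.three_le_four_mul_im_sq_of_mem_fd hγz
  set z₁ := γ • z₀ with hz₁
  have hz₁im : 1 / 2 ≤ z₁.im := by nlinarith [z₁.im_pos]
  have hz₁' : ‖(f ∣[(2 : ℤ)] γ⁻¹) z₁‖ * z₁.im = ‖f z₀‖ * z₀.im := by
    rw [norm_slash_mul_im, hz₁, inv_smul_smul]
  set g := f ∣[(2 : ℤ)] γ⁻¹ with hg
  have key (i : ℕ) : ∃ z : ℍ, z.im = ℓ ^ i * z₁.im ∧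
      M - ‖g z‖ * z.im ≤ (1 + ℓ) ^ i * (M - ‖g z₁‖ * z₁.im) := by
    induction i with
    | zero => exact ⟨z₁, by simp, by simp⟩
    | succ i ih =>
      obtain ⟨z, hz, hz'⟩ := ih
      refine ⟨natMul ℓ hℓ.pos z, ?_, ?_⟩
      · rw [im_natMul, hz]
        ring
      · refine (le_norm_mul_im_natMul hN hℓ hℓN (slash_mem_heckeSpanLevel hf γ⁻¹) (hMγ _) z).trans ?_
        rw [pow_succ', mul_assoc]
        exact mul_le_mul_of_nonneg_left hz' (by positivity)
  obtain ⟨z, hz, hz'⟩ := key j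
  have hlt : ‖g z‖ * z.im < M / 2 := hA z (by rw [hz]; nlinarith [pow_pos hℓ0 j]) g ⟨_, rfl⟩
  rw [hz₁'] at hz'
  have : (1 + (ℓ : ℝ)) ^ j * (M - ‖f z₀‖ * z₀.im) < M / 2 := by
    rw [mul_comm, ← lt_div_iff₀ (by positivity)]
    linarith
  linarith

end


/-! ### Gauss sums and character sums of the `φ_x`. -/

noncomputable section

section CharacterSums

lemma sum_zmod_val {n : ℕ} [NeZero n] {E : Type*} [AddCommMonoid E] (F : ℕ → E) :
    ∑ b : ZMod n, F b.val = ∑ i ∈ Finset.range n, F i := by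
  cases n with
  | zero => exact absurd rfl (NeZero.ne 0)
  | succ n => exact Fin.sum_univ_eq_sum_range F (n + 1)

lemma sum_zmod_sq {n : ℕ} [NeZero n] (F : ℕ → ℂ) :
    ∑ b : ZMod (n ^ 2), F b.val = ∑ i : ZMod n, ∑ j : ZMod n, F (i.val + n * j.val) := by
  rw [sum_zmod_val, pow_two]
  have h (i : ZMod n) : ∑ j : ZMod n, F (i.val + n * j.val) =
      ∑ j ∈ Finset.range n, F (i.val + n * j) := sum_zmod_val fun j => F (i.val + n * j)
  rw [Finset.sum_congr rfl fun i _ => h i,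
    sum_zmod_val (n := n) fun i => ∑ j ∈ Finset.range n, F (i + n * j), Finset.sum_comm]
  simp only [Finset.sum_range]
  rw [← Equiv.sum_comp finProdFinEquiv, Fintype.sum_prod_type]
  rfl

variable {f : ℕ} [NeZero f] {χ : DirichletCharacter ℂ f}

/-- For primitive `χ` every twisted Gauss sum is a multiple of this one, while Fourier inversion at
`1` recovers `f χ(1) = f ≠ 0` from them. -/
lemma gaussSum_ne_zero_of_primitive (hχ : χ.IsPrimitive) :
    gaussSum χ (ZMod.stdAddChar (N := f)) ≠ 0 := by
  intro h0
  have h1 : ∑ a : ZMod f, gaussSum χ ((ZMod.stdAddChar (N := f)).mulShift a) *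
      ZMod.stdAddChar (-a) = 0 := by
    simp [gaussSum_mulShift_of_isPrimitive _ hχ, h0]
  have h2 : ∑ a : ZMod f, gaussSum χ ((ZMod.stdAddChar (N := f)).mulShift a) *
      ZMod.stdAddChar (-a) = f := by
    simp only [gaussSum, Finset.sum_mul]
    rw [Finset.sum_comm]
    have (x : ZMod f) : ∑ a : ZMod f, χ x * (ZMod.stdAddChar (N := f)).mulShift a x *
        ZMod.stdAddChar (-a) = χ x * if x - 1 = 0 then (f : ℂ) else 0 := by
      rw [← sum_stdAddChar_mul, Finset.mul_sum]
      refine Finset.sum_congr rfl fun a _ => ?_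
      rw [AddChar.mulShift_apply, mul_assoc, ← AddChar.map_add_eq_mul]
      ring_nf
    rw [Finset.sum_congr rfl fun x _ => this x]
    simp [sub_eq_zero]
  rw [h1] at h2
  exact NeZero.ne f (by exact_mod_cast h2.symm)

lemma stdAddChar_natCast_mul (k : ℤ) :
    (ZMod.stdAddChar (((f : ℤ) * k : ℤ) : ZMod (f ^ 2)) : ℂ) =
      ZMod.stdAddChar ((k : ℤ) : ZMod f) := by
  have hf : (f : ℂ) ≠ 0 := by exact_mod_cast NeZero.ne f
  rw [ZMod.stdAddChar_coe, ZMod.stdAddChar_coe]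
  congr 1
  push_cast
  field_simp

/-- Twisted sum of additive characters modulo `f²` against a primitive character modulo `f`. -/
lemma sum_primitive_mul_stdAddChar (hχ : χ.IsPrimitive) (k : ℤ) :
    ∑ b : ZMod (f ^ 2), χ (b.val : ZMod f) *
        ZMod.stdAddChar ((b.val : ZMod (f ^ 2)) * (k : ZMod (f ^ 2))) =
      if (f : ℤ) ∣ k then
        f * χ⁻¹ ((k / f : ℤ) : ZMod f) * gaussSum χ (ZMod.stdAddChar (N := f)) else 0 := by
  -- Write `b = i + f j`: the character sees only `i`, the sum over `j` forces `f ∣ k`, and a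
  -- twisted Gauss sum modulo `f` remains.
  rw [sum_zmod_sq (n := f) fun b => χ (b : ZMod f) *
    ZMod.stdAddChar ((b : ZMod (f ^ 2)) * (k : ZMod (f ^ 2)))]
  have hterm (i j : ZMod f) : χ ((i.val + f * j.val : ℕ) : ZMod f) *
      (ZMod.stdAddChar (((i.val + f * j.val : ℕ) : ZMod (f ^ 2)) * (k : ZMod (f ^ 2))) : ℂ) =
      χ i * ZMod.stdAddChar ((i.val : ZMod (f ^ 2)) * (k : ZMod (f ^ 2))) *
        ZMod.stdAddChar (j * (k : ZMod f)) := by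
    have h1 : ((i.val + f * j.val : ℕ) : ZMod f) = i := by simp
    have h2 : (((i.val + f * j.val : ℕ) : ZMod (f ^ 2)) * (k : ZMod (f ^ 2))) =
        (i.val : ZMod (f ^ 2)) * (k : ZMod (f ^ 2)) +
          (((f : ℤ) * (j.val * k) : ℤ) : ZMod (f ^ 2)) := by
      push_cast
      ring
    have h3 : ((j.val * k : ℤ) : ZMod f) = j * k := by simp
    rw [h1, h2, AddChar.map_add_eq_mul, stdAddChar_natCast_mul, h3, mul_assoc]
  simp only [hterm, ← Finset.mul_sum, sum_stdAddChar_mul]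
  have hdvd : (k : ZMod f) = 0 ↔ (f : ℤ) ∣ k := ZMod.intCast_zmod_eq_zero_iff_dvd k f
  simp only [hdvd]
  split_ifs with h
  · obtain ⟨k, rfl⟩ := h
    rw [Int.mul_ediv_cancel_left _ (by exact_mod_cast NeZero.ne f), mul_assoc,
      ← gaussSum_mulShift_of_isPrimitive _ hχ, gaussSum, Finset.mul_sum]
    refine Finset.sum_congr rfl fun i _ => ?_
    have h2 : (i.val : ZMod (f ^ 2)) * (((f : ℤ) * k : ℤ) : ZMod (f ^ 2)) =
        (((f : ℤ) * (i.val * k) : ℤ) : ZMod (f ^ 2)) := by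
      push_cast
      ring
    have h3 : ((i.val * k : ℤ) : ZMod f) = k * i := by simp [mul_comm]
    rw [h2, stdAddChar_natCast_mul, h3, AddChar.mulShift_apply]
    ring
  · simp

lemma sum_mul_resInd (n : ℕ) (F : ZMod f → ℂ) :
    ∑ a : ZMod f, F a * resInd a n = F n := by
  simp [resInd]

lemma sum_mul_resInd_neg (n : ℕ) (F : ZMod f → ℂ) :
    ∑ a : ZMod f, F a * resInd (-a) n = F (-n) := by
  have (a : ZMod f) : (n : ZMod f) = -a ↔ -(n : ZMod f) = a := by rw [neg_eq_iff_eq_neg]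
  simp [resInd, this]

lemma sum_units_eq_sum {n : ℕ} [NeZero n] {E : Type*} [AddCommMonoid E] (F : ZMod n → E)
    (hF : ∀ a, ¬ IsUnit a → F a = 0) : ∑ a : (ZMod n)ˣ, F a = ∑ a : ZMod n, F a :=
  Fintype.sum_of_injective _ Units.val_injective _ _ (fun a ha => hF a fun ⟨u, hu⟩ => ha ⟨u, hu⟩)
    fun _ => rfl

lemma sum_sum_char_mul_dsum (c d g : ℂ) {A : ZMod f → ℕ → ℂ} {B : ZMod (f ^ 2) → ℕ → ℂ}
    (hA : ∀ a, BddSeq (A a)) (hB : ∀ b, BddSeq (B b))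
    (hA' : ∀ n, ∑ a, χ a * A a n = c * χ (n : ZMod f))
    (hB' : ∀ m : ℕ, ∑ b, χ (b.val : ZMod f) * B b m =
      if f ∣ m then d * (f * χ⁻¹ ((m / f : ℕ) : ZMod f) * g) else 0) (z : ℍ) :
    ∑ a : ZMod f, ∑ b : ZMod (f ^ 2), (χ a * χ (b.val : ZMod f)) *
        dsum (A a) (B b) ((z : ℂ) / f) =
      c * d * (f * g) * dsum (fun n => χ (n : ZMod f)) (fun m => χ⁻¹ (m : ZMod f)) z := by
  have hf : 0 < f := Nat.pos_of_ne_zero (NeZero.ne f)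
  have hf' : (f : ℂ) ≠ 0 := by exact_mod_cast hf.ne'
  have h := dsum_sum_sum Finset.univ Finset.univ _ _ (fun a => (hA a).const_mul (χ a))
    (fun b : ZMod (f ^ 2) => (hB b).const_mul (χ (b.val : ZMod f))) (im_div_nat_pos z hf)
  simp only [hA', hB', dsum_const_mul_left, dsum_const_mul_right, dsum_ite_dvd_right hf,
    Nat.mul_div_cancel_left _ hf, mul_div_cancel₀ _ hf'] at h
  simp only [mul_assoc] at h ⊢
  rw [Finset.sum_congr rfl fun a _ => Finset.sum_congr rfl fun b _ =>
    mul_left_comm (χ a) (χ (b.val : ZMod f)) _, h, show (fun n : ℕ => (f : ℂ) * (χ⁻¹ (n : ZMod f) * g)) =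
    fun n : ℕ => (f * g) * χ⁻¹ (n : ZMod f) by ext; ring, dsum_const_mul_right]
  ring

/-- The sum over `a` turns residue indicators into `χ(n)`; the one over `b` modulo `f²` forces `f ∣
m`, which undoes the scaling `z / f` and leaves `χ⁻¹(m / f)` and a Gauss sum. The constant terms
cancel for `f ≠ 1` because `χ` sums to zero over `b`. -/
lemma sum_char_dsum (hχ : χ.IsPrimitive) (z : ℍ) :
    ∑ a : ZMod f, ∑ b : ZMod (f ^ 2), (χ a * χ (b.val : ZMod f)) *
        heckeHol ((a.val : ℚ) / f, (b.val : ℚ) / (f : ℚ) ^ 2) z =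
      (if f = 1 then 1 / 12 else 0) - 2 * gaussSum χ (ZMod.stdAddChar (N := f)) *
        dsum (fun n => χ (n : ZMod f)) (fun m => χ⁻¹ (m : ZMod f)) z := by
  have hf : 0 < f := Nat.pos_of_ne_zero (NeZero.ne f)
  have hz := im_div_nat_pos z hf
  have hf' : (f : ℂ) ≠ 0 := by exact_mod_cast hf.ne'
  have hexp (b : ZMod (f ^ 2)) (m : ℕ) : expSeq ((b.val : ℚ) / (f : ℚ) ^ 2) m =
      ZMod.stdAddChar ((b.val : ZMod (f ^ 2)) * ((m : ℤ) : ZMod (f ^ 2))) := by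
    have := expSeq_div_eq (N := f ^ 2) b.val m
    push_cast at this ⊢
    exact this
  have hexp' (b : ZMod (f ^ 2)) (m : ℕ) : expSeq (-((b.val : ℚ) / (f : ℚ) ^ 2)) m =
      ZMod.stdAddChar ((b.val : ZMod (f ^ 2)) * ((-m : ℤ) : ZMod (f ^ 2))) := by
    have := expSeq_div_eq (N := f ^ 2) (-b.val) m
    push_cast at this ⊢
    rw [← neg_div, this]
    ring_nf
  have h0 := sum_primitive_mul_stdAddChar hχ 0
  simp only [Int.cast_zero, mul_zero, AddChar.map_zero_eq_one, mul_one, dvd_zero, if_true,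
    Int.zero_ediv] at h0
  set g := gaussSum χ (ZMod.stdAddChar (N := f)) with hg
  have h1 := sum_sum_char_mul_dsum (χ := χ) 1 1 g bddSeq_resInd
    (fun b : ZMod (f ^ 2) => bddSeq_expSeq ((b.val : ℚ) / (f : ℚ) ^ 2))
    (fun n => by rw [sum_mul_resInd, one_mul]) (fun m => by
      simp only [hexp, sum_primitive_mul_stdAddChar hχ, ← hg, Int.natCast_dvd_natCast, one_mul]
      norm_cast) z
  have h2 := sum_sum_char_mul_dsum (χ := χ) (χ (-1)) (χ⁻¹ (-1)) g (fun a => bddSeq_resInd (-a))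
    (fun b : ZMod (f ^ 2) => bddSeq_expSeq (-((b.val : ℚ) / (f : ℚ) ^ 2)))
    (fun n => by rw [sum_mul_resInd_neg, ← map_mul, neg_one_mul]) (fun m => by
      simp only [hexp', sum_primitive_mul_stdAddChar hχ, ← hg, dvd_neg, Int.natCast_dvd_natCast]
      split_ifs with hm
      · rw [Int.neg_ediv_of_dvd (by exact_mod_cast hm)]
        rw [← Int.natCast_div, Int.cast_neg, Int.cast_natCast, neg_eq_neg_one_mul, map_mul]
        ring
      · rfl) z
  -- The signs from `-x` cancel, so the two halves `P_x` and `P_{-x}` contribute equally.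
  have hχ1 : χ (-1) * χ⁻¹ (-1) = 1 := by
    rw [← MulChar.mul_apply, mul_inv_cancel, MulChar.one_apply isUnit_one.neg]
  have hexpand (a : ZMod f) (b : ZMod (f ^ 2)) :
      heckeHol ((a.val : ℚ) / f, (b.val : ℚ) / (f : ℚ) ^ 2) z = (1 / 2) *
        (((Int.fract ((a.val : ℚ) / f)) ^ 2 - Int.fract ((a.val : ℚ) / f) + 1 / 6 : ℚ) : ℂ) -
      (f : ℂ)⁻¹ * (dsum (resInd a) (expSeq ((b.val : ℚ) / (f : ℚ) ^ 2)) ((z : ℂ) / f) +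
        dsum (resInd (-a)) (expSeq (-((b.val : ℚ) / (f : ℚ) ^ 2))) ((z : ℂ) / f)) := by
    have := heckeHol_eq_dsum hf a.val ((b.val : ℚ) / (f : ℚ) ^ 2) z
    simpa using this
  have h3 : ∑ a : ZMod f, ∑ b : ZMod (f ^ 2), (χ a * χ (b.val : ZMod f)) * ((1 / 2) *
        (((Int.fract ((a.val : ℚ) / f)) ^ 2 - Int.fract ((a.val : ℚ) / f) + 1 / 6 : ℚ) : ℂ)) =
      if f = 1 then 1 / 12 else 0 := by
    split_ifs with hf1
    · subst hf1
      have h01 (x : ZMod 1) : χ x = 1 := by rw [Subsingleton.elim x 1, map_one]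
      have h02 (x : ZMod 1) : (x.val : ℚ) = 0 := by
        rw [Subsingleton.elim x 0, ZMod.val_zero, Nat.cast_zero]
      simp only [h01, h02]
      norm_num
    · have : Nontrivial (ZMod f) := ZMod.nontrivial_iff.mpr hf1
      rw [MulChar.map_zero, mul_zero, zero_mul] at h0
      simp_rw [mul_right_comm _ _ (_ * _), ← Finset.mul_sum, h0]
      simp
  simp only [hexpand, mul_sub, Finset.sum_sub_distrib, h3, mul_left_comm _ (f : ℂ)⁻¹,
    ← Finset.mul_sum, mul_add, Finset.sum_add_distrib, h1, h2, hχ1]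
  field_simp
  ring

end CharacterSums

end


/-! ### Fourier expansions of `E_ψ` and of its images under the operators `[p]⁺` and `[p]⁻`. -/

noncomputable section

lemma sum_heckePhi_of_eq_one {f : ℕ} [NeZero f] (h : f = 1) :
    (-1 / (2 * ∑ x : ZMod f, ZMod.stdAddChar x) : ℂ) • ∑ a : ZMod f, ∑ b : ZMod (f ^ 2),
      heckePhi ((a.val : ℚ) / f, (b.val : ℚ) / (f : ℚ) ^ 2) = (-1 / 2 : ℂ) • heckePhi 0 := by
  subst h
  have h1 (x : ZMod 1) : (ZMod.stdAddChar x : ℂ) = 1 := by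
    rw [Subsingleton.elim x 0, AddChar.map_zero_eq_one]
  have h2 (x : ZMod 1) : (x.val : ℚ) = 0 := by
    rw [Subsingleton.elim x 0, ZMod.val_zero, Nat.cast_zero]
  simp only [h1, h2]
  norm_num
  rfl

lemma heckePhi_zero_apply (z : ℍ) :
    heckePhi 0 z = 1 / 12 - nonHol z - 2 * dsum (fun _ => 1) (fun _ => 1) z := by
  have h := heckeHol_eq_dsum one_pos 0 0 z
  have h1 : resInd (N := 1) ((0 : ℤ) : ZMod 1) = fun _ => 1 := by
    ext n
    rw [resInd, if_pos (Subsingleton.elim _ _)]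
  have h2 : resInd (N := 1) (-((0 : ℤ) : ZMod 1)) = fun _ => 1 := by
    ext n
    rw [resInd, if_pos (Subsingleton.elim _ _)]
  have h3 : expSeq 0 = fun _ => 1 := by
    ext n
    simp [expSeq]
  rw [neg_zero, h1, h2, h3] at h
  rw [heckePhi_of_integral ⟨⟨0, by simp⟩, ⟨0, by simp⟩⟩, Pi.sub_apply,
    show (0 : ℚ × ℚ) = (((0 : ℤ) : ℚ) / (1 : ℕ), 0) by ext <;> simp, h]
  norm_num
  ring

section EisPsi

variable {n : ℕ} (ψ : DirichletCharacter ℂ n)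

lemma psiVal_mul (a b : ℕ) : psiVal ψ (a * b) = psiVal ψ a * psiVal ψ b := by
  simp [psiVal]

lemma psiInvVal_mul (a b : ℕ) : psiInvVal ψ (a * b) = psiInvVal ψ a * psiInvVal ψ b := by
  simp only [psiInvVal, Nat.cast_mul, map_mul]

@[simp] lemma psiVal_one : psiVal ψ 1 = 1 := by simp [psiVal]

@[simp] lemma psiInvVal_one : psiInvVal ψ 1 = 1 := by simp only [psiInvVal, Nat.cast_one, map_one]

lemma bddSeq_psiVal : BddSeq (psiVal ψ) := ⟨1, fun _ => DirichletCharacter.norm_le_one _ _⟩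

lemma bddSeq_psiInvVal : BddSeq (psiInvVal ψ) := ⟨1, fun _ => DirichletCharacter.norm_le_one _ _⟩

lemma psiVal_mul_psiInvVal {a : ℕ} (ha : a.Coprime ψ.conductor) :
    psiVal ψ a * psiInvVal ψ a = 1 := by
  rw [psiVal, psiInvVal, ← MulChar.mul_apply, mul_inv_cancel, MulChar.one_apply]
  rwa [ZMod.isUnit_iff_coprime]

lemma psiVal_eq_zero {a : ℕ} (ha : ¬ a.Coprime ψ.conductor) : psiVal ψ a = 0 :=
  MulChar.map_nonunit _ (by rwa [ZMod.isUnit_iff_coprime])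

lemma psiInvVal_eq_zero {a : ℕ} (ha : ¬ a.Coprime ψ.conductor) : psiInvVal ψ a = 0 :=
  MulChar.map_nonunit _ (by rwa [ZMod.isUnit_iff_coprime])

lemma psiVal_eq_one (h : ψ.conductor = 1) (a : ℕ) : psiVal ψ a = 1 := by
  have : Subsingleton (ZMod ψ.conductor) := ZMod.subsingleton_iff.mpr h
  rw [psiVal, Subsingleton.elim (a : ZMod ψ.conductor) 1, map_one]

lemma psiInvVal_eq_one (h : ψ.conductor = 1) (a : ℕ) : psiInvVal ψ a = 1 := by
  have : Subsingleton (ZMod ψ.conductor) := ZMod.subsingleton_iff.mpr h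
  rw [psiInvVal, Subsingleton.elim (a : ZMod ψ.conductor) 1, map_one]

variable [NeZero n]

lemma eisPsi_eq_sum : eisPsi ψ =
    (-1 / (2 * gaussSum ψ.primitiveCharacter (ZMod.stdAddChar (N := ψ.conductor)))) •
      ∑ a : ZMod ψ.conductor, ∑ b : ZMod (ψ.conductor ^ 2),
        (ψ.primitiveCharacter a * ψ.primitiveCharacter (b.val : ZMod ψ.conductor)) •
          heckePhi ((a.val : ℚ) / ψ.conductor, (b.val : ℚ) / (ψ.conductor : ℚ) ^ 2) := by
  have hb (b : ZMod (ψ.conductor ^ 2)) (h : ¬ IsUnit b) :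
      ψ.primitiveCharacter (b.val : ZMod ψ.conductor) = 0 := by
    refine MulChar.map_nonunit _ fun hu => h ?_
    rw [ZMod.isUnit_iff_coprime] at hu
    rw [← ZMod.natCast_zmod_val b, ZMod.isUnit_iff_coprime]
    exact hu.pow_right 2
  rw [eisPsi]
  congr 1
  simp only [psiVal, ZMod.natCast_zmod_val]
  rw [sum_units_eq_sum (fun a : ZMod ψ.conductor => ∑ b : (ZMod (ψ.conductor ^ 2))ˣ,
    (ψ.primitiveCharacter a * ψ.primitiveCharacter ((b : ZMod (ψ.conductor ^ 2)).val :
      ZMod ψ.conductor)) • heckePhi ((a.val : ℚ) / ψ.conductor,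
        ((b : ZMod (ψ.conductor ^ 2)).val : ℚ) / (ψ.conductor : ℚ) ^ 2))
    fun a ha => by simp [MulChar.map_nonunit _ ha]]
  exact Finset.sum_congr rfl fun a _ => sum_units_eq_sum
    (fun b : ZMod (ψ.conductor ^ 2) =>
      (ψ.primitiveCharacter a * ψ.primitiveCharacter (b.val : ZMod ψ.conductor)) •
        heckePhi ((a.val : ℚ) / ψ.conductor, (b.val : ℚ) / (ψ.conductor : ℚ) ^ 2))
    fun b h => by rw [hb b h, mul_zero, zero_smul]

lemma not_isIntegralPair_of_isUnit {f : ℕ} [NeZero f] (hf : f ≠ 1) {a : ZMod f} (ha : IsUnit a)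
    (y : ℚ) : ¬ IsIntegralPair ((a.val : ℚ) / f, y) := by
  rintro ⟨⟨m, hm⟩, -⟩
  have hf0 : (f : ℚ) ≠ 0 := by exact_mod_cast NeZero.ne f
  have : Nontrivial (ZMod f) := ZMod.nontrivial_iff.mpr hf
  refine ha.ne_zero ?_
  rw [div_eq_iff hf0] at hm
  have h : ((a.val : ℤ) : ZMod f) = ((m * f : ℤ) : ZMod f) := congrArg _ (by exact_mod_cast hm)
  simpa using h

lemma eisPsi_eq_sum_heckeHol (h : ψ.conductor ≠ 1) : eisPsi ψ =
    (-1 / (2 * gaussSum ψ.primitiveCharacter (ZMod.stdAddChar (N := ψ.conductor)))) •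
      ∑ a : ZMod ψ.conductor, ∑ b : ZMod (ψ.conductor ^ 2),
        (ψ.primitiveCharacter a * ψ.primitiveCharacter (b.val : ZMod ψ.conductor)) •
          heckeHol ((a.val : ℚ) / ψ.conductor, (b.val : ℚ) / (ψ.conductor : ℚ) ^ 2) := by
  rw [eisPsi_eq_sum]
  congr 1
  refine Finset.sum_congr rfl fun a _ => Finset.sum_congr rfl fun b _ => ?_
  by_cases ha : IsUnit a
  · rw [heckePhi_of_not_integral (not_isIntegralPair_of_isUnit h ha _)]
  · simp [MulChar.map_nonunit _ ha]

lemma eisPsi_eq_heckePhi_zero (h : ψ.conductor = 1) : eisPsi ψ = (-1 / 2 : ℂ) • heckePhi 0 := by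
  have hχ (x : ZMod ψ.conductor) : ψ.primitiveCharacter x = 1 := by
    have : Subsingleton (ZMod ψ.conductor) := ZMod.subsingleton_iff.mpr h
    rw [Subsingleton.elim x 1, map_one]
  rw [eisPsi_eq_sum]
  simp only [hχ, gaussSum, one_mul, one_smul]
  exact sum_heckePhi_of_eq_one h

lemma eisPsi_apply (z : ℍ) : eisPsi ψ z =
    (if ψ.conductor = 1 then -1 / 24 else 0) + (if ψ.conductor = 1 then 1 / 2 else 0) * nonHol z +
      dsum (psiVal ψ) (psiInvVal ψ) z := by
  split_ifs with h
  · rw [eisPsi_eq_heckePhi_zero ψ h, Pi.smul_apply, heckePhi_zero_apply, smul_eq_mul,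
      dsum_congr (fun n _ => psiVal_eq_one ψ h n) (fun n _ => psiInvVal_eq_one ψ h n)]
    ring
  · have hg := gaussSum_ne_zero_of_primitive ψ.primitiveCharacter_isPrimitive
    have hsum := sum_char_dsum ψ.primitiveCharacter_isPrimitive z
    rw [if_neg h] at hsum
    rw [eisPsi_eq_sum_heckeHol ψ h]
    simp only [Pi.smul_apply, Finset.sum_apply, smul_eq_mul]
    rw [hsum, show (fun n : ℕ => ψ.primitiveCharacter (n : ZMod ψ.conductor)) = psiVal ψ from rfl,
      show (fun n : ℕ => ψ.primitiveCharacter⁻¹ (n : ZMod ψ.conductor)) = psiInvVal ψ from rfl]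
    field_simp
    ring

end EisPsi

/-- Induction along the list of prime factors, with `K` the product of the primes already applied;
square-freeness makes the next prime prime to `K`. -/
lemma prod_dvd_induction {g : ℍ → ℂ} {M : ℕ} (hM : Squarefree M)
    (op : (p : ℕ) → p.Prime → (ℍ → ℂ) → ℍ → ℂ) (P : ℕ → (ℍ → ℂ) → Prop) (h1 : P 1 g)
    (hstep : ∀ (K p : ℕ) (hp : p.Prime) (h : ℍ → ℂ), ¬ p ∣ K → p * K ∣ M → P K h →
      P (p * K) (op p hp h)) :
    P M (M.primeFactorsList.attach.foldr
      (fun p h => op p.1 (Nat.prime_of_mem_primeFactorsList p.2) h) g) := by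
  have key (l : List {p // p ∈ M.primeFactorsList}) (hl : (l.map Subtype.val).prod ∣ M) :
      P (l.map Subtype.val).prod (l.foldr
        (fun p h => op p.1 (Nat.prime_of_mem_primeFactorsList p.2) h) g) := by
    induction l with
    | nil => exact h1
    | cons p l ih =>
      rw [List.map_cons, List.prod_cons] at hl ⊢
      have hp := Nat.prime_of_mem_primeFactorsList p.2
      refine hstep _ _ hp _ (fun hd => ?_) hl (ih (dvd_of_mul_left_dvd hl))
      exact hp.one_lt.ne' (Nat.isUnit_iff.mp (hM _ ((mul_dvd_mul_left _ hd).trans hl)))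
  have h := key M.primeFactorsList.attach
  rw [List.attach_map_subtype_val, Nat.prod_primeFactorsList hM.ne_zero] at h
  exact h dvd_rfl

/-- The form of the Fourier expansion of a weight two Eisenstein series, with constant term `c`,
non-holomorphic part `s * nonHol` and coefficients given by `A` and `B`. -/
def HasDsum (c s : ℂ) (A B : ℕ → ℂ) (g : ℍ → ℂ) : Prop :=
  ∀ z : ℍ, g z = c + s * nonHol z + dsum A B z

/-- A constant is multiplied by `p` under `γ_p` while `nonHol` is fixed; the two factors `1 - p x`
and `1 - x` decide which term dies for a trivial character. -/
lemma HasDsum.sub_smul_gammaOp {c s : ℂ} {A B : ℕ → ℂ} {g : ℍ → ℂ} (hg : HasDsum c s A B g)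
    (p : ℕ) (hp : p.Prime) (x : ℂ) (z : ℍ) : (g - x • gammaOp p hp g) z =
      c * (1 - p * x) + s * (1 - x) * nonHol z +
        (dsum A B z - x * (p * dsum A B (p * z))) := by
  have h := congrFun (gammaOp_nonHol p hp) z
  rw [gammaOp_apply] at h
  rw [Pi.sub_apply, Pi.smul_apply, gammaOp_apply, hg, hg, smul_eq_mul, coe_natMul]
  linear_combination (-x * s) * h

section Operators

variable {n : ℕ} (ψ : DirichletCharacter ℂ n)

/-- The restriction of a sequence to the integers prime to `K`. -/
def coprimePart (K : ℕ) (A : ℕ → ℂ) (n : ℕ) : ℂ := if n.Coprime K then A n else 0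

lemma BddSeq.coprimePart {A : ℕ → ℂ} (hA : BddSeq A) (K : ℕ) : BddSeq (coprimePart K A) :=
  hA.ite _

lemma coprimePart_mul {A : ℕ → ℂ} (hA : ∀ a b, A (a * b) = A a * A b) (K a b : ℕ) :
    coprimePart K A (a * b) = coprimePart K A a * coprimePart K A b := by
  simp only [coprimePart, Nat.coprime_mul_iff_left, hA]
  split_ifs <;> simp_all

lemma coprimePart_prime_mul {p : ℕ} (hp : p.Prime) (K : ℕ) (A : ℕ → ℂ) :
    coprimePart (p * K) A =
      fun n => coprimePart K A n - if p ∣ n then coprimePart K A n else 0 := by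
  ext n
  simp only [coprimePart, Nat.coprime_mul_iff_right, Nat.coprime_comm (n := n) (m := p), hp.coprime_iff_not_dvd]
  split_ifs <;> simp_all

/-- The subtracted series is exactly the part with `p ∣ n`, because the left sequence is
multiplicative with value `ψ(p)` at `p`. -/
lemma HasDsum.plusOpPrime {c s : ℂ} {K : ℕ} {B : ℕ → ℂ} (hB : BddSeq B) {g : ℍ → ℂ}
    (hg : HasDsum c s (coprimePart K (psiVal ψ)) B g) (p : ℕ) (hp : p.Prime) (hpK : ¬ p ∣ K) :
    HasDsum (c * (1 - p * psiVal ψ p)) (s * (1 - psiVal ψ p)) (coprimePart (p * K) (psiVal ψ)) B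
      (plusOpPrime ψ p hp g) := by
  intro z
  rw [_root_.plusOpPrime, hg.sub_smul_gammaOp, coprimePart_prime_mul hp,
    dsum_sub_left ((bddSeq_psiVal ψ).coprimePart K) (((bddSeq_psiVal ψ).coprimePart K).ite _) hB
      z.im_pos, dsum_ite_dvd_left hp.pos]
  have hpc : coprimePart K (psiVal ψ) p = psiVal ψ p :=
    if_pos ((Nat.Prime.coprime_iff_not_dvd hp).mpr hpK)
  simp only [coprimePart_mul (psiVal_mul ψ), hpc, dsum_const_mul_left]
  ring

lemma HasDsum.minusOpPrime {c s : ℂ} {K : ℕ} {A : ℕ → ℂ} (hA : BddSeq A) {g : ℍ → ℂ}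
    (hg : HasDsum c s A (coprimePart K (psiInvVal ψ)) g) (p : ℕ) (hp : p.Prime) (hpK : ¬ p ∣ K) :
    HasDsum (c * (1 - psiInvVal ψ p)) (s * (1 - (p : ℂ)⁻¹ * psiInvVal ψ p)) A
      (coprimePart (p * K) (psiInvVal ψ)) (minusOpPrime ψ p hp g) := by
  intro z
  have hp' : (p : ℂ) ≠ 0 := by exact_mod_cast hp.ne_zero
  rw [_root_.minusOpPrime, hg.sub_smul_gammaOp, coprimePart_prime_mul hp,
    dsum_sub_right hA ((bddSeq_psiInvVal ψ).coprimePart K)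
      (((bddSeq_psiInvVal ψ).coprimePart K).ite _) z.im_pos, dsum_ite_dvd_right hp.pos]
  have hpc : coprimePart K (psiInvVal ψ) p = psiInvVal ψ p :=
    if_pos ((Nat.Prime.coprime_iff_not_dvd hp).mpr hpK)
  simp only [coprimePart_mul (psiInvVal_mul ψ), hpc, dsum_const_mul_right]
  field_simp

/-- A non-holomorphic part occurs only for conductor `1`, and then the first factor `1 - ψ(p) = 0`
removes it. -/
lemma hasDsum_plusOp [NeZero n] {M : ℕ} (hM : Squarefree M) : ∃ c s : ℂ,
    (c ≠ 0 → ψ.conductor = 1) ∧ (s ≠ 0 → ψ.conductor = 1 ∧ M = 1) ∧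
      HasDsum c s (coprimePart M (psiVal ψ)) (psiInvVal ψ) (plusOp ψ M (eisPsi ψ)) := by
  refine prod_dvd_induction hM (plusOpPrime ψ) (fun K g => ∃ c s : ℂ,
    (c ≠ 0 → ψ.conductor = 1) ∧ (s ≠ 0 → ψ.conductor = 1 ∧ K = 1) ∧
      HasDsum c s (coprimePart K (psiVal ψ)) (psiInvVal ψ) g) ?_ ?_
  · refine ⟨if ψ.conductor = 1 then -1 / 24 else 0, if ψ.conductor = 1 then 1 / 2 else 0, ?_, ?_, ?_⟩
    · split_ifs with h <;> simp [h]
    · split_ifs with h <;> simp [h]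
    · intro z
      rw [eisPsi_apply]
      congr 1
      exact dsum_congr (fun n _ => by simp [coprimePart]) (fun _ _ => rfl) _
  · rintro K p hp h hpK - ⟨c, s, hc, hs, hh⟩
    refine ⟨_, _, fun h0 => hc (left_ne_zero_of_mul h0), fun h0 => ?_,
      hh.plusOpPrime ψ (bddSeq_psiInvVal ψ) p hp hpK⟩
    refine absurd (psiVal_eq_one ψ (hs (left_ne_zero_of_mul h0)).1 p) fun h1 => ?_
    exact right_ne_zero_of_mul h0 (by rw [h1, sub_self])

/-- For conductor `1` each operator multiplies the constant term by `1 - ψ⁻¹(p) = 0`, so it survives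
only when there is no prime to apply. -/
lemma hasDsum_minusOp {A : ℕ → ℂ} (hA : BddSeq A) {c : ℂ} (hc : c ≠ 0 → ψ.conductor = 1)
    {g : ℍ → ℂ} (hg : HasDsum c 0 A (psiInvVal ψ) g) {L : ℕ} (hL : Squarefree L) : ∃ c : ℂ,
    (c ≠ 0 → ψ.conductor = 1 ∧ L = 1) ∧
      HasDsum c 0 A (coprimePart L (psiInvVal ψ)) (minusOp ψ L g) := by
  refine prod_dvd_induction hL (minusOpPrime ψ) (fun K g => ∃ c : ℂ,
    (c ≠ 0 → ψ.conductor = 1 ∧ K = 1) ∧ HasDsum c 0 A (coprimePart K (psiInvVal ψ)) g) ?_ ?_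
  · refine ⟨c, fun h => ⟨hc h, rfl⟩, fun z => ?_⟩
    rw [hg z]
    congr 1
    exact dsum_congr (fun _ _ => rfl) (fun n _ => by simp [coprimePart]) _
  · rintro K p hp h hpK - ⟨c, hc, hh⟩
    refine ⟨_, fun h0 => ?_, by simpa using hh.minusOpPrime ψ hA p hp hpK⟩
    refine absurd (psiInvVal_eq_one ψ (hc (left_ne_zero_of_mul h0)).1 p) fun h1 => ?_
    exact right_ne_zero_of_mul h0 (by rw [h1, sub_self])

end Operators

end


/-! ### Hecke eigenvalues of `E_{M,L,ψ}`. -/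

noncomputable section

lemma HasDsum.heckeOp_apply {c : ℂ} {A B : ℕ → ℂ} (hA : BddSeq A) (hB : BddSeq B)
    (hA' : ∀ a b, A (a * b) = A a * A b) (hB' : ∀ a b, B (a * b) = B a * B b)
    {g : ℍ → ℂ} (hg : HasDsum c 0 A B g) (N ℓ : ℕ) (hℓ : ℓ.Prime) (z : ℍ) :
    heckeOp N ℓ hℓ g z = c + (ℓ * A ℓ + B ℓ) * dsum A B z - ℓ * A ℓ * B ℓ * dsum A B (ℓ * z) +
      if ℓ ∣ N then 0 else ℓ * (c + dsum A B (ℓ * z)) := by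
  have hℓ' : (ℓ : ℂ) ≠ 0 := by exact_mod_cast hℓ.ne_zero
  have h1 : (∑ k ∈ Finset.range ℓ, g ∣[(2 : ℤ)] upperGL 1 k ℓ one_ne_zero hℓ.ne_zero) z =
      c + (ℓ : ℂ)⁻¹ * ∑ k ∈ Finset.range ℓ, dsum A B ((z : ℂ) / ℓ + k / ℓ) := by
    rw [Finset.sum_apply]
    have (k : ℕ) : (g ∣[(2 : ℤ)] upperGL 1 k ℓ one_ne_zero hℓ.ne_zero) z =
        (ℓ : ℂ)⁻¹ * (c + dsum A B ((z : ℂ) / ℓ + k / ℓ)) := by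
      rw [slash_upperGL g 1 k ℓ _ _ z (addDiv ℓ hℓ.pos k z) (by simp [coe_addDiv]), hg, coe_addDiv,
        add_div]
      simp
    simp only [this, ← Finset.mul_sum, Finset.sum_add_distrib, Finset.sum_const, Finset.card_range,
      nsmul_eq_mul]
    field_simp
  rw [heckeOp, Pi.add_apply, h1, dsum_eigen hℓ hA hB (hA' ℓ) (hB' ℓ) z.im_pos]
  split_ifs
  · simp
    ring
  · rw [gammaOp_apply, hg, coe_natMul]
    ring

namespace EisIndex

variable {D C : ℕ} (t : EisIndex D C)

lemma conductor_dvd_M : t.ψ.conductor ∣ t.M := t.ψ.conductor_dvd_level.trans (Nat.gcd_dvd_left _ _)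

lemma conductor_dvd_L : t.ψ.conductor ∣ t.L := t.ψ.conductor_dvd_level.trans (Nat.gcd_dvd_right _ _)

/-- The sequence whose product with `t.rightSeq` gives the Fourier coefficients of `eisSeries t`. -/
def leftSeq : ℕ → ℂ := coprimePart (t.M / t.ψ.conductor) (psiVal t.ψ)

/-- The sequence whose product with `t.leftSeq` gives the Fourier coefficients of `eisSeries t`. -/
def rightSeq : ℕ → ℂ := coprimePart (t.L / t.ψ.conductor) (psiInvVal t.ψ)

lemma bddSeq_leftSeq : BddSeq t.leftSeq := (bddSeq_psiVal _).coprimePart _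

lemma bddSeq_rightSeq : BddSeq t.rightSeq := (bddSeq_psiInvVal _).coprimePart _

lemma leftSeq_mul (a b : ℕ) : t.leftSeq (a * b) = t.leftSeq a * t.leftSeq b :=
  coprimePart_mul (psiVal_mul _) _ a b

lemma rightSeq_mul (a b : ℕ) : t.rightSeq (a * b) = t.rightSeq a * t.rightSeq b :=
  coprimePart_mul (psiInvVal_mul _) _ a b

lemma squarefree_M (hD : Squarefree D) : Squarefree t.M := hD.squarefree_of_dvd t.M_dvd

lemma squarefree_L (hD : Squarefree D) : Squarefree t.L := hD.squarefree_of_dvd t.L_dvd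

lemma hasDsum_eisSeries (hD : Squarefree D) : ∃ c : ℂ, (c ≠ 0 → t.ψ.conductor = 1 ∧ t.L = 1) ∧
    HasDsum c 0 t.leftSeq t.rightSeq (eisSeries t) := by
  have hM := (t.squarefree_M hD).squarefree_of_dvd (Nat.div_dvd_of_dvd t.conductor_dvd_M)
  have hL := (t.squarefree_L hD).squarefree_of_dvd (Nat.div_dvd_of_dvd t.conductor_dvd_L)
  obtain ⟨c, s, hc, hs, h⟩ := hasDsum_plusOp t.ψ hM
  have hs0 : s = 0 := by
    by_contra h0
    obtain ⟨h1, h2⟩ := hs h0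
    rw [h1, Nat.div_one] at h2
    exact t.M_ne_one h2
  subst hs0
  obtain ⟨c', hc', h'⟩ := hasDsum_minusOp t.ψ t.bddSeq_leftSeq hc h hL
  refine ⟨c', fun h0 => ?_, h'⟩
  obtain ⟨h1, h2⟩ := hc' h0
  exact ⟨h1, by rwa [h1, Nat.div_one] at h2⟩

lemma leftSeq_prime {ℓ : ℕ} (hℓ : ℓ.Prime) : t.leftSeq ℓ = if ℓ ∣ t.M / t.ψ.conductor then 0 else psiVal t.ψ ℓ := by
  simp only [leftSeq, coprimePart, hℓ.coprime_iff_not_dvd]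
  split_ifs <;> simp_all

lemma rightSeq_prime {ℓ : ℕ} (hℓ : ℓ.Prime) : t.rightSeq ℓ = if ℓ ∣ t.L / t.ψ.conductor then 0 else psiInvVal t.ψ ℓ := by
  simp only [rightSeq, coprimePart, hℓ.coprime_iff_not_dvd]
  split_ifs <;> simp_all

lemma dvd_M_or_dvd_L {ℓ : ℕ} (hℓ : ℓ.Prime) (h : ℓ ∣ D) : ℓ ∣ t.M ∨ ℓ ∣ t.L :=
  hℓ.dvd_mul.mp (h.trans t.dvd_mul)

lemma dvd_div_conductor_or {ℓ : ℕ} (hℓ : ℓ.Prime) {K : ℕ} (hK : t.ψ.conductor ∣ K) (h : ℓ ∣ K) :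
    ℓ ∣ K / t.ψ.conductor ∨ ℓ ∣ t.ψ.conductor := by
  rw [← hℓ.dvd_mul, Nat.div_mul_cancel hK]
  exact h

lemma psiVal_eq_zero_of_dvd {ℓ : ℕ} (hℓ : ℓ.Prime) (h : ℓ ∣ t.ψ.conductor) : psiVal t.ψ ℓ = 0 :=
  psiVal_eq_zero _ fun hc => (hℓ.coprime_iff_not_dvd.mp hc) h

lemma psiInvVal_eq_zero_of_dvd {ℓ : ℕ} (hℓ : ℓ.Prime) (h : ℓ ∣ t.ψ.conductor) :
    psiInvVal t.ψ ℓ = 0 :=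
  psiInvVal_eq_zero _ fun hc => (hℓ.coprime_iff_not_dvd.mp hc) h

lemma leftSeq_of_dvd {ℓ : ℕ} (hℓ : ℓ.Prime) (h : ℓ ∣ t.M) : t.leftSeq ℓ = 0 := by
  rw [t.leftSeq_prime hℓ]
  split_ifs with h1
  · rfl
  · exact t.psiVal_eq_zero_of_dvd hℓ ((t.dvd_div_conductor_or hℓ t.conductor_dvd_M h).resolve_left h1)

lemma rightSeq_of_dvd {ℓ : ℕ} (hℓ : ℓ.Prime) (h : ℓ ∣ t.L) : t.rightSeq ℓ = 0 := by
  rw [t.rightSeq_prime hℓ]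
  split_ifs with h1
  · rfl
  · exact t.psiInvVal_eq_zero_of_dvd hℓ
      ((t.dvd_div_conductor_or hℓ t.conductor_dvd_L h).resolve_left h1)

lemma leftSeq_of_not_dvd {ℓ : ℕ} (hℓ : ℓ.Prime) (h : ¬ ℓ ∣ t.M) :
    t.leftSeq ℓ = psiVal t.ψ ℓ := by
  rw [t.leftSeq_prime hℓ, if_neg fun h1 => h (h1.trans (Nat.div_dvd_of_dvd t.conductor_dvd_M))]

lemma rightSeq_of_not_dvd {ℓ : ℕ} (hℓ : ℓ.Prime) (h : ¬ ℓ ∣ t.L) :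
    t.rightSeq ℓ = psiInvVal t.ψ ℓ := by
  rw [t.rightSeq_prime hℓ, if_neg fun h1 => h (h1.trans (Nat.div_dvd_of_dvd t.conductor_dvd_L))]

/-- A prime `ℓ ∣ D` divides `M L`, so one sequence vanishes at it; otherwise the values are `ψ(ℓ)`
and its inverse. This product is the coefficient of the unwanted series at `ℓ z`: it is absent for
`ℓ ∣ D` and cancels against `γ_ℓ` for `ℓ ∤ D`. -/
lemma leftSeq_mul_rightSeq {ℓ : ℕ} (hℓ : ℓ.Prime) :
    t.leftSeq ℓ * t.rightSeq ℓ = if ℓ ∣ D then 0 else 1 := by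
  split_ifs with h
  · rcases t.dvd_M_or_dvd_L hℓ h with h | h
    · rw [t.leftSeq_of_dvd hℓ h, zero_mul]
    · rw [t.rightSeq_of_dvd hℓ h, mul_zero]
  · rw [t.leftSeq_of_not_dvd hℓ fun h1 => h (h1.trans t.M_dvd),
      t.rightSeq_of_not_dvd hℓ fun h1 => h (h1.trans t.L_dvd), psiVal_mul_psiInvVal]
    rw [hℓ.coprime_iff_not_dvd]
    exact fun h1 => h (h1.trans (t.conductor_dvd_M.trans t.M_dvd))

/-- The eigenvalue of the Hecke operator `T_ℓ` on `eisSeries t`. -/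
def eigenvalue (ℓ : ℕ) : ℂ := ℓ * t.leftSeq ℓ + t.rightSeq ℓ

theorem heckeOp_eisSeries (hD : Squarefree D) (hC : C ∣ D) {ℓ : ℕ} (hℓ : ℓ.Prime) :
    heckeOp (D * C) ℓ hℓ (eisSeries t) = t.eigenvalue ℓ • eisSeries t := by
  obtain ⟨c, hc, h⟩ := t.hasDsum_eisSeries hD
  ext z
  rw [h.heckeOp_apply t.bddSeq_leftSeq t.bddSeq_rightSeq t.leftSeq_mul t.rightSeq_mul,
    Pi.smul_apply, h z, smul_eq_mul, mul_assoc (ℓ : ℂ), t.leftSeq_mul_rightSeq hℓ, ← eigenvalue]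
  have hdvd : ℓ ∣ D * C ↔ ℓ ∣ D :=
    ⟨fun h => (hℓ.dvd_mul.mp h).elim id fun h => h.trans hC, fun h => h.mul_right C⟩
  -- The constant term matters only if `f = 1` and `L = 1`, in which case `M = D` and the eigenvalue
  -- is `1` or `1 + ℓ`.
  have hc' : t.eigenvalue ℓ * c = c + if ℓ ∣ D then 0 else ℓ * c := by
    by_cases hc0 : c = 0
    · simp [hc0]
    obtain ⟨h1, h2⟩ := hc hc0
    have hMD : t.M = D := Nat.dvd_antisymm t.M_dvd (by simpa [h2] using t.dvd_mul)
    have hr : t.rightSeq ℓ = 1 := by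
      rw [t.rightSeq_of_not_dvd hℓ (by rw [h2]; exact hℓ.not_dvd_one), psiInvVal_eq_one _ h1]
    rw [eigenvalue, hr]
    split_ifs with hd
    · rw [t.leftSeq_of_dvd hℓ (by rwa [hMD])]
      ring
    · rw [t.leftSeq_of_not_dvd hℓ (by rwa [hMD]), psiVal_eq_one _ h1]
      ring
  simp only [hdvd]
  split_ifs at hc' ⊢ <;> linear_combination -hc'

lemma eigenvalue_of_not_dvd {ℓ : ℕ} (hℓ : ℓ.Prime) (h : ¬ ℓ ∣ D) :
    t.eigenvalue ℓ = psiInvVal t.ψ ℓ + ℓ * psiVal t.ψ ℓ := by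
  rw [eigenvalue, t.leftSeq_of_not_dvd hℓ fun h1 => h (h1.trans t.M_dvd),
    t.rightSeq_of_not_dvd hℓ fun h1 => h (h1.trans t.L_dvd), add_comm]

lemma eigenvalue_of_dvd_M {ℓ : ℕ} (hℓ : ℓ.Prime) (h : ℓ ∣ t.M) (h' : ¬ ℓ ∣ t.L) :
    t.eigenvalue ℓ = psiInvVal t.ψ ℓ := by
  rw [eigenvalue, t.leftSeq_of_dvd hℓ h, t.rightSeq_of_not_dvd hℓ h', mul_zero, zero_add]

lemma eigenvalue_of_dvd_L {ℓ : ℕ} (hℓ : ℓ.Prime) (h : ¬ ℓ ∣ t.M) (h' : ℓ ∣ t.L) :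
    t.eigenvalue ℓ = ℓ * psiVal t.ψ ℓ := by
  rw [eigenvalue, t.leftSeq_of_not_dvd hℓ h, t.rightSeq_of_dvd hℓ h', add_zero]

lemma eigenvalue_of_dvd_of_dvd {ℓ : ℕ} (hℓ : ℓ.Prime) (h : ℓ ∣ t.M) (h' : ℓ ∣ t.L) :
    t.eigenvalue ℓ = 0 := by
  rw [eigenvalue, t.leftSeq_of_dvd hℓ h, t.rightSeq_of_dvd hℓ h', mul_zero, add_zero]

lemma dvd_div_gcd_iff {a b ℓ : ℕ} (ha : Squarefree a) (hℓ : ℓ.Prime) :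
    ℓ ∣ a / Nat.gcd a b ↔ ℓ ∣ a ∧ ¬ ℓ ∣ b := by
  have hg := Nat.gcd_dvd_left a b
  constructor
  · refine fun h => ⟨h.trans (Nat.div_dvd_of_dvd hg), fun hb => hℓ.one_lt.ne' ?_⟩
    have h2 := mul_dvd_mul h (Nat.dvd_gcd (h.trans (Nat.div_dvd_of_dvd hg)) hb)
    rw [Nat.div_mul_cancel hg] at h2
    exact Nat.isUnit_iff.mp (ha _ h2)
  · rintro ⟨h1, h2⟩
    rw [← Nat.div_mul_cancel hg, hℓ.dvd_mul] at h1
    exact h1.resolve_right fun h => h2 (h.trans (Nat.gcd_dvd_right _ _))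

end EisIndex

theorem heckeOp_eisSeries_cases {D C : ℕ} (hD : Squarefree D) (hC : C ∣ D) (t : EisIndex D C)
    (ℓ : ℕ) (hℓ : ℓ.Prime) :
    (¬ ℓ ∣ D → heckeOp (D * C) ℓ hℓ (eisSeries t) =
        (psiInvVal t.ψ ℓ + (ℓ : ℂ) * psiVal t.ψ ℓ) • eisSeries t) ∧
      (ℓ ∣ t.M / Nat.gcd t.M t.L → heckeOp (D * C) ℓ hℓ (eisSeries t) =
        psiInvVal t.ψ ℓ • eisSeries t) ∧
      (ℓ ∣ t.L / Nat.gcd t.M t.L → heckeOp (D * C) ℓ hℓ (eisSeries t) =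
        ((ℓ : ℂ) * psiVal t.ψ ℓ) • eisSeries t) ∧
      (ℓ ∣ Nat.gcd t.M t.L → heckeOp (D * C) ℓ hℓ (eisSeries t) = 0) := by
  rw [t.heckeOp_eisSeries hD hC hℓ]
  refine ⟨fun h => ?_, fun h => ?_, fun h => ?_, fun h => ?_⟩
  · rw [t.eigenvalue_of_not_dvd hℓ h]
  · rw [EisIndex.dvd_div_gcd_iff (t.squarefree_M hD) hℓ] at h
    rw [t.eigenvalue_of_dvd_M hℓ h.1 h.2]
  · rw [Nat.gcd_comm, EisIndex.dvd_div_gcd_iff (t.squarefree_L hD) hℓ] at h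
    rw [t.eigenvalue_of_dvd_L hℓ h.2 h.1]
  · rw [t.eigenvalue_of_dvd_of_dvd hℓ (h.trans (Nat.gcd_dvd_left _ _))
      (h.trans (Nat.gcd_dvd_right _ _)), zero_smul]

end


/-! ### The level of `E_{M,L,ψ}`. -/

noncomputable section

open Filter Topology
open scoped Manifold ContDiff

/-- The linear combinations of holomorphic Eisenstein series that are invariant under `Γ₀(K)`. -/
def heckeInvariants (K : ℕ) : Submodule ℂ (ℍ → ℂ) where
  carrier := {g | g ∈ heckeSpan ∧ ∀ γ ∈ Gamma0 K, g ∣[(2 : ℤ)] γ = g}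
  add_mem' := fun ⟨hg, hg'⟩ ⟨hh, hh'⟩ =>
    ⟨add_mem hg hh, fun γ hγ => by rw [SlashAction.add_slash, hg' γ hγ, hh' γ hγ]⟩
  zero_mem' := ⟨zero_mem _, fun γ _ => SlashAction.zero_slash _ _⟩
  smul_mem' := fun c g ⟨hg, hg'⟩ =>
    ⟨Submodule.smul_mem _ _ hg, fun γ hγ => by rw [ModularForm.SL_smul_slash, hg' γ hγ]⟩

lemma mem_heckeInvariants {K : ℕ} {g : ℍ → ℂ} : g ∈ heckeInvariants K ↔
    g ∈ heckeSpan ∧ ∀ γ ∈ Gamma0 K, g ∣[(2 : ℤ)] γ = g := Iff.rfl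

lemma Gamma0_le_of_dvd {K N : ℕ} (h : K ∣ N) : Gamma0 N ≤ Gamma0 K := fun γ hγ => by
  rw [Gamma0_mem, ZMod.intCast_zmod_eq_zero_iff_dvd] at hγ ⊢
  exact (Int.natCast_dvd_natCast.mpr h).trans hγ

lemma heckeInvariants_mono {K N : ℕ} (h : K ∣ N) : heckeInvariants K ≤ heckeInvariants N :=
  fun _ hg => ⟨hg.1, fun γ hγ => hg.2 γ (Gamma0_le_of_dvd h hγ)⟩

/-- Holomorphy and boundedness at the cusps are automatic in the span of the `φ_x`, which is stable
under `SL(2, ℤ)`; only invariance is a condition. -/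
theorem eisensteinSpace_eq_heckeInvariants {N : ℕ} [NeZero N] :
    eisensteinSpace N = heckeInvariants N := by
  ext f
  rw [eisensteinSpace, Submodule.mem_inf, ← heckeSpan_eq, mem_heckeInvariants, and_comm]
  refine and_congr_right fun hf => ⟨?_, fun h => ?_⟩
  · rintro ⟨F, rfl⟩ γ hγ
    exact F.slash_action_eq' _ ⟨γ, hγ, rfl⟩
  · refine ⟨⟨⟨f, ?_⟩, mdifferentiable_of_mem_heckeSpan hf, fun {c} hc => ?_⟩, rfl⟩
    · rintro _ ⟨γ, hγ, rfl⟩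
      exact h γ hγ
    · rw [Subgroup.IsArithmetic.isCusp_iff_isCusp_SL2Z] at hc
      rw [OnePoint.isBoundedAt_iff_forall_SL2Z hc]
      intro γ _
      obtain ⟨c, hc⟩ := exists_tendsto_of_mem_heckeSpan (slash_mem_heckeSpan hf γ)
      exact hc.isBigO_one ℝ

lemma gammaOp_mem_heckeSpan {p : ℕ} (hp : p.Prime) {g : ℍ → ℂ} (hg : g ∈ heckeSpan) :
    gammaOp p hp g ∈ heckeSpan := by
  induction hg using Submodule.span_induction with
  | mem f hf =>
    obtain ⟨x, hx, rfl⟩ := hf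
    rw [gammaOp_heckeHol]
    refine sum_mem fun j _ => heckeHol_mem_heckeSpan fun h => hx ?_
    obtain ⟨h1, n, hn⟩ := h
    refine ⟨h1, p * n - j, ?_⟩
    have hp' : (p : ℚ) ≠ 0 := by exact_mod_cast hp.ne_zero
    rw [div_eq_iff hp'] at hn
    push_cast
    linarith
  | zero =>
    rw [← zero_smul ℂ (0 : ℍ → ℂ), gammaOp_smul, zero_smul]
    exact zero_mem _
  | add f g _ _ hf hg => rw [gammaOp_add]; exact add_mem hf hg
  | smul c f _ hf => rw [gammaOp_smul]; exact Submodule.smul_mem _ _ hf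

/-- Conjugation by `diag(p, 1)` carries `γ` to `γ'`. This is how `γ_p` raises the level by the
factor `p`. -/
lemma gammaOp_slash {p : ℕ} (hp : p.Prime) (g : ℍ → ℂ) (γ γ' : SL(2, ℤ)) (h00 : γ' 0 0 = γ 0 0)
    (h01 : γ' 0 1 = p * γ 0 1) (h10 : p * γ' 1 0 = γ 1 0) (h11 : γ' 1 1 = γ 1 1) :
    gammaOp p hp g ∣[(2 : ℤ)] γ = gammaOp p hp (g ∣[(2 : ℤ)] γ') := by
  have hr : (p : ℝ) * (γ' 1 0 : ℤ) = (γ 1 0 : ℤ) := by exact_mod_cast h10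
  rw [gammaOp, gammaOp, ModularForm.SL_slash, ModularForm.SL_slash, ← SlashAction.slash_mul,
    ← SlashAction.slash_mul]
  congr 1
  ext i j
  fin_cases i <;> fin_cases j <;>
    simp [upperGL, Matrix.GeneralLinearGroup.mkOfDetNeZero, Matrix.mul_apply, Fin.sum_univ_two,
      h00, h01, h11, ← hr, mul_comm]

lemma gammaOp_mem_heckeInvariants {p K : ℕ} (hp : p.Prime) {g : ℍ → ℂ}
    (hg : g ∈ heckeInvariants K) : gammaOp p hp g ∈ heckeInvariants (p * K) := by
  refine ⟨gammaOp_mem_heckeSpan hp hg.1, fun γ hγ => ?_⟩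
  rw [Gamma0_mem, ZMod.intCast_zmod_eq_zero_iff_dvd, Nat.cast_mul] at hγ
  obtain ⟨c, hc⟩ := hγ
  have hdet := SL_det_cast ℤ γ
  let γ' : SL(2, ℤ) := ⟨!![γ 0 0, p * γ 0 1; K * c, γ 1 1], by
    rw [Matrix.det_fin_two_of]
    simp only [Int.cast_id] at hdet
    linear_combination hdet + (γ 0 1) * hc⟩
  have hγ' : γ' ∈ Gamma0 K := by
    rw [Gamma0_mem, ZMod.intCast_zmod_eq_zero_iff_dvd]
    exact ⟨c, rfl⟩
  rw [gammaOp_slash hp g γ γ' rfl rfl (by rw [hc, mul_assoc]; rfl) rfl, hg.2 γ' hγ']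

lemma sub_smul_gammaOp_mem {p K : ℕ} (hp : p.Prime) {g : ℍ → ℂ}
    (hg : g ∈ heckeInvariants K) (c : ℂ) : g - c • gammaOp p hp g ∈ heckeInvariants (p * K) :=
  sub_mem (heckeInvariants_mono (dvd_mul_left _ _) hg)
    (Submodule.smul_mem _ _ (gammaOp_mem_heckeInvariants hp hg))

/-- The distribution relation at `x = 0`: the non-holomorphic parts cancel, and so does the summand
at the zero division point. -/
lemma heckePhi_zero_sub_gammaOp {p : ℕ} (hp : p.Prime) :
    haveI : NeZero p := ⟨hp.ne_zero⟩
    heckePhi 0 - gammaOp p hp (heckePhi 0) =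
      -∑ a : (ZMod p)ˣ, heckeHol (((0 : ℤ) : ℚ) / p, (((a : ZMod p).val : ℤ) : ℚ) / p) := by
  have : NeZero p := ⟨hp.ne_zero⟩
  have : Fact p.Prime := ⟨hp⟩
  have hhol : heckeHol 0 = heckePhi 0 + nonHol := by
    rw [heckePhi_of_integral ⟨⟨0, by simp⟩, ⟨0, by simp⟩⟩, sub_add_cancel]
  have hG := gammaOp_heckeHol p hp 0
  rw [hhol, gammaOp_add, gammaOp_nonHol] at hG
  let H : ZMod p → ℍ → ℂ := fun a => heckeHol (((0 : ℤ) : ℚ) / p, ((a.val : ℤ) : ℚ) / p)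
  have h0 : H 0 = heckePhi 0 + nonHol := by
    rw [← hhol]
    simp only [H, ZMod.val_zero]
    congr 1
    ext <;> simp
  have h1 : ∑ j ∈ Finset.range p, heckeHol ((0 : ℚ × ℚ).1, ((0 : ℚ × ℚ).2 + j) / p) =
      ∑ a : ZMod p, H a := by
    rw [← sum_zmod_val]
    simp [H]
  have h2 : ∑ a : ZMod p, H a = H 0 + ∑ a : (ZMod p)ˣ, H a := by
    have h3 : ∑ a : (ZMod p)ˣ, H a = ∑ a : (ZMod p)ˣ, if (a : ZMod p) = 0 then 0 else H a :=
      Finset.sum_congr rfl fun a _ => by rw [if_neg a.ne_zero]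
    rw [h3, sum_units_eq_sum (fun a : ZMod p => if a = 0 then 0 else H a) fun a ha =>
      if_pos (by simpa using ha), ← Finset.add_sum_erase _ _ (Finset.mem_univ 0),
      ← Finset.add_sum_erase _ (fun a : ZMod p => if a = 0 then 0 else H a) (Finset.mem_univ 0),
      if_pos rfl, zero_add]
    exact congrArg _ (Finset.sum_congr rfl fun a ha => (if_neg (Finset.ne_of_mem_erase ha)).symm)
  rw [h1, h2, h0] at hG
  rw [eq_sub_of_add_eq hG]
  abel

/-- An element of `Γ₀(p)` permutes the points `(0, a/p)` by multiplying `a` with its lower right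
entry. -/
lemma heckePhi_zero_sub_gammaOp_mem {p : ℕ} (hp : p.Prime) :
    heckePhi 0 - gammaOp p hp (heckePhi 0) ∈ heckeInvariants p := by
  have : NeZero p := ⟨hp.ne_zero⟩
  have : Fact p.Prime := ⟨hp⟩
  rw [heckePhi_zero_sub_gammaOp]
  have hne (a : (ZMod p)ˣ) : ¬ (((0 : ℤ) : ZMod p) = 0 ∧ (((a : ZMod p).val : ℤ) : ZMod p) = 0) := by
    simp
  refine neg_mem ⟨sum_mem fun a _ => heckeHol_mem_heckeSpan ?_, fun γ hγ => ?_⟩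
  · rw [isIntegralPair_div_iff hp.pos]
    exact hne a
  · rw [Gamma0_mem] at hγ
    have hdet := SL_det_cast (ZMod p) γ
    rw [hγ, mul_zero, sub_zero] at hdet
    let u : (ZMod p)ˣ := ⟨(γ 1 1 : ℤ), (γ 0 0 : ℤ), by rw [mul_comm]; exact hdet, hdet⟩
    rw [SlashAction.sum_slash]
    refine (Finset.sum_congr rfl fun a _ => ?_).trans (Equiv.sum_comp (Equiv.mulLeft u) _)
    rw [heckeHol_slash_div _ _ (hne a)]
    apply heckeHol_div_congr
    · simp [hγ]
    · simp [u, mul_comm]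

section Character

variable {f : ℕ} [NeZero f] (χ : DirichletCharacter ℂ f)

/-- The second coordinate needs the denominator `f²` so that the lower left entry does not disturb
the first one; the upper right entry changes `b` by a multiple of `f` only. -/
lemma heckeHol_slash_div_sq {a : ZMod f} (ha : a ≠ 0) (b : ZMod (f ^ 2)) {γ : SL(2, ℤ)}
    (hγ : γ ∈ Gamma0 (f ^ 2)) :
    heckeHol ((a.val : ℚ) / f, (b.val : ℚ) / (f : ℚ) ^ 2) ∣[(2 : ℤ)] γ =
      heckeHol (((((γ 0 0 : ℤ) : ZMod f) * a).val : ℚ) / f,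
        ((((γ 1 1 : ℤ) : ZMod (f ^ 2)) * b + f * ((γ 0 1 : ℤ) : ZMod (f ^ 2)) * a.val).val : ℚ) / (f : ℚ) ^ 2) := by
  have hf : (f : ℚ) ≠ 0 := by exact_mod_cast NeZero.ne f
  rw [Gamma0_mem] at hγ
  have e (a : ZMod f) (b : ZMod (f ^ 2)) : ((a.val : ℚ) / f, (b.val : ℚ) / (f : ℚ) ^ 2) =
      (((f * a.val : ℤ) : ℚ) / (f ^ 2 : ℕ), ((b.val : ℤ) : ℚ) / (f ^ 2 : ℕ)) := by
    push_cast
    congr 1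
    field_simp
  rw [e, e, heckeHol_slash_div _ _ fun h => ha ?_]
  · apply heckeHol_div_congr
    · push_cast
      rw [hγ, mul_zero, add_zero]
      have : (((((γ 0 0 : ℤ) : ZMod f) * a).val : ℤ) : ZMod f) = (((γ 0 0 : ℤ) * a.val : ℤ) : ZMod f) := by
        simp
      obtain ⟨m, hm⟩ := (ZMod.intCast_eq_intCast_iff_dvd_sub _ _ _).mp this
      have hm' := congrArg (Int.cast : ℤ → ZMod (f ^ 2)) hm
      have hsq : (f : ZMod (f ^ 2)) * f = 0 := by
        rw [← pow_two]
        exact_mod_cast ZMod.natCast_self (f ^ 2)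
      push_cast at hm'
      linear_combination f * hm' + m * hsq
    · push_cast
      rw [ZMod.natCast_zmod_val, ZMod.natCast_zmod_val]
      ring
  · have h1 := h.1
    rw [ZMod.intCast_zmod_eq_zero_iff_dvd] at h1
    have h2 : f ∣ a.val := Nat.dvd_of_mul_dvd_mul_left (Nat.pos_of_ne_zero (NeZero.ne f))
      (by rw [← pow_two]; exact_mod_cast h1)
    rw [← ZMod.natCast_zmod_val a]
    exact (ZMod.natCast_eq_zero_iff _ _).mpr h2

lemma sum_char_heckeHol_mem (hf : f ≠ 1) :
    ∑ a : ZMod f, ∑ b : ZMod (f ^ 2), (χ a * χ (b.val : ZMod f)) •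
      heckeHol ((a.val : ℚ) / f, (b.val : ℚ) / (f : ℚ) ^ 2) ∈ heckeInvariants (f ^ 2) := by
  have : Nontrivial (ZMod f) := ZMod.nontrivial_iff.mpr hf
  refine ⟨sum_mem fun a _ => sum_mem fun b _ => ?_, fun γ hγ => ?_⟩
  · by_cases ha : IsUnit a
    · exact Submodule.smul_mem _ _ (heckeHol_mem_heckeSpan (not_isIntegralPair_of_isUnit hf ha _))
    · rw [MulChar.map_nonunit _ ha, zero_mul, zero_smul]
      exact zero_mem _
  · have hγ0 := hγ
    rw [Gamma0_mem] at hγ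
    have hdet := SL_det_cast (ZMod (f ^ 2)) γ
    rw [hγ, mul_zero, sub_zero] at hdet
    have hdet' : ((γ 0 0 : ℤ) : ZMod f) * ((γ 1 1 : ℤ) : ZMod f) = 1 := by
      have := congrArg (ZMod.castHom (dvd_pow_self f two_ne_zero) (ZMod f)) hdet
      simpa using this
    have hχ : χ (γ 0 0 : ℤ) * χ (γ 1 1 : ℤ) = 1 := by rw [← map_mul, hdet', map_one]
    -- This triangular substitution multiplies the weight `χ(a) χ(b)` by the values of `χ` at the
    -- two diagonal entries of `γ`, whose product is `1`.
    let T : ZMod f × ZMod (f ^ 2) → ZMod f × ZMod (f ^ 2) := fun q =>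
      ((γ 0 0 : ℤ) * q.1, (γ 1 1 : ℤ) * q.2 + f * (γ 0 1 : ℤ) * q.1.val)
    have hT : Function.Bijective T := by
      rw [← Finite.injective_iff_bijective]
      rintro ⟨a, b⟩ ⟨a', b'⟩ h
      obtain ⟨h1, h2⟩ := Prod.mk.inj h
      have ha : a = a' := by
        simp only at h1
        linear_combination (γ 1 1 : ZMod f) * h1 - (a - a') * hdet'
      subst ha
      refine Prod.ext rfl ?_
      simp only at h2 ⊢
      linear_combination (γ 0 0 : ZMod (f ^ 2)) * h2 - (b - b') * hdet
    simp only [SlashAction.sum_slash, ModularForm.SL_smul_slash]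
    rw [← Fintype.sum_prod_type', ← Fintype.sum_prod_type']
    refine (Finset.sum_congr rfl fun q _ => ?_).trans (hT.sum_comp
      fun q : ZMod f × ZMod (f ^ 2) => (χ q.1 * χ (q.2.val : ZMod f)) •
        heckeHol ((q.1.val : ℚ) / f, (q.2.val : ℚ) / (f : ℚ) ^ 2))
    have hcast : χ ((T q).2.val : ZMod f) = χ (γ 1 1 : ℤ) * χ (q.2.val : ZMod f) := by
      rw [← map_mul]
      congr 1
      have (x : ZMod (f ^ 2)) : (x.val : ZMod f) =
          ZMod.castHom (dvd_pow_self f two_ne_zero) (ZMod f) x := by simp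
      rw [this, this]
      simp [T]
    rw [hcast]
    by_cases ha : IsUnit q.1
    · rw [heckeHol_slash_div_sq ha.ne_zero _ hγ0]
      congr 1
      simp only [T, map_mul]
      linear_combination -(χ q.1 * χ (q.2.val : ZMod f)) * hχ
    · have ha' : ¬ IsUnit (T q).1 := fun h => ha (isUnit_of_mul_isUnit_right h)
      rw [MulChar.map_nonunit _ ha, MulChar.map_nonunit _ ha']
      simp

end Character

lemma eisPsi_mem {n : ℕ} [NeZero n] (ψ : DirichletCharacter ℂ n) (h : ψ.conductor ≠ 1) :
    eisPsi ψ ∈ heckeInvariants (ψ.conductor ^ 2) := by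
  rw [eisPsi_eq_sum_heckeHol ψ h]
  exact Submodule.smul_mem _ _ (sum_char_heckeHol_mem _ h)

lemma plusOp_eisPsi_mem {n : ℕ} [NeZero n] (ψ : DirichletCharacter ℂ n) {M : ℕ}
    (hM : Squarefree M) (h : ψ.conductor ≠ 1) :
    plusOp ψ M (eisPsi ψ) ∈ heckeInvariants (M * ψ.conductor ^ 2) := by
  refine prod_dvd_induction hM (plusOpPrime ψ)
    (fun K g => g ∈ heckeInvariants (K * ψ.conductor ^ 2)) ?_ ?_
  · rw [one_mul]
    exact eisPsi_mem ψ h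
  · intro K p hp g _ _ hg
    rw [mul_assoc]
    exact sub_smul_gammaOp_mem hp hg _

/-- Here `E_ψ` is a multiple of the non-holomorphic `φ_0`, so the first prime needs
`heckePhi_zero_sub_gammaOp_mem`; the induction hypothesis therefore distinguishes `K = 1`. -/
lemma plusOp_eisPsi_mem_of_conductor_eq_one {n : ℕ} [NeZero n] (ψ : DirichletCharacter ℂ n) {M : ℕ}
    (hM : Squarefree M) (hM1 : M ≠ 1) (h : ψ.conductor = 1) :
    plusOp ψ M (eisPsi ψ) ∈ heckeInvariants M := by
  refine (prod_dvd_induction (g := eisPsi ψ) hM (plusOpPrime ψ) (fun K g =>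
    (K = 1 → g = eisPsi ψ) ∧ (K ≠ 1 → g ∈ heckeInvariants K)) ⟨fun _ => rfl, fun h => absurd rfl h⟩
    ?_).2 hM1
  rintro K p hp g hpK - ⟨h1, h2⟩
  refine ⟨fun h => absurd (Nat.eq_one_of_mul_eq_one_right h) hp.ne_one, fun _ => ?_⟩
  by_cases hK : K = 1
  · rw [h1 hK, hK, mul_one, plusOpPrime, psiVal_eq_one ψ h, one_smul, eisPsi_eq_heckePhi_zero ψ h,
      gammaOp_smul, ← smul_sub]
    exact Submodule.smul_mem _ _ (heckePhi_zero_sub_gammaOp_mem hp)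
  · exact sub_smul_gammaOp_mem hp (h2 hK) _

lemma minusOp_mem {n : ℕ} (ψ : DirichletCharacter ℂ n) {K L : ℕ} (hL : Squarefree L)
    {g : ℍ → ℂ} (hg : g ∈ heckeInvariants K) : minusOp ψ L g ∈ heckeInvariants (L * K) := by
  refine prod_dvd_induction hL (minusOpPrime ψ) (fun J g => g ∈ heckeInvariants (J * K)) ?_ ?_
  · rwa [one_mul]
  · intro J p hp g _ _ hg
    rw [mul_assoc]
    exact sub_smul_gammaOp_mem hp hg _

theorem eisSeries_mem_heckeInvariants {D C : ℕ} (hD : Squarefree D) (t : EisIndex D C) :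
    eisSeries t ∈ heckeInvariants (D * C) := by
  have hM := (t.squarefree_M hD).squarefree_of_dvd (Nat.div_dvd_of_dvd t.conductor_dvd_M)
  have hL := (t.squarefree_L hD).squarefree_of_dvd (Nat.div_dvd_of_dvd t.conductor_dvd_L)
  refine heckeInvariants_mono t.mul_dvd ?_
  by_cases h : t.ψ.conductor = 1
  · have h1 := plusOp_eisPsi_mem_of_conductor_eq_one t.ψ hM (by rw [h, Nat.div_one]; exact t.M_ne_one) h
    have h2 := minusOp_mem t.ψ hL h1
    rwa [show t.L / t.ψ.conductor * (t.M / t.ψ.conductor) = t.M * t.L by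
      rw [h, Nat.div_one, Nat.div_one, mul_comm]] at h2
  · have h2 := minusOp_mem t.ψ hL (plusOp_eisPsi_mem t.ψ hM h)
    rwa [show t.L / t.ψ.conductor * (t.M / t.ψ.conductor * t.ψ.conductor ^ 2) = t.M * t.L by
      rw [pow_two, ← mul_assoc (t.M / _), Nat.div_mul_cancel t.conductor_dvd_M, mul_left_comm,
        Nat.div_mul_cancel t.conductor_dvd_L]] at h2

end


/-! ### Normalization and linear independence. -/

noncomputable section

theorem qExpansion_coeff_one_eisSeries {D C : ℕ} (hD : Squarefree D) (hC : C ∣ D)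
    (t : EisIndex D C) : (qExpansion 1 (eisSeries t)).coeff 1 = 1 := by
  have hN : D * C ≠ 0 := mul_ne_zero hD.ne_zero (ne_zero_of_dvd_ne_zero hD.ne_zero hC)
  have : NeZero (D * C) := ⟨hN⟩
  have hmem := eisSeries_mem_heckeInvariants hD t
  rw [← eisensteinSpace_eq_heckeInvariants] at hmem
  obtain ⟨F, hF⟩ := hmem.1
  obtain ⟨c, -, h⟩ := t.hasDsum_eisSeries hD
  have hsum (τ : ℍ) : HasSum (fun m : ℕ => ((if m = 0 then c else 0) +
      dsumCoeff t.leftSeq t.rightSeq m) • Function.Periodic.qParam 1 τ ^ m) (F τ) := by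
    have h1 := hasSum_dsumCoeff t.bddSeq_leftSeq t.bddSeq_rightSeq (w := τ) τ.im_pos
    have h2 : HasSum (fun m : ℕ => (if m = 0 then c else 0)) c := hasSum_ite_eq 0 c
    have h3 : F τ = c + dsum t.leftSeq t.rightSeq τ := by
      rw [hF, h]
      ring
    rw [h3]
    refine (h2.add h1).congr_fun fun m => ?_
    simp only [Function.Periodic.qParam, Complex.ofReal_one, div_one, smul_eq_mul]
    rcases eq_or_ne m 0 with rfl | hm
    · simp
    · simp [hm]
  have hq := ModularFormClass.qExpansion_coeff_unique one_pos
    (by rw [strictPeriods_Gamma0]; exact AddSubgroup.mem_zmultiples 1) hsum 1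
  rw [← hF, ← hq]
  have hl : t.leftSeq 1 = 1 := by simp [EisIndex.leftSeq, coprimePart]
  have hr : t.rightSeq 1 = 1 := by simp [EisIndex.rightSeq, coprimePart]
  simp [dsumCoeff, hl, hr]

theorem eisSeries_ne_zero {D C : ℕ} (hD : Squarefree D) (hC : C ∣ D)
    (t : EisIndex D C) : eisSeries t ≠ 0 := by
  intro h0
  have h := qExpansion_coeff_one_eisSeries hD hC t
  rw [h0, qExpansion_zero] at h
  simp at h

/-- The Hecke operator `T_ℓ` as a linear map. -/
def heckeLinear (N ℓ : ℕ) (hℓ : ℓ.Prime) : (ℍ → ℂ) →ₗ[ℂ] (ℍ → ℂ) where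
  toFun := heckeOp N ℓ hℓ
  map_add' f g := by
    simp only [heckeOp, SlashAction.add_slash, Finset.sum_add_distrib]
    split_ifs
    · abel
    · rw [gammaOp_add]
      abel
  map_smul' c f := by
    ext z
    have h (k : ℕ) : ((c • f) ∣[(2 : ℤ)] upperGL 1 k ℓ one_ne_zero hℓ.ne_zero) z =
        c * (f ∣[(2 : ℤ)] upperGL 1 k ℓ one_ne_zero hℓ.ne_zero) z := by
      have hw : (addDiv ℓ hℓ.pos k z : ℂ) = ((1 : ℕ) * z + k) / ℓ := by simp [coe_addDiv]
      rw [slash_upperGL _ 1 k ℓ _ _ z _ hw, slash_upperGL _ 1 k ℓ _ _ z _ hw, Pi.smul_apply,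
        smul_eq_mul]
      ring
    simp only [heckeOp, Pi.add_apply, Finset.sum_apply, h, RingHom.id_apply, Pi.smul_apply,
      smul_eq_mul, mul_add, Finset.mul_sum]
    congr 1
    split_ifs
    · simp
    · rw [gammaOp_smul]
      rfl

/-- Simultaneous eigenvectors with distinct systems of eigenvalues are linearly independent. -/
lemma linearIndependent_of_eigenvalues {ι I K V : Type*} [Field K] [AddCommGroup V] [Module K V]
    (v : ι → V) (hv : ∀ i, v i ≠ 0) (T : I → V →ₗ[K] V) (μ : ι → I → K)
    (hT : ∀ i j, T j (v i) = μ i j • v i) (hμ : Function.Injective μ) : LinearIndependent K v := by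
  classical
  rw [linearIndependent_iff']
  intro s
  induction s using Finset.induction_on with
  | empty => simp
  | insert a s ha ih =>
    intro g hg
    rw [Finset.sum_insert ha] at hg
    have hs (i : ι) (hi : i ∈ s) : g i = 0 := by
      have hne : μ i ≠ μ a := fun h => ha (hμ h ▸ hi)
      obtain ⟨j, hj⟩ := Function.ne_iff.mp hne
      have h1 := congrArg (T j) hg
      simp only [map_add, map_sum, map_smul, hT, map_zero] at h1
      have h2 := congrArg (μ a j • ·) hg
      simp only [smul_add, Finset.smul_sum, smul_zero] at h2
      have h3 : ∑ i ∈ s, (g i * (μ i j - μ a j)) • v i = 0 := by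
        have h4 : ∑ i ∈ s, (g i * (μ i j - μ a j)) • v i =
            (g a • μ a j • v a + ∑ i ∈ s, g i • μ i j • v i) -
              (μ a j • g a • v a + ∑ i ∈ s, μ a j • g i • v i) := by
          rw [smul_comm (g a), add_sub_add_left_eq_sub, ← Finset.sum_sub_distrib]
          exact Finset.sum_congr rfl fun i _ => by module
        rw [h4, h1, h2, sub_zero]
      exact (mul_eq_zero.mp (ih _ h3 i hi)).resolve_right (sub_ne_zero.mpr hj)
    rw [Finset.sum_eq_zero fun i hi => by rw [hs i hi, zero_smul], add_zero] at hg
    intro i hi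
    rcases Finset.mem_insert.mp hi with rfl | hi
    · exact (smul_eq_zero.mp hg).resolve_right (hv _)
    · exact hs i hi

/-- The equation factors as `(x - y) (ℓ x y - 1) = 0`, and the second factor is nonzero since `|ℓ x
y| = ℓ > 1`. -/
lemma eq_of_inv_add_mul_eq {x y : ℂ} (hx : ‖x‖ = 1) (hy : ‖y‖ = 1) {ℓ : ℕ} (hℓ : 1 < ℓ)
    (h : x⁻¹ + ℓ * x = y⁻¹ + ℓ * y) : x = y := by
  have hx0 : x ≠ 0 := norm_ne_zero_iff.mp (by rw [hx]; exact one_ne_zero)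
  have hy0 : y ≠ 0 := norm_ne_zero_iff.mp (by rw [hy]; exact one_ne_zero)
  by_contra hne
  have h1 : (x - y) * (ℓ * (x * y) - 1) = 0 := by
    field_simp at h
    linear_combination h
  have h2 := (mul_eq_zero.mp h1).resolve_left (sub_ne_zero.mpr hne)
  have h3 := congrArg norm (sub_eq_zero.mp h2)
  rw [norm_mul, norm_mul, hx, hy, Complex.norm_natCast, norm_one, mul_one, mul_one] at h3
  exact hℓ.ne' (by exact_mod_cast h3)

lemma psiVal_of_coprime {n : ℕ} (ψ : DirichletCharacter ℂ n) {a : ℕ} (ha : a.Coprime n) :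
    psiVal ψ a = ψ a := by
  have := ψ.primitiveCharacter_apply_of_isCoprime (a := a) (by exact_mod_cast ha.isCoprime)
  rw [psiVal]
  exact_mod_cast this

lemma norm_psiVal {n : ℕ} (ψ : DirichletCharacter ℂ n) {a : ℕ} (ha : a.Coprime ψ.conductor) :
    ‖psiVal ψ a‖ = 1 := by
  rw [psiVal, ← ZMod.coe_unitOfCoprime a ha]
  exact DirichletCharacter.unit_norm_eq_one _ _

lemma psiInvVal_eq_inv {n : ℕ} (ψ : DirichletCharacter ℂ n) (a : ℕ) :
    psiInvVal ψ a = (psiVal ψ a)⁻¹ := MulChar.inv_apply_eq_inv' _ _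

namespace EisIndex

variable {D C : ℕ}

lemma norm_eigenvalue (t : EisIndex D C) {ℓ : ℕ} (hℓ : ℓ.Prime) (hd : ℓ ∣ D) :
    ‖t.eigenvalue ℓ‖ = if ℓ ∣ t.M then if ℓ ∣ t.L then (0 : ℝ) else 1 else ℓ := by
  have hcop {K : ℕ} (hK : t.ψ.conductor ∣ K) (h : ¬ ℓ ∣ K) : ℓ.Coprime t.ψ.conductor :=
    (hℓ.coprime_iff_not_dvd.mpr fun h1 => h (h1.trans hK))
  split_ifs with hM hL
  · rw [t.eigenvalue_of_dvd_of_dvd hℓ hM hL, norm_zero]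
  · rw [t.eigenvalue_of_dvd_M hℓ hM hL, psiInvVal_eq_inv, norm_inv,
      norm_psiVal _ (hcop t.conductor_dvd_L hL), inv_one]
  · rw [t.eigenvalue_of_dvd_L hℓ hM ((t.dvd_M_or_dvd_L hℓ hd).resolve_left hM), norm_mul,
      norm_psiVal _ (hcop t.conductor_dvd_M hM), mul_one, Complex.norm_natCast]

/-- The three possible absolute values `0`, `1`, `ℓ` are distinct and correspond to the three ways a
prime divisor of `D` can divide `M L`. -/
lemma dvd_iff_of_norm_eigenvalue_eq {t t' : EisIndex D C} {ℓ : ℕ} (hℓ : ℓ.Prime) (hd : ℓ ∣ D)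
    (h : ‖t.eigenvalue ℓ‖ = ‖t'.eigenvalue ℓ‖) :
    (ℓ ∣ t.M ↔ ℓ ∣ t'.M) ∧ (ℓ ∣ t.L ↔ ℓ ∣ t'.L) := by
  rw [t.norm_eigenvalue hℓ hd, t'.norm_eigenvalue hℓ hd] at h
  have h1 : (1 : ℝ) < ℓ := by exact_mod_cast hℓ.one_lt
  have hor := t.dvd_M_or_dvd_L hℓ hd
  have hor' := t'.dvd_M_or_dvd_L hℓ hd
  split_ifs at h <;> first | tauto | linarith

lemma ext_of_eigenvalue (hD : Squarefree D) {t t' : EisIndex D C}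
    (h : ∀ ℓ : ℕ, ℓ.Prime → t.eigenvalue ℓ = t'.eigenvalue ℓ) : t = t' := by
  have hM : t.M = t'.M := by
    rw [Nat.Squarefree.ext_iff (t.squarefree_M hD) (t'.squarefree_M hD)]
    refine fun ℓ hℓ => ?_
    by_cases hd : ℓ ∣ D
    · exact (dvd_iff_of_norm_eigenvalue_eq hℓ hd (by rw [h ℓ hℓ])).1
    · exact iff_of_false (fun h => hd (h.trans t.M_dvd)) (fun h => hd (h.trans t'.M_dvd))
  have hL : t.L = t'.L := by
    rw [Nat.Squarefree.ext_iff (t.squarefree_L hD) (t'.squarefree_L hD)]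
    refine fun ℓ hℓ => ?_
    by_cases hd : ℓ ∣ D
    · exact (dvd_iff_of_norm_eigenvalue_eq hℓ hd (by rw [h ℓ hℓ])).2
    · exact iff_of_false (fun h => hd (h.trans t.L_dvd)) (fun h => hd (h.trans t'.L_dvd))
  have hval (ℓ : ℕ) (hℓ : ℓ.Prime) (hd : ¬ ℓ ∣ D) :
      t.ψ (ℓ : ZMod _) = t'.ψ (ℓ : ZMod _) := by
    have h1 := h ℓ hℓ
    have hcop (t : EisIndex D C) : ℓ.Coprime (Nat.gcd t.M t.L) :=
      hℓ.coprime_iff_not_dvd.mpr fun h => hd (h.trans ((Nat.gcd_dvd_left _ _).trans t.M_dvd))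
    rw [t.eigenvalue_of_not_dvd hℓ hd, t'.eigenvalue_of_not_dvd hℓ hd, psiInvVal_eq_inv,
      psiInvVal_eq_inv] at h1
    rw [← psiVal_of_coprime _ (hcop t), ← psiVal_of_coprime _ (hcop t')]
    exact eq_of_inv_add_mul_eq (norm_psiVal _ ((hcop t).coprime_dvd_right t.ψ.conductor_dvd_level))
      (norm_psiVal _ ((hcop t').coprime_dvd_right t'.ψ.conductor_dvd_level)) hℓ.one_lt h1
  have hD0 := hD.ne_zero
  obtain ⟨M, L, hM1, _, _, _, _, _, _, ψ⟩ := t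
  obtain ⟨M', L', _, _, _, _, _, _, _, ψ'⟩ := t'
  dsimp only at hM hL
  subst hM
  subst hL
  simp only at hval
  have : NeZero (Nat.gcd M L) := ⟨(Nat.gcd_pos_of_pos_left _ hM1).ne'⟩
  have hψ : ψ = ψ' := MulChar.ext fun a => by
    -- By Dirichlet's theorem each unit class contains a prime, and `ℓ > D` ensures `ℓ ∤ D`.
    obtain ⟨ℓ, hℓD, hℓ, hℓa⟩ := Nat.forall_exists_prime_gt_and_eq_mod a.isUnit D
    rw [← hℓa]
    exact hval ℓ hℓ fun hd => (Nat.le_of_dvd (Nat.pos_of_ne_zero hD0) hd).not_gt hℓD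
  subst hψ
  rfl

end EisIndex

theorem linearIndependent_eisSeries {D C : ℕ} (hD : Squarefree D) (hC : C ∣ D) :
    LinearIndependent ℂ (fun t : EisIndex D C => eisSeries t) :=
  linearIndependent_of_eigenvalues _ (eisSeries_ne_zero hD hC)
    (fun ℓ : {ℓ : ℕ // ℓ.Prime} => heckeLinear (D * C) ℓ.1 ℓ.2) (fun t ℓ => t.eigenvalue ℓ.1)
    (fun t ℓ => t.heckeOp_eisSeries hD hC ℓ.2) fun _ _ h =>
      EisIndex.ext_of_eigenvalue hD fun ℓ hℓ => congrFun h ⟨ℓ, hℓ⟩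

end


/-! ### Cusps, constant terms and spanning. -/

noncomputable section

open Filter Topology

section Arithmetic

variable {D C : ℕ}

lemma dvd_gcd_mul_gcd_div {d : ℕ} (hd : d ∣ D * C) :
    D ∣ Nat.gcd D (D * C / d) * Nat.gcd D d := by
  have h : D ∣ D * C / d * d := by
    rw [Nat.div_mul_cancel hd]
    exact dvd_mul_right _ _
  exact (Nat.dvd_gcd dvd_rfl h).trans (Nat.gcd_mul_right_dvd_mul_gcd _ _ _)

lemma gcd_mul_gcd_div_dvd {d : ℕ} (hd : d ∣ D * C) :
    Nat.gcd D (D * C / d) * Nat.gcd D d ∣ D * C := by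
  conv_rhs => rw [← Nat.div_mul_cancel hd]
  exact mul_dvd_mul (Nat.gcd_dvd_right _ _) (Nat.gcd_dvd_right _ _)

/-- At each prime the exponent in `D C` is at most `2`, so that of `d` is recovered from whether the
prime divides `d` and whether it divides `D C / d`. -/
lemma eq_of_gcd_eq_of_gcd_div_eq (hD : Squarefree D) (hC : C ∣ D) {d d' : ℕ} (hd : d ∣ D * C)
    (hd' : d' ∣ D * C) (h1 : Nat.gcd D d = Nat.gcd D d')
    (h2 : Nat.gcd D (D * C / d) = Nat.gcd D (D * C / d')) : d = d' := by
  have hD0 := hD.ne_zero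
  have hC0 : C ≠ 0 := ne_zero_of_dvd_ne_zero hD0 hC
  have hN0 : D * C ≠ 0 := mul_ne_zero hD0 hC0
  have hd0 := ne_zero_of_dvd_ne_zero hN0 hd
  have hd0' := ne_zero_of_dvd_ne_zero hN0 hd'
  have hq {d : ℕ} (hd : d ∣ D * C) : D * C / d ≠ 0 :=
    ne_zero_of_dvd_ne_zero hN0 (Nat.div_dvd_of_dvd hd)
  refine Nat.eq_of_factorization_eq hd0 hd0' fun p => ?_
  have e1 := congrArg (fun n => n.factorization p) h1
  have e2 := congrArg (fun n => n.factorization p) h2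
  have hle := (Nat.factorization_le_iff_dvd hd0 hN0).mpr hd p
  have hle' := (Nat.factorization_le_iff_dvd hd0' hN0).mpr hd' p
  have hCD := (Nat.factorization_le_iff_dvd hC0 hD0).mpr hC p
  have hD1 := hD.natFactorization_le_one p
  simp only [Nat.factorization_gcd hD0 hd0, Nat.factorization_gcd hD0 hd0',
    Nat.factorization_gcd hD0 (hq hd), Nat.factorization_gcd hD0 (hq hd'),
    Nat.factorization_div hd, Nat.factorization_div hd', Finsupp.inf_apply, Finsupp.tsub_apply,
    Nat.factorization_mul hD0 hC0, Finsupp.add_apply] at e1 e2 hle hle'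
  omega

/-- The square of `gcd(d, DC/d)` divides `D C`, hence `D²`. So a residue modulo `gcd(M, L)` is fine
enough to separate cusps with the same `d`. -/
lemma gcd_div_dvd (hC : C ∣ D) {d : ℕ} (hd : d ∣ D * C) :
    Nat.gcd d (D * C / d) ∣ Nat.gcd (Nat.gcd D (D * C / d)) (Nat.gcd D d) := by
  have h : Nat.gcd d (D * C / d) ^ 2 ∣ D ^ 2 := by
    rw [pow_two, pow_two]
    refine dvd_trans ?_ (mul_dvd_mul_left D hC)
    conv_rhs => rw [← Nat.mul_div_cancel' hd]
    exact mul_dvd_mul (Nat.gcd_dvd_left _ _) (Nat.gcd_dvd_right _ _)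
  have hD' := (Nat.pow_dvd_pow_iff two_ne_zero).mp h
  exact Nat.dvd_gcd (Nat.dvd_gcd hD' (Nat.gcd_dvd_right _ _))
    (Nat.dvd_gcd hD' (Nat.gcd_dvd_left _ _))

end Arithmetic

/-- Only the counting of cusps uses this, so any bijection between sets of equal size will do. -/
lemma exists_equiv_units (n : ℕ) [NeZero n] : Nonempty (DirichletCharacter ℂ n ≃ (ZMod n)ˣ) := by
  rw [← Finite.card_eq, DirichletCharacter.card_eq_totient_of_hasEnoughRootsOfUnity,
    Nat.card_eq_fintype_card, ZMod.card_units_eq_totient]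

/-- A bijection between the Dirichlet characters and the units modulo `n`. -/
def characterEquivUnits (n : ℕ) [NeZero n] : DirichletCharacter ℂ n ≃ (ZMod n)ˣ :=
  (exists_equiv_units n).some

variable {D C : ℕ}

/-- The cusp `γ ∞` of `Γ₀(DC)` corresponds to the index `t`. -/
def CuspRel (γ : SL(2, ℤ)) (t : EisIndex D C) : Prop :=
  t.L = Nat.gcd D (Int.gcd (γ 1 0) (D * C : ℕ)) ∧
    t.M = Nat.gcd D (D * C / Int.gcd (γ 1 0) (D * C : ℕ)) ∧
    ((γ 1 1 : ℤ) : ZMod (Nat.gcd t.M t.L)) =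
      characterEquivUnits (Nat.gcd t.M t.L) t.ψ *
        ((γ 1 0 / (Int.gcd (γ 1 0) (D * C : ℕ) : ℤ) : ℤ) : ZMod (Nat.gcd t.M t.L))

lemma exists_mul_zpow_mul_inv_mem {N : ℕ} {γ γ' : SL(2, ℤ)} {d c c' n : ℤ} (hN : N = d * n)
    (hγ : γ 1 0 = d * c) (hγ' : γ' 1 0 = d * c') (hc : IsCoprime c n) (hc' : IsCoprime c' n)
    (h : (Int.gcd d n : ℤ) ∣ c * γ' 1 1 - c' * γ 1 1) :
    ∃ j : ℤ, γ * ModularGroup.T ^ j * γ'⁻¹ ∈ Gamma0 N := by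
  obtain ⟨k, hk⟩ := h
  rw [Int.gcd_eq_gcd_ab] at hk
  obtain ⟨w, s, hws⟩ := hc.mul_left hc'
  -- After division by `d`, the lower left entry is `c δ' - c' δ - j d c c'`, with `δ`, `δ'` the
  -- lower right entries. Modulo `n` the difference `c δ' - c' δ` is the Bézout coefficient times `d
  -- k`, and `w` inverts `c c'`.
  refine ⟨Int.gcdA d n * k * w, ?_⟩
  rw [Gamma0_mem, ZMod.intCast_zmod_eq_zero_iff_dvd, hN]
  have e : (γ * ModularGroup.T ^ (Int.gcdA d n * k * w) * γ'⁻¹) 1 0 =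
      d * (c * γ' 1 1 - c' * γ 1 1) - Int.gcdA d n * k * w * (d * c) * (d * c') := by
    rw [← hγ, ← hγ']
    simp [Matrix.SpecialLinearGroup.coe_mul, ModularGroup.coe_T_zpow, Matrix.mul_apply,
      Fin.sum_univ_two, Matrix.SpecialLinearGroup.coe_inv, Matrix.adjugate_fin_two]
    linear_combination (γ' 1 1 : ℤ) * hγ - (γ 1 1 : ℤ) * hγ'
  rw [e, hk]
  refine ⟨Int.gcdB d n * k + d * Int.gcdA d n * k * s, ?_⟩
  linear_combination (-d * d * Int.gcdA d n * k) * hws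

lemma isCoprime_div_gcd {c N : ℤ} (h : N ≠ 0) :
    IsCoprime (c / Int.gcd c N) (N / Int.gcd c N) := by
  rw [Int.isCoprime_iff_gcd_eq_one]
  exact Int.gcd_div_gcd_div_gcd (Int.gcd_pos_of_ne_zero_right _ h)

/-- `M` and `L` determine `d`, and the character fixes the ratio of lower right entry to reduced
lower left entry modulo `gcd(M, L)`, which is the congruence needed for equivalence. -/
theorem CuspRel.exists_mem_Gamma0 (hD : Squarefree D) (hC : C ∣ D) {γ γ' : SL(2, ℤ)}
    {t : EisIndex D C} (h : CuspRel γ t) (h' : CuspRel γ' t) :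
    ∃ j : ℤ, γ * ModularGroup.T ^ j * γ'⁻¹ ∈ Gamma0 (D * C) := by
  have hN0 : D * C ≠ 0 := mul_ne_zero hD.ne_zero (ne_zero_of_dvd_ne_zero hD.ne_zero hC)
  have hN0' : ((D * C : ℕ) : ℤ) ≠ 0 := by exact_mod_cast hN0
  obtain ⟨h1, h2, h3⟩ := h
  obtain ⟨h1', h2', h3'⟩ := h'
  have hdvd (c : ℤ) : Int.gcd c (D * C : ℕ) ∣ D * C := by
    exact_mod_cast Int.gcd_dvd_right c ((D * C : ℕ) : ℤ)
  have hdd : Int.gcd (γ' 1 0) (D * C : ℕ) = Int.gcd (γ 1 0) (D * C : ℕ) :=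
    eq_of_gcd_eq_of_gcd_div_eq hD hC (hdvd _) (hdvd _) (by rw [← h1, ← h1']) (by rw [← h2, ← h2'])
  have hco := isCoprime_div_gcd (c := γ 1 0) hN0'
  have hco' := isCoprime_div_gcd (c := γ' 1 0) hN0'
  have hg : Nat.gcd (Int.gcd (γ 1 0) (D * C : ℕ)) (D * C / Int.gcd (γ 1 0) (D * C : ℕ)) ∣
      Nat.gcd t.M t.L := by
    rw [h1, h2]
    exact gcd_div_dvd hC (hdvd _)
  rw [hdd] at h3' hco'
  have e1 := (Int.mul_ediv_cancel' (Int.gcd_dvd_left (γ 1 0) ((D * C : ℕ) : ℤ))).symm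
  have e1' := (Int.mul_ediv_cancel' (Int.gcd_dvd_left (γ' 1 0) ((D * C : ℕ) : ℤ))).symm
  rw [hdd] at e1'
  have e2 := (Int.mul_ediv_cancel' (Int.gcd_dvd_right (γ 1 0) ((D * C : ℕ) : ℤ))).symm
  refine exists_mul_zpow_mul_inv_mem e2 e1 e1' hco hco' ?_
  refine (Int.natCast_dvd_natCast.mpr ?_ : _ ∣ ((Nat.gcd t.M t.L : ℕ) : ℤ)).trans ?_
  · rw [← Int.natCast_div, Int.gcd_natCast_natCast]
    exact hg
  · rw [← ZMod.intCast_zmod_eq_zero_iff_dvd]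
    rw [Int.cast_sub, Int.cast_mul, Int.cast_mul, h3, h3']
    ring

theorem exists_cuspRel (hD : Squarefree D) (hC : C ∣ D) {γ : SL(2, ℤ)}
    (hγ : γ ∉ Gamma0 (D * C)) : ∃ t : EisIndex D C, CuspRel γ t := by
  have hN0 : D * C ≠ 0 := mul_ne_zero hD.ne_zero (ne_zero_of_dvd_ne_zero hD.ne_zero hC)
  have hN0' : ((D * C : ℕ) : ℤ) ≠ 0 := by exact_mod_cast hN0
  rw [Gamma0_mem, ZMod.intCast_zmod_eq_zero_iff_dvd] at hγ
  set d := Int.gcd (γ 1 0) (D * C : ℕ) with hd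
  have hdN : d ∣ D * C := by exact_mod_cast Int.gcd_dvd_right (γ 1 0) ((D * C : ℕ) : ℤ)
  have hdc : (d : ℤ) ∣ γ 1 0 := Int.gcd_dvd_left _ _
  set M := Nat.gcd D (D * C / d) with hM
  set L := Nat.gcd D d with hL
  -- Not being in `Γ₀(DC)` means `d ≠ D C`; a prime of `D C / d` then divides `D` because `C ∣ D`.
  have hM1 : M ≠ 1 := by
    intro h1
    have hne : D * C / d ≠ 1 := by
      intro h
      rw [← Nat.eq_of_dvd_of_div_eq_one hdN h] at hγ
      exact hγ hdc
    obtain ⟨p, hp, hpd⟩ := Nat.exists_prime_and_dvd hne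
    have hpD : p ∣ D := (hp.dvd_mul.mp (hpd.trans (Nat.div_dvd_of_dvd hdN))).elim id
      fun h => h.trans hC
    have := Nat.dvd_gcd hpD hpd
    rw [← hM, h1] at this
    exact hp.not_dvd_one this
  have hMpos : 1 ≤ M := Nat.gcd_pos_of_pos_left _ (Nat.pos_of_ne_zero hD.ne_zero)
  have hLpos : 1 ≤ L := Nat.gcd_pos_of_pos_left _ (Nat.pos_of_ne_zero hD.ne_zero)
  have : NeZero (Nat.gcd M L) := ⟨(Nat.gcd_pos_of_pos_left _ hMpos).ne'⟩
  have hco := isCoprime_div_gcd (c := γ 1 0) hN0'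
  have hgM : Nat.gcd M L ∣ D * C / d := (Nat.gcd_dvd_left _ _).trans (Nat.gcd_dvd_right _ _)
  have hgL : Nat.gcd M L ∣ d := (Nat.gcd_dvd_right _ _).trans (Nat.gcd_dvd_right _ _)
  have hu1 : IsUnit ((γ 1 0 / (d : ℤ) : ℤ) : ZMod (Nat.gcd M L)) := by
    obtain ⟨a, b, hab⟩ := hco
    rw [← hd, ← Int.natCast_div] at hab
    have h := congrArg (Int.cast : ℤ → ZMod (Nat.gcd M L)) hab
    rw [Int.cast_add, Int.cast_mul, Int.cast_mul, Int.cast_natCast,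
      (ZMod.natCast_eq_zero_iff _ _).mpr hgM, mul_zero, add_zero, Int.cast_one, mul_comm] at h
    exact IsUnit.of_mul_eq_one _ h
  have hu2 : IsUnit ((γ 1 1 : ℤ) : ZMod (Nat.gcd M L)) := by
    have hdet := SL_det_cast (ZMod (Nat.gcd M L)) γ
    rw [(ZMod.intCast_zmod_eq_zero_iff_dvd (γ 1 0) _).mpr
      ((Int.natCast_dvd_natCast.mpr hgL).trans hdc), mul_zero, sub_zero, mul_comm] at hdet
    exact IsUnit.of_mul_eq_one _ hdet
  refine ⟨⟨M, L, hMpos, hLpos, Nat.gcd_dvd_left _ _, Nat.gcd_dvd_left _ _, hM1,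
    dvd_gcd_mul_gcd_div hdN, gcd_mul_gcd_div_dvd hdN,
    (characterEquivUnits _).symm (hu2.unit * hu1.unit⁻¹)⟩, rfl, rfl, ?_⟩
  simp only [Equiv.apply_symm_apply, Units.val_mul, IsUnit.unit_spec, ← hd]
  rw [mul_assoc, IsUnit.val_inv_mul, mul_one]

lemma Tendsto.slash_T_zpow {g : ℍ → ℂ} {a : ℂ} (h : Tendsto g atImInfty (𝓝 a)) (j : ℤ) :
    Tendsto (g ∣[(2 : ℤ)] (ModularGroup.T ^ j)) atImInfty (𝓝 a) := by
  have e : g ∣[(2 : ℤ)] (ModularGroup.T ^ j) = g ∘ fun z => ModularGroup.T ^ j • z := by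
    ext z
    rw [ModularForm.SL_slash_apply, ModularGroup.denom_apply]
    simp [ModularGroup.coe_T_zpow]
  rw [e]
  refine h.comp (tendsto_comap_iff.mpr ?_)
  have : UpperHalfPlane.im ∘ (fun z : ℍ => ModularGroup.T ^ j • z) = UpperHalfPlane.im :=
    funext fun z => ModularGroup.im_T_zpow_smul z j
  rw [this]
  exact tendsto_comap

lemma tendsto_slash_of_cuspRel (hD : Squarefree D) (hC : C ∣ D) {γ γ' : SL(2, ℤ)}
    {t : EisIndex D C} (h : CuspRel γ t) (h' : CuspRel γ' t) {f : ℍ → ℂ}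
    (hf : f ∈ heckeInvariants (D * C)) {a : ℂ} (ha : Tendsto (f ∣[(2 : ℤ)] γ) atImInfty (𝓝 a)) :
    Tendsto (f ∣[(2 : ℤ)] γ') atImInfty (𝓝 a) := by
  obtain ⟨j, hj⟩ := h.exists_mem_Gamma0 hD hC h'
  have e : f ∣[(2 : ℤ)] γ' = (f ∣[(2 : ℤ)] γ) ∣[(2 : ℤ)] (ModularGroup.T ^ j) := by
    conv_lhs => rw [← hf.2 _ hj]
    rw [← SlashAction.slash_mul, ← SlashAction.slash_mul, inv_mul_cancel_right]
  rw [e]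
  exact Tendsto.slash_T_zpow ha j

/-- The residue theorem for weight two: if the constant terms at all cusps but `∞` vanish, so does
the one at `∞`. -/
lemma eq_zero_of_tendsto_slash {N : ℕ} [NeZero N] {f : ℍ → ℂ} (hf : f ∈ heckeInvariants N) {a : ℂ}
    (ha : Tendsto f atImInfty (𝓝 a))
    (h : ∀ γ : SL(2, ℤ), γ ∉ Gamma0 N → Tendsto (f ∣[(2 : ℤ)] γ) atImInfty (𝓝 0)) : a = 0 := by
  classical
  have hmem := hf
  rw [← eisensteinSpace_eq_heckeInvariants] at hmem
  obtain ⟨F, rfl⟩ := hmem.1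
  -- The trace has level one and weight two, where every form is zero. Of the cosets it sums over,
  -- only the trivial one has a constant term that is not assumed to vanish.
  have h0 : ModularForm.trace 𝒮ℒ F = 0 := rank_zero_iff_forall_zero.mp levelOne_weight_two_rank_zero _
  let Q := 𝒮ℒ ⧸ (Subgroup.subgroupOf (Gamma0 N : Subgroup (GL (Fin 2) ℝ)) 𝒮ℒ)
  let := Fintype.ofFinite Q
  have h1 : ∑ q : Q, SlashInvariantForm.quotientFunc F q = 0 := by
    rw [← ModularForm.coe_trace, h0]
    rfl
  have hq (q : Q) : Tendsto (SlashInvariantForm.quotientFunc F q) atImInfty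
      (𝓝 (if q = ((1 : 𝒮ℒ) : Q) then a else 0)) := by
    induction q using Quotient.inductionOn with
    | h r =>
    obtain ⟨_, γ, rfl⟩ := r
    have hiff : (⟦⟨Matrix.SpecialLinearGroup.mapGL ℝ γ, γ, rfl⟩⟧ : Q) = ((1 : 𝒮ℒ) : Q) ↔
        γ⁻¹ ∈ Gamma0 N := by
      refine QuotientGroup.eq.trans ?_
      rw [mul_one, Subgroup.mem_subgroupOf, Subgroup.coe_inv, ← map_inv]
      exact Subgroup.mem_map_iff_mem Matrix.SpecialLinearGroup.mapGL_injective
    rw [SlashInvariantForm.quotientFunc_mk]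
    have e : (F : ℍ → ℂ) ∣[(2 : ℤ)] ((Matrix.SpecialLinearGroup.mapGL ℝ) γ)⁻¹ =
        (F : ℍ → ℂ) ∣[(2 : ℤ)] γ⁻¹ := by
      rw [← map_inv]
      rfl
    simp only [e, hiff]
    split_ifs with hγ
    · rw [hf.2 _ hγ]
      exact ha
    · exact h _ hγ
  have h2 := tendsto_finsetSum Finset.univ fun q _ => hq q
  rw [Finset.sum_ite_eq' Finset.univ, if_pos (Finset.mem_univ _)] at h2
  refine tendsto_nhds_unique h2 ?_
  have h3 : (fun z => ∑ q : Q, SlashInvariantForm.quotientFunc F q z) = 0 := by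
    rw [← h1]
    ext z
    rw [Finset.sum_apply]
  rw [h3]
  exact tendsto_const_nhds

/-- The constant term at `∞`, as a linear map. -/
def constTerm : heckeSpan →ₗ[ℂ] ℂ where
  toFun f := limUnder atImInfty (f : ℍ → ℂ)
  map_add' f g := ((tendsto_nhds_limUnder (exists_tendsto_of_mem_heckeSpan f.2)).add
    (tendsto_nhds_limUnder (exists_tendsto_of_mem_heckeSpan g.2))).limUnder_eq
  map_smul' c f :=
    ((tendsto_nhds_limUnder (exists_tendsto_of_mem_heckeSpan f.2)).const_smul c).limUnder_eq

lemma tendsto_constTerm (f : heckeSpan) : Tendsto (f : ℍ → ℂ) atImInfty (𝓝 (constTerm f)) :=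
  tendsto_nhds_limUnder (exists_tendsto_of_mem_heckeSpan f.2)

/-- The weight two slash operator on linear combinations of Eisenstein series, restricted to forms
that are invariant under `Γ₀(N)`. -/
def slashLinear (N : ℕ) (γ : SL(2, ℤ)) : heckeInvariants N →ₗ[ℂ] heckeSpan where
  toFun f := ⟨(f : ℍ → ℂ) ∣[(2 : ℤ)] γ, slash_mem_heckeSpan f.2.1 γ⟩
  map_add' _ _ := Subtype.ext (SlashAction.add_slash _ _ _ _)
  map_smul' _ _ := Subtype.ext (ModularForm.SL_smul_slash _ _ _ _)

open Classical in
/-- A representative of the cusp attached to the index `t`. -/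
def cuspRep (t : EisIndex D C) : SL(2, ℤ) := if h : ∃ γ, CuspRel γ t then h.choose else 1

lemma cuspRel_cuspRep {γ : SL(2, ℤ)} {t : EisIndex D C} (h : CuspRel γ t) :
    CuspRel (cuspRep t) t := by
  have h' : ∃ γ, CuspRel γ t := ⟨γ, h⟩
  rw [cuspRep, dif_pos h']
  exact h'.choose_spec

/-- The constant terms at the cusps attached to the indices. -/
def constTerms (D C : ℕ) : heckeInvariants (D * C) →ₗ[ℂ] EisIndex D C → ℂ :=
  LinearMap.pi fun t => constTerm ∘ₗ slashLinear (D * C) (cuspRep t)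

/-- Every cusp other than `∞` carries some index, so its constant term is among the recorded ones up
to equivalence. Indices that no matrix realizes have the default representative `1`, which is
harmless for injectivity. -/
lemma constTerms_injective (hD : Squarefree D) (hC : C ∣ D) :
    Function.Injective (constTerms D C) := by
  have : NeZero (D * C) :=
    ⟨mul_ne_zero hD.ne_zero (ne_zero_of_dvd_ne_zero hD.ne_zero hC)⟩
  rw [injective_iff_map_eq_zero]
  rintro ⟨f, hf⟩ h
  have hzero (γ : SL(2, ℤ)) (hγ : γ ∉ Gamma0 (D * C)) :
      Tendsto (f ∣[(2 : ℤ)] γ) atImInfty (𝓝 0) := by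
    obtain ⟨t, ht⟩ := exists_cuspRel hD hC hγ
    refine tendsto_slash_of_cuspRel hD hC (cuspRel_cuspRep ht) ht hf ?_
    have h0 := tendsto_constTerm (slashLinear (D * C) (cuspRep t) ⟨f, hf⟩)
    rwa [show constTerm (slashLinear (D * C) (cuspRep t) ⟨f, hf⟩) = 0 from congrFun h t] at h0
  obtain ⟨a, ha⟩ := exists_tendsto_of_mem_heckeSpan hf.1
  -- The cusp `∞` has to be treated apart, since `exists_cuspRel` gives an index only to matrices
  -- outside `Γ₀(DC)`.
  have ha0 := eq_zero_of_tendsto_slash hf ha hzero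
  refine Subtype.ext (eq_zero_of_tendsto_zero hf.1 fun γ => ?_)
  by_cases hγ : γ ∈ Gamma0 (D * C)
  · rw [hf.2 γ hγ, ← ha0]
    exact ha
  · exact hzero γ hγ

lemma finite_eisIndex (hD : D ≠ 0) : Finite (EisIndex D C) := by
  have (p : Set.Icc 1 D × Set.Icc 1 D) : NeZero (Nat.gcd p.1 p.2) :=
    ⟨(Nat.gcd_pos_of_pos_left _ p.1.2.1).ne'⟩
  have hfin : Finite (Σ p : Set.Icc 1 D × Set.Icc 1 D, DirichletCharacter ℂ (Nat.gcd p.1 p.2)) :=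
    inferInstance
  have hle {K : ℕ} (h : K ∣ D) : K ≤ D := Nat.le_of_dvd (Nat.pos_of_ne_zero hD) h
  refine Finite.of_injective (β := Σ p : Set.Icc 1 D × Set.Icc 1 D,
    DirichletCharacter ℂ (Nat.gcd p.1 p.2)) (fun t => ⟨(⟨t.M, t.M_pos, hle t.M_dvd⟩,
      ⟨t.L, t.L_pos, hle t.L_dvd⟩), t.ψ⟩) ?_
  rintro ⟨M, L, _, _, _, _, _, _, _, ψ⟩ ⟨M', L', _, _, _, _, _, _, _, ψ'⟩ h
  simp only [Sigma.mk.injEq, Prod.mk.injEq] at h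
  obtain ⟨⟨h1, h2⟩, h⟩ := h
  obtain rfl : M = M' := congrArg Subtype.val h1
  obtain rfl : L = L' := congrArg Subtype.val h2
  rw [eq_of_heq h]

/-- The constant terms bound the dimension by the number of indices, which is also the dimension of
the span of the independent `E_{M,L,ψ}`. -/
theorem span_eisSeries (hD : Squarefree D) (hC : C ∣ D) :
    Submodule.span ℂ (Set.range fun t : EisIndex D C => eisSeries t) =
      eisensteinSpace (D * C) := by
  have : NeZero (D * C) :=
    ⟨mul_ne_zero hD.ne_zero (ne_zero_of_dvd_ne_zero hD.ne_zero hC)⟩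
  have := finite_eisIndex (C := C) hD.ne_zero
  have := Fintype.ofFinite (EisIndex D C)
  have hinj := constTerms_injective hD hC
  have hfd : FiniteDimensional ℂ (heckeInvariants (D * C)) := FiniteDimensional.of_injective _ hinj
  rw [eisensteinSpace_eq_heckeInvariants]
  refine Submodule.eq_of_le_of_finrank_le ?_ ?_
  · rw [Submodule.span_le]
    rintro _ ⟨t, rfl⟩
    exact eisSeries_mem_heckeInvariants hD t
  · rw [finrank_span_eq_card (linearIndependent_eisSeries hD hC)]
    refine (LinearMap.finrank_le_finrank_of_injective hinj).trans ?_
    rw [Module.finrank_fintype_fun_eq_card]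

end

theorem proposition3 (D C : ℕ) (hD : Squarefree D) (hC : C ∣ D) :
    (∀ t : EisIndex D C,
      (qExpansion 1 (eisSeries t)).coeff 1 = 1 ∧ eisSeries t ≠ 0) ∧
    (∀ (t : EisIndex D C) (ℓ : ℕ) (hℓ : ℓ.Prime),
      (¬ ℓ ∣ D → heckeOp (D * C) ℓ hℓ (eisSeries t) =
        (psiInvVal t.ψ ℓ + (ℓ : ℂ) * psiVal t.ψ ℓ) • eisSeries t) ∧
      (ℓ ∣ t.M / Nat.gcd t.M t.L → heckeOp (D * C) ℓ hℓ (eisSeries t) =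
        psiInvVal t.ψ ℓ • eisSeries t) ∧
      (ℓ ∣ t.L / Nat.gcd t.M t.L → heckeOp (D * C) ℓ hℓ (eisSeries t) =
        ((ℓ : ℂ) * psiVal t.ψ ℓ) • eisSeries t) ∧
      (ℓ ∣ Nat.gcd t.M t.L → heckeOp (D * C) ℓ hℓ (eisSeries t) = 0)) ∧
    (LinearIndependent ℂ (fun t : EisIndex D C => eisSeries t) ∧
      Submodule.span ℂ (Set.range fun t : EisIndex D C => eisSeries t) =
        eisensteinSpace (D * C)) :=
  ⟨fun t => ⟨qExpansion_coeff_one_eisSeries hD hC t, eisSeries_ne_zero hD hC t⟩,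
    heckeOp_eisSeries_cases hD hC, linearIndependent_eisSeries hD hC, span_eisSeries hD hC⟩
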